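/- Let $c_0>0$, $\omega>0$, $0<\rho_0<\rho_1$, let $d\in\{2,3\}$, and let $\Omega\subset\mathbb{R}^d$ be contained in the ball $\{|x|<\rho_0-\epsilon\}$ for some $\epsilon>0$. Consider the Cauchy problem $$\partial_t^2 v-c_0^2\Delta v=0\quad (x\in\mathbb{R}^d,\ t>0),\qquad v(x,0)=v_0(x),\quad \partial_t v(x,0)=v_1(x)\quad (x\in\mathbb{R}^d),$$ with complex-valued data $v_0,v_1$. For a function $f$ write $N[f]:=|f|+|\nabla f|+|\Delta f|+|\nabla\Delta f|+|\Delta^2 f|$. For $d=2$, assume that $$v_0(x)=A_0(|x|)\,Y_0\!\left(\tfrac{x}{|x|}\right)+V_0(x),\qquad v_1(x)=A_0(|x|)\,Y_1\!\left(\tfrac{x}{|x|}\right)+V_1(x),$$ where $A_0\in C^5([0,\infty))$, $Y_0,Y_1\in C^5(\mathbb{S}^1)$, and $V_0,V_1\in C^5_b(\mathbb{R}^2)$ (all derivatives of order at most $5$ are continuous and bounded) are complex-valued; $A_0(|x|)=V_0(x)=V_1(x)=0$ for $|x|\le\rho_0$ (the first terms are understood to be $0$ at $x=0$); $A_0(\rho)=e^{i\omega\rho/c_0}/\rho^{3/2}$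 for $\rho>\rho_1$; and there is a constant $C_0>0$ such that $|x|^{5/2}\left(N[V_0](x)+N[V_1](x)\right)\le C_0$ for all $x\in\mathbb{R}^2$. For $d=3$, assume that $v_0\in W^{5,\infty}(\mathbb{R}^3)$ and $v_1\in W^{4,\infty}(\mathbb{R}^3)$, taken as their continuous representatives, and that there is a constant $C_0>0$ such that $|x|^{2}\left(N[v_0](x)+N[v_1](x)\right)\le C_0$ for almost every $x\in\mathbb{R}^3$. Then there is a constant $C>0$ such that the classical solution $v\in C^2(\mathbb{R}^d\times[0,\infty))$ of the Cauchy problem is of class $C^3(\mathbb{R}^d\times[0,\infty))$ and satisfies, for all $x\in\Omega$ and all $t\ge 0$, $$|v(x,t)|+|\nabla v(x,t)|+|\partial_t v(x,t)|+|\Delta v(x,t)|+|\partial_t\nabla v(x,t)|+|\partial_t\Delta v(x,t)|\le\frac{C}{(1+t^2)^{1/2}}.$$ -/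

import Mathlib

noncomputable section

namespace WaveDecay

open Set MeasureTheory
open scoped Manifold EuclideanSpace

/-- The space `ℝ^d` with its Euclidean norm. -/
abbrev Sp (d : ℕ) : Type := EuclideanSpace ℝ (Fin d)

/-- The unit sphere `S^{d-1}` of `ℝ^d`, centered at the origin. -/
abbrev USphere (d : ℕ) : Type := Metric.sphere (0 : Sp d) 1

/-- The partial derivative `∂f/∂x_j` at `x`, with values in a real normed space. -/
def partialDeriv {d : ℕ} {F : Type*} [NormedAddCommGroup F] [NormedSpace ℝ F]
    (f : Sp d → F) (j : Fin d) (x : Sp d) : F :=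
  fderiv ℝ f x (EuclideanSpace.single j (1 : ℝ))

/-- The gradient `(∂f/∂x_1, …, ∂f/∂x_d)` of a complex-valued function, a vector of `ℂ^d`
with its Hermitian norm. -/
def grad {d : ℕ} (f : Sp d → ℂ) (x : Sp d) : EuclideanSpace ℂ (Fin d) :=
  WithLp.toLp 2 (fun j => partialDeriv f j x)

/-- The Laplacian of a complex-valued function on `ℝ^d` (Mathlib's Laplacian). -/
abbrev lap {d : ℕ} (f : Sp d → ℂ) : Sp d → ℂ := Laplacian.laplacian f

/-- The time derivative of a function of `(x, t)` on `ℝ^d × [0, ∞)`; it is the ordinary derivative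
for `t > 0` and the right derivative at `t = 0`. -/
def timeDeriv {d : ℕ} {F : Type*} [NormedAddCommGroup F] [NormedSpace ℝ F]
    (w : Sp d → ℝ → F) (x : Sp d) (t : ℝ) : F :=
  derivWithin (w x) (Ici 0) t

/-- `v` belongs to `C^n(ℝ^d × [0, ∞))`. -/
def IsCnUpToInitialTime {d : ℕ} (n : ℕ) (v : Sp d → ℝ → ℂ) : Prop :=
  ContDiffOn ℝ n (fun p : Sp d × ℝ => v p.1 p.2) (univ ×ˢ Ici 0)

/-- `v` is a classical solution, of class `C²(ℝ^d × [0, ∞))`, of the Cauchy problem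
`∂_t² v - c₀² Δ v = 0` for `t > 0`, `v(·, 0) = v₀`, `∂_t v(·, 0) = v₁`.
The values of `v` at negative times play no role. -/
structure IsClassicalSolution {d : ℕ} (c₀ : ℝ) (v₀ v₁ : Sp d → ℂ) (v : Sp d → ℝ → ℂ) : Prop where
  regular : IsCnUpToInitialTime 2 v
  wave_eq : ∀ x : Sp d, ∀ t : ℝ, 0 < t →
    iteratedDeriv 2 (v x) t - (c₀ : ℂ) ^ 2 * lap (fun y => v y t) x = 0
  init_value : ∀ x : Sp d, v x 0 = v₀ x
  init_velocity : ∀ x : Sp d, timeDeriv v x 0 = v₁ x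

/-- The space `C^n_b(ℝ^d)`: functions of class `C^n` all of whose derivatives of order at most `n`
are bounded. -/
def IsCnBounded {d : ℕ} (n : ℕ) (f : Sp d → ℂ) : Prop :=
  ContDiff ℝ n f ∧ ∀ k : ℕ, k ≤ n → ∃ M : ℝ, ∀ x : Sp d, ‖iteratedFDeriv ℝ k f x‖ ≤ M

/-- `g` is the weak (distributional) partial derivative `∂f/∂x_j` on `ℝ^d`. -/
def HasWeakPartialDeriv {d : ℕ} (f : Sp d → ℂ) (j : Fin d) (g : Sp d → ℂ) : Prop :=
  ∀ φ : Sp d → ℝ, ContDiff ℝ ((⊤ : ℕ∞) : WithTop ℕ∞) φ → HasCompactSupport φ →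
    ∫ x, partialDeriv φ j x • f x = - ∫ x, φ x • g x

/-- The Sobolev space `W^{k,∞}(ℝ^d)`: essentially bounded functions whose weak partial derivatives
of order at most `k` exist and are essentially bounded. -/
def MemSobolevInf {d : ℕ} : ℕ → (Sp d → ℂ) → Prop
  | 0, f => MemLp f ⊤ volume
  | k + 1, f => MemLp f ⊤ volume ∧
      ∀ j : Fin d, ∃ g : Sp d → ℂ, HasWeakPartialDeriv f j g ∧ MemSobolevInf k g

/-- The quantity `|f| + |∇f| + |Δf| + |∇Δf| + |Δ²f|` at `x`. -/
def biharmonicSize {d : ℕ} (f : Sp d → ℂ) (x : Sp d) : ℝ :=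
  ‖f x‖ + ‖grad f x‖ + ‖lap f x‖ + ‖grad (lap f) x‖ + ‖lap (lap f) x‖

/-- The assumptions on the initial data in dimension two. The decomposition
`v_i(x) = A₀(|x|) Y_i(x/|x|) + V_i(x)` is written in polar coordinates `x = r θ`;
at the origin the first term is zero, because `A₀` vanishes on `[0, ρ₀]`. -/
def AdmissibleData2D (ω c₀ ρ₀ ρ₁ : ℝ) (v₀ v₁ : Sp 2 → ℂ) : Prop :=
  ∃ (A₀ : ℝ → ℂ) (Y₀ Y₁ : USphere 2 → ℂ) (V₀ V₁ : Sp 2 → ℂ),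
    (∀ r : ℝ, 0 ≤ r → ∀ θ : USphere 2,
      v₀ (r • (θ : Sp 2)) = A₀ r * Y₀ θ + V₀ (r • (θ : Sp 2))) ∧
    (∀ r : ℝ, 0 ≤ r → ∀ θ : USphere 2,
      v₁ (r • (θ : Sp 2)) = A₀ r * Y₁ θ + V₁ (r • (θ : Sp 2))) ∧
    ContDiffOn ℝ 5 A₀ (Ici 0) ∧
    ContMDiff (𝓡 1) 𝓘(ℝ, ℂ) 5 Y₀ ∧ ContMDiff (𝓡 1) 𝓘(ℝ, ℂ) 5 Y₁ ∧
    IsCnBounded 5 V₀ ∧ IsCnBounded 5 V₁ ∧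
    (∀ x : Sp 2, ‖x‖ ≤ ρ₀ → A₀ ‖x‖ = 0 ∧ V₀ x = 0 ∧ V₁ x = 0) ∧
    (∃ C₀ : ℝ, 0 < C₀ ∧ ∀ x : Sp 2,
      ‖x‖ ^ (5 / 2 : ℝ) * (biharmonicSize V₀ x + biharmonicSize V₁ x) ≤ C₀) ∧
    (∀ ρ : ℝ, ρ₁ < ρ →
      A₀ ρ = Complex.exp (Complex.I * ((ω / c₀ * ρ : ℝ) : ℂ)) / ((ρ ^ (3 / 2 : ℝ) : ℝ) : ℂ))

/-- The assumptions on the initial data in dimension three. The data are the continuous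
representatives of their Sobolev classes. All derivatives in the decay condition then exist
classically and are continuous, except `Δ²v₁`: as `Δv₁` is of class `C^{1,1}`, its Laplacian exists
classically at almost every point and agrees with the weak one almost everywhere; hence the decay
condition is required at almost every point. -/
def AdmissibleData3D (v₀ v₁ : Sp 3 → ℂ) : Prop :=
  Continuous v₀ ∧ Continuous v₁ ∧ MemSobolevInf 5 v₀ ∧ MemSobolevInf 4 v₁ ∧
    ∃ C₀ : ℝ, 0 < C₀ ∧ ∀ᵐ x : Sp 3,
      ‖x‖ ^ 2 * (biharmonicSize v₀ x + biharmonicSize v₁ x) ≤ C₀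

/-- The quantity `|v| + |∇v| + |∂_t v| + |Δv| + |∂_t ∇v| + |∂_t Δv|` at `(x, t)`. -/
def solutionSize {d : ℕ} (v : Sp d → ℝ → ℂ) (x : Sp d) (t : ℝ) : ℝ :=
  ‖v x t‖ + ‖grad (fun y => v y t) x‖ + ‖timeDeriv v x t‖
    + ‖lap (fun y => v y t) x‖
    + ‖timeDeriv (fun y s => grad (fun z => v z s) y) x t‖
    + ‖timeDeriv (fun y s => lap (fun z => v z s) y) x t‖

/-- Decay on `Ω` of the solution with initial data `v₀`, `v₁`. Every classical solution is of class
`C³(ℝ^d × [0, ∞))`, so that all the derivatives exist, and satisfies the bound. -/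
def SolutionDecaysOn {d : ℕ} (c₀ : ℝ) (Ω : Set (Sp d)) (v₀ v₁ : Sp d → ℂ) : Prop :=
  ∃ C : ℝ, 0 < C ∧ ∀ v : Sp d → ℝ → ℂ, IsClassicalSolution c₀ v₀ v₁ v →
    IsCnUpToInitialTime 3 v ∧
    ∀ x ∈ Ω, ∀ t : ℝ, 0 ≤ t → solutionSize v x t ≤ C / (1 + t ^ 2) ^ (1 / 2 : ℝ)

/-- `Ω ⋐ B_{ρ₀}`: the set `Ω` lies in a concentric ball of strictly smaller radius. -/
def CompactlyInBall {d : ℕ} (Ω : Set (Sp d)) (ρ₀ : ℝ) : Prop :=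
  ∃ ε : ℝ, 0 < ε ∧ Ω ⊆ Metric.ball (0 : Sp d) (ρ₀ - ε)

end WaveDecay

end

/-! Solutions of the wave equation are Kirchhoff integrals of their data, and differentiating a
solution only changes the data: Δv has data (Δv₀, Δv₁), and ∂_t v has data (v₁, c²Δv₀). Hence v, ∂_t
v, Δv and ∂_tΔv are four Kirchhoff integrals, and the theorem reduces to their being O(1/(1+t))
locally uniformly in x (`IsFrame.solutionDecaysOn`). The two gradients cannot be treated in this
way: their Kirchhoff integrals would contain full second derivatives of the data, while only
Laplacians and first derivatives are controlled. They are bounded instead by the function and its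
Laplacian on a unit ball, through an interior gradient estimate (`norm_fderiv_le_of_frameLap`).

Both dimensions share one formula. Directions are built from three vectors `b`: the standard basis
of ℝ³, or that of ℝ² completed by zero, which is Hadamard's descent. The sphere enters through one
fact, that the spherical part of the Laplacian is a divergence in latitude and longitude and
integrates to zero (`integral_sphere_frameLap`). This gives the time derivative of a Kirchhoff
integral, and also the representation of an arbitrary C² solution, because a weighted integral over
the sections of the backward light cone is constant (`eq_kir_of_wave_eq`).

In dimension three, the sphere of radius ct about a point x of a bounded set is, for large t, at
distance comparable to t from the origin. Data of size |x|^{-2} against the weight t in Kirchhoff's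
formula give 1/t with no cancellation. The regularity needed, C⁴ and C³, follows from the Sobolev
assumption by mollification.

In the plane the point of latitude φ lies at distance T sin φ from x, where T = ct, so small
distances are always present. Data of size |x|^{-5/2} are still harmless, because ∫ sin φ (1 + T sin
φ)^{-5/2} dφ = O(T^{-2}). With exponent -3/2 absolute values give only O(T^{-3/2}); the missing
T^{-1/2} comes from the oscillation e^{ikT sin φ}, k = ω/c₀, whose phase is stationary only at φ =
π/2 (`exists_norm_oscillatory_integral_le`). To use it, the data are replaced near infinity by
e^{ikr}(1 + r)^{-3/2} α(x, e) and their radial derivatives by ik times their values, with errors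
O((1 + r)^{-5/2}) (`decaysLocally_kir_planeFrame`). Laplacians of the data have the same structure,
since Δ maps e^{ikr} r^{-3/2} W(θ) to -k² times itself plus O(r^{-5/2}) (`isOutgoing_of_eq`). -/

noncomputable section

namespace WaveDecay

open Set MeasureTheory Filter Topology
open scoped Manifold EuclideanSpace

/-! ### Integrals depending on a parameter -/

section ParametricIntegral

variable {P Q G : Type} [NormedAddCommGroup P] [NormedSpace ℝ P] [FiniteDimensional ℝ P]
  [TopologicalSpace Q] [SecondCountableTopology Q] [T2Space Q] [MeasurableSpace Q] [BorelSpace Q]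
  [NormedAddCommGroup G] [NormedSpace ℝ G]
  {μ : Measure Q} [IsFiniteMeasureOnCompacts μ]

/-- Differentiation under the integral sign over a compact set, for integrands whose derivative in
the parameter is jointly continuous. -/
theorem hasFDerivAt_setIntegral_of_continuousOn {U : Set P} (hU : IsOpen U) {K : Set Q}
    (hK : IsCompact K) {F : P → Q → G} {F' : P → Q → P →L[ℝ] G}
    (hF : ContinuousOn (fun p : P × Q => F p.1 p.2) (U ×ˢ K))
    (hF' : ContinuousOn (fun p : P × Q => F' p.1 p.2) (U ×ˢ K))
    (hd : ∀ p ∈ U, ∀ q ∈ K, HasFDerivAt (fun p => F p q) (F' p q) p) {p₀ : P} (hp₀ : p₀ ∈ U) :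
    HasFDerivAt (fun p => ∫ q in K, F p q ∂μ) (∫ q in K, F' p₀ q ∂μ) p₀ := by
  have := FiniteDimensional.proper ℝ P
  obtain ⟨N, hN, hNU, hNc⟩ := local_compact_nhds (hU.mem_nhds hp₀)
  obtain ⟨M, hM⟩ := (hNc.prod hK).bddAbove_image
    (hF'.mono (prod_mono_left hNU)).norm
  have hsl : ∀ p ∈ U, ContinuousOn (F p) K := fun p hp =>
    hF.comp (f := fun q => (p, q)) (by fun_prop) (fun q hq => ⟨hp, hq⟩)
  have hsl' : ContinuousOn (F' p₀) K :=
    hF'.comp (f := fun q => (p₀, q)) (by fun_prop) (fun q hq => ⟨hp₀, hq⟩)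
  refine hasFDerivAt_integral_of_dominated_of_fderiv_le (bound := fun _ => M) hN ?_ ?_ ?_ ?_ ?_ ?_
  · filter_upwards [hU.mem_nhds hp₀] with p hp
    exact (hsl p hp).aestronglyMeasurable hK.measurableSet
  · exact (hsl p₀ hp₀).integrableOn_compact hK
  · exact hsl'.aestronglyMeasurable hK.measurableSet
  · refine (ae_restrict_iff' hK.measurableSet).2 (Eventually.of_forall fun q hq p hp => ?_)
    exact hM ⟨(p, q), ⟨hp, hq⟩, rfl⟩
  · exact continuousOn_const.integrableOn_compact hK
  · exact (ae_restrict_iff' hK.measurableSet).2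
      (Eventually.of_forall fun q hq p hp => hd p (hNU hp) q hq)

theorem hasFDerivAt_setIntegral {K : Set Q} (hK : IsCompact K) {F : P → Q → G}
    {F' : P → Q → P →L[ℝ] G} (hF : Continuous (fun p : P × Q => F p.1 p.2))
    (hF' : Continuous (fun p : P × Q => F' p.1 p.2))
    (hd : ∀ p q, HasFDerivAt (fun p => F p q) (F' p q) p) (p₀ : P) :
    HasFDerivAt (fun p => ∫ q in K, F p q ∂μ) (∫ q in K, F' p₀ q ∂μ) p₀ :=
  hasFDerivAt_setIntegral_of_continuousOn isOpen_univ hK hF.continuousOn hF'.continuousOn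
    (fun p _ q _ => hd p q) (mem_univ p₀)

end ParametricIntegral

section ParametricContDiff

variable {P Q : Type} [NormedAddCommGroup P] [NormedSpace ℝ P] [FiniteDimensional ℝ P]
  [NormedAddCommGroup Q] [NormedSpace ℝ Q] [SecondCountableTopology Q]
  [MeasurableSpace Q] [BorelSpace Q] {μ : Measure Q} [IsLocallyFiniteMeasure μ]

theorem contDiff_setIntegral {K : Set Q} (hK : IsCompact K) (n : ℕ) {G : Type}
    [NormedAddCommGroup G] [NormedSpace ℝ G] {F : P × Q → G} (hF : ContDiff ℝ n F) :
    ContDiff ℝ n (fun p => ∫ q in K, F (p, q) ∂μ) := by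
  have := FiniteDimensional.proper ℝ P
  induction n generalizing G with
  | zero =>
    rw [Nat.cast_zero, contDiff_zero] at *
    exact continuous_parametric_integral_of_continuous (f := fun p q => F (p, q)) hF hK
  | succ n ih =>
    have h1 : ContDiff ℝ n (fun z : P × Q => (fderiv ℝ F z).comp (.inl ℝ P Q)) :=
      ((hF.fderiv_right (m := n) (by norm_cast)).clm_comp contDiff_const)
    have hd : ∀ p, HasFDerivAt (fun p => ∫ q in K, F (p, q) ∂μ)
        (∫ q in K, (fderiv ℝ F (p, q)).comp (.inl ℝ P Q) ∂μ) p :=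
      hasFDerivAt_setIntegral hK (F := fun p q => F (p, q))
        (F' := fun p q => (fderiv ℝ F (p, q)).comp (.inl ℝ P Q)) hF.continuous h1.continuous
        fun p q => ((hF.differentiable (by norm_cast)) (p, q)).hasFDerivAt.comp p
          (hasFDerivAt_prodMk_left p q)
    rw [Nat.cast_add, Nat.cast_one, contDiff_succ_iff_fderiv]
    refine ⟨fun p => (hd p).differentiableAt, by simp, ?_⟩
    rw [show fderiv ℝ (fun p => ∫ q in K, F (p, q) ∂μ) = _ from funext fun p => (hd p).fderiv]
    exact ih h1

end ParametricContDiff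

/-! ### Spherical coordinates -/

/-- The rectangle of latitude and longitude. -/
def angles : Set (ℝ × ℝ) := Icc (0, 0) (Real.pi, 2 * Real.pi)

theorem isCompact_angles : IsCompact angles := isCompact_Icc

/-- The integral over `angles` of a divergence vanishes under the boundary conditions of functions
of latitude and longitude. -/
theorem integral_angles_divergence_eq_zero {p q p' q' : ℝ × ℝ → ℂ} (hp : ContDiff ℝ 1 p)
    (hq : ContDiff ℝ 1 q) (hp' : ∀ z : ℝ × ℝ, HasDerivAt (fun s => p (s, z.2)) (p' z) z.1)
    (hq' : ∀ z : ℝ × ℝ, HasDerivAt (fun s => q (z.1, s)) (q' z) z.2)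
    (hp0 : ∀ θ, p (0, θ) = 0) (hp1 : ∀ θ, p (Real.pi, θ) = 0)
    (hq1 : ∀ φ, q (φ, 2 * Real.pi) = q (φ, 0)) :
    ∫ z in angles, (p' z + q' z) = 0 := by
  have hle : ((0 : ℝ), (0 : ℝ)) ≤ (Real.pi, 2 * Real.pi) :=
    ⟨Real.pi_pos.le, by have := Real.pi_pos; simpa using by positivity⟩
  have e1 : ∀ z, p' z = fderiv ℝ p z (1, 0) := fun z => by
    have h := ((hp.differentiable one_ne_zero) z).hasFDerivAt.comp_hasDerivAt_of_eq z.1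
      ((hasDerivAt_id z.1).prodMk (hasDerivAt_const z.1 z.2)) rfl
    exact (hp' z).unique h
  have e2 : ∀ z, q' z = fderiv ℝ q z (0, 1) := fun z => by
    have h := ((hq.differentiable one_ne_zero) z).hasFDerivAt.comp_hasDerivAt_of_eq z.2
      ((hasDerivAt_const z.2 z.1).prodMk (hasDerivAt_id z.2)) rfl
    exact (hq' z).unique h
  simp only [e1, e2]
  have hc1 := hp.continuous_fderiv one_ne_zero
  have hc2 := hq.continuous_fderiv one_ne_zero
  rw [angles, integral_divergence_prod_Icc_of_hasFDerivAt_of_le p q (fderiv ℝ p) (fderiv ℝ q) _ _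
    hle hp.continuous.continuousOn hq.continuous.continuousOn
    (fun x _ => ((hp.differentiable one_ne_zero) x).hasFDerivAt)
    (fun x _ => ((hq.differentiable one_ne_zero) x).hasFDerivAt)
    (Continuous.continuousOn (by fun_prop) |>.integrableOn_compact isCompact_Icc)]
  simp [hp0, hp1, hq1]

/-! ### The moving frame of spherical coordinates, for an arbitrary triple of vectors -/

section Frame

variable {E : Type} [NormedAddCommGroup E] [NormedSpace ℝ E]

/-- The point of latitude and longitude `z` on the sphere spanned by `b`. -/
def dir (b : Fin 3 → E) (z : ℝ × ℝ) : E :=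
  (Real.sin z.1 * Real.cos z.2) • b 0 + (Real.sin z.1 * Real.sin z.2) • b 1 + Real.cos z.1 • b 2

/-- The derivative of `dir` in the latitude. -/
def dirLat (b : Fin 3 → E) (z : ℝ × ℝ) : E :=
  (Real.cos z.1 * Real.cos z.2) • b 0 + (Real.cos z.1 * Real.sin z.2) • b 1 - Real.sin z.1 • b 2

/-- The unit vector in the direction of increasing longitude. -/
def dirLon (b : Fin 3 → E) (z : ℝ × ℝ) : E := -Real.sin z.2 • b 0 + Real.cos z.2 • b 1

/-- The unit vector in the horizontal direction of longitude `z.2`. -/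
def dirHor (b : Fin 3 → E) (z : ℝ × ℝ) : E := Real.cos z.2 • b 0 + Real.sin z.2 • b 1

theorem contDiff_dir (b : Fin 3 → E) {n : WithTop ℕ∞} : ContDiff ℝ n (dir b) := by
  unfold dir
  have := Real.contDiff_sin (n := n)
  have := Real.contDiff_cos (n := n)
  fun_prop

theorem contDiff_dirLat (b : Fin 3 → E) {n : WithTop ℕ∞} : ContDiff ℝ n (dirLat b) := by
  unfold dirLat
  have := Real.contDiff_sin (n := n)
  have := Real.contDiff_cos (n := n)
  fun_prop

theorem contDiff_dirLon (b : Fin 3 → E) {n : WithTop ℕ∞} : ContDiff ℝ n (dirLon b) := by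
  unfold dirLon
  have := Real.contDiff_sin (n := n)
  have := Real.contDiff_cos (n := n)
  fun_prop

@[fun_prop] theorem continuous_dir (b : Fin 3 → E) : Continuous (dir b) :=
  (contDiff_dir b (n := 0)).continuous

theorem hasDerivAt_dir_lat (b : Fin 3 → E) (z : ℝ × ℝ) :
    HasDerivAt (fun s => dir b (s, z.2)) (dirLat b z) z.1 := by
  have := ((((Real.hasDerivAt_sin z.1).mul_const (Real.cos z.2)).smul_const (b 0)).add
    (((Real.hasDerivAt_sin z.1).mul_const (Real.sin z.2)).smul_const (b 1))).add
    ((Real.hasDerivAt_cos z.1).smul_const (b 2))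
  refine HasDerivAt.congr_deriv this ?_
  simp only [dirLat]; module

theorem hasDerivAt_dir_lon (b : Fin 3 → E) (z : ℝ × ℝ) :
    HasDerivAt (fun s => dir b (z.1, s)) (Real.sin z.1 • dirLon b z) z.2 := by
  have := ((((Real.hasDerivAt_cos z.2).const_mul (Real.sin z.1)).smul_const (b 0)).add
    (((Real.hasDerivAt_sin z.2).const_mul (Real.sin z.1)).smul_const (b 1))).add_const
    (Real.cos z.1 • b 2)
  refine HasDerivAt.congr_deriv this ?_
  simp only [dirLon]; module

theorem hasDerivAt_dirLat (b : Fin 3 → E) (z : ℝ × ℝ) :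
    HasDerivAt (fun s => dirLat b (s, z.2)) (-dir b z) z.1 := by
  have := ((((Real.hasDerivAt_cos z.1).mul_const (Real.cos z.2)).smul_const (b 0)).add
    (((Real.hasDerivAt_cos z.1).mul_const (Real.sin z.2)).smul_const (b 1))).sub
    ((Real.hasDerivAt_sin z.1).smul_const (b 2))
  refine HasDerivAt.congr_deriv this ?_
  simp only [dir]; module

theorem hasDerivAt_dirLon (b : Fin 3 → E) (z : ℝ × ℝ) :
    HasDerivAt (fun s => dirLon b (z.1, s)) (-dirHor b z) z.2 := by
  have := ((Real.hasDerivAt_sin z.2).neg.smul_const (b 0)).add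
    ((Real.hasDerivAt_cos z.2).smul_const (b 1))
  refine HasDerivAt.congr_deriv this ?_
  simp only [dirHor]; module

/-- The horizontal vector appears when `dirLon` is differentiated in longitude. Splitting it into
radial and meridional parts makes the term from d(sin φ) = cos φ dφ cancel in the divergence
identities. -/
theorem sin_smul_dir_add_cos_smul_dirLat (b : Fin 3 → E) (z : ℝ × ℝ) :
    Real.sin z.1 • dir b z + Real.cos z.1 • dirLat b z = dirHor b z := by
  simp only [dir, dirLat, dirHor]
  have h := Real.sin_sq_add_cos_sq z.1
  have h1 : Real.cos z.1 ^ 2 = 1 - Real.sin z.1 ^ 2 := by linarith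
  match_scalars
  · linear_combination Real.cos z.2 * h
  · linear_combination Real.sin z.2 * h
  · ring

/-- The sum of the second derivatives in the directions `b`. -/
def frameLap (b : Fin 3 → E) (f : E → ℂ) (x : E) : ℂ :=
  ∑ i, fderiv ℝ (fderiv ℝ f) x (b i) (b i)

/-- The coefficients of `dir`, `dirLat`, `dirLon` with respect to `b` form an orthogonal matrix, and
a trace is invariant under such a change. Only the coefficients matter, so `b` may be linearly
dependent, as it is in the plane. -/
theorem sum_dir_dir (b : Fin 3 → E) (T : E →L[ℝ] E →L[ℝ] ℂ) (z : ℝ × ℝ) :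
    T (dir b z) (dir b z) + T (dirLat b z) (dirLat b z) + T (dirLon b z) (dirLon b z)
      = ∑ i, T (b i) (b i) := by
  have h := Real.sin_sq_add_cos_sq z.1
  have h' := Real.sin_sq_add_cos_sq z.2
  have h1 : Real.cos z.1 ^ 2 = 1 - Real.sin z.1 ^ 2 := by linarith
  have h2 : Real.cos z.2 ^ 2 = 1 - Real.sin z.2 ^ 2 := by linarith
  simp only [dir, dirLat, dirLon, Fin.sum_univ_three, map_add, map_sub, map_smul, add_apply,
    sub_apply, smul_apply]
  match_scalars
  · linear_combination Real.cos z.2 ^ 2 * h + h'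
  · linear_combination Real.cos z.2 * Real.sin z.2 * h
  · ring
  · linear_combination Real.cos z.2 * Real.sin z.2 * h
  · linear_combination Real.sin z.2 ^ 2 * h + h'
  · ring
  · ring
  · ring
  · linear_combination h

end Frame
end WaveDecay
end

noncomputable section

namespace WaveDecay

open Set MeasureTheory Filter Topology
open scoped Manifold EuclideanSpace

/-! ### Identities for integrals over spheres -/

theorem hasDerivAt_setIntegral_of_continuousOn {Q G : Type} [TopologicalSpace Q]
    [SecondCountableTopology Q] [T2Space Q] [MeasurableSpace Q] [BorelSpace Q]
    [NormedAddCommGroup G] [NormedSpace ℝ G] [CompleteSpace G]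
    {μ : Measure Q} [IsFiniteMeasureOnCompacts μ] {U : Set ℝ} (hU : IsOpen U) {K : Set Q}
    (hK : IsCompact K) {F F' : ℝ → Q → G}
    (hF : ContinuousOn (fun p : ℝ × Q => F p.1 p.2) (U ×ˢ K))
    (hF' : ContinuousOn (fun p : ℝ × Q => F' p.1 p.2) (U ×ˢ K))
    (hd : ∀ p ∈ U, ∀ q ∈ K, HasDerivAt (fun p => F p q) (F' p q) p) {t : ℝ} (ht : t ∈ U) :
    HasDerivAt (fun p => ∫ q in K, F p q ∂μ) (∫ q in K, F' t q ∂μ) t := by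
  have hc : ContinuousOn
      (fun p : ℝ × Q => ContinuousLinearMap.toSpanSingleton ℝ (F' p.1 p.2)) (U ×ˢ K) :=
    (ContinuousLinearMap.toSpanSingletonCLE (𝕜 := ℝ) (E := G)).continuous.comp_continuousOn hF'
  have h := hasFDerivAt_setIntegral_of_continuousOn (μ := μ) hU hK
    (F' := fun p q => ContinuousLinearMap.toSpanSingleton ℝ (F' p q)) hF hc
    (fun p hp q hq => (hd p hp q hq).hasFDerivAt) ht
  refine h.hasDerivAt.congr_deriv ?_
  have hi : ContinuousOn (fun q : Q => ContinuousLinearMap.toSpanSingleton ℝ (F' t q)) K :=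
    hc.comp (f := fun q : Q => (t, q)) (by fun_prop) (fun q hq => ⟨ht, hq⟩)
  rw [ContinuousLinearMap.integral_apply (hi.integrableOn_compact hK)]
  simp

theorem hasDerivAt_setIntegral {Q G : Type} [TopologicalSpace Q]
    [SecondCountableTopology Q] [T2Space Q] [MeasurableSpace Q] [BorelSpace Q]
    [NormedAddCommGroup G] [NormedSpace ℝ G] [CompleteSpace G]
    {μ : Measure Q} [IsFiniteMeasureOnCompacts μ] {K : Set Q}
    (hK : IsCompact K) {F F' : ℝ → Q → G} (hF : Continuous (fun p : ℝ × Q => F p.1 p.2))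
    (hF' : Continuous (fun p : ℝ × Q => F' p.1 p.2))
    (hd : ∀ p q, HasDerivAt (fun p => F p q) (F' p q) p) (t : ℝ) :
    HasDerivAt (fun p => ∫ q in K, F p q ∂μ) (∫ q in K, F' t q ∂μ) t :=
  hasDerivAt_setIntegral_of_continuousOn isOpen_univ hK hF.continuousOn hF'.continuousOn
    (fun p _ q _ => hd p q) (mem_univ t)

theorem setIntegral_angles {G : Type} [NormedAddCommGroup G] [NormedSpace ℝ G] {F : ℝ × ℝ → G}
    (hF : Continuous F) :
    ∫ z in angles, F z = ∫ φ in (0)..Real.pi, ∫ θ in (0)..(2 * Real.pi), F (φ, θ) := by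
  have h2 : (0 : ℝ) ≤ 2 * Real.pi := by positivity
  rw [angles, Icc_prod_eq, Measure.volume_eq_prod, setIntegral_prod _
    (hF.continuousOn.integrableOn_compact (isCompact_Icc.prod isCompact_Icc)),
    intervalIntegral.integral_of_le Real.pi_pos.le, integral_Icc_eq_integral_Ioc]
  refine integral_congr_ae (Eventually.of_forall fun φ => ?_)
  simp only
  rw [intervalIntegral.integral_of_le h2, integral_Icc_eq_integral_Ioc]

theorem volume_real_angles : volume.real angles = 2 * Real.pi ^ 2 := by
  rw [angles, Icc_prod_eq, Measure.volume_eq_prod, measureReal_prod_prod, Real.volume_real_Icc,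
    Real.volume_real_Icc, max_eq_left (by linarith [Real.pi_pos]),
    max_eq_left (by linarith [Real.pi_pos])]
  ring

theorem norm_setIntegral_angles_le {F : ℝ × ℝ → ℂ} {C : ℝ} (h : ∀ z, ‖F z‖ ≤ C) :
    ‖∫ z in angles, F z‖ ≤ 2 * Real.pi ^ 2 * C := by
  have := norm_setIntegral_le_of_norm_le_const (μ := volume) (s := angles) (f := F) (C := C)
    isCompact_angles.measure_lt_top (fun z _ => h z)
  rwa [volume_real_angles, mul_comm] at this

section Frame

variable {E : Type} [NormedAddCommGroup E] [NormedSpace ℝ E] (b : Fin 3 → E)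

/-- The point at distance `r` from `x` in the direction `dir b z`. -/
def ray (x : E) (r : ℝ) (z : ℝ × ℝ) : E := x + r • dir b z

theorem contDiff_ray (x : E) (r : ℝ) {n : WithTop ℕ∞} : ContDiff ℝ n (ray b x r) :=
  contDiff_const.add (contDiff_const.smul (contDiff_dir b))

theorem hasDerivAt_ray_lat (x : E) (r : ℝ) (z : ℝ × ℝ) :
    HasDerivAt (fun s => ray b x r (s, z.2)) (r • dirLat b z) z.1 :=
  ((hasDerivAt_dir_lat b z).const_smul r).const_add x

theorem hasDerivAt_ray_lon (x : E) (r : ℝ) (z : ℝ × ℝ) :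
    HasDerivAt (fun s => ray b x r (z.1, s)) (r • Real.sin z.1 • dirLon b z) z.2 :=
  ((hasDerivAt_dir_lon b z).const_smul r).const_add x

theorem hasDerivAt_ray (x : E) (r : ℝ) (z : ℝ × ℝ) :
    HasDerivAt (fun s => ray b x s z) (dir b z) r := by
  simpa [ray] using ((hasDerivAt_id r).smul_const (dir b z)).const_add x

theorem dirLon_two_pi (φ : ℝ) : dirLon b (φ, 2 * Real.pi) = dirLon b (φ, 0) := by simp [dirLon]

theorem ray_two_pi (x : E) (r φ : ℝ) : ray b x r (φ, 2 * Real.pi) = ray b x r (φ, 0) := by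
  simp [ray, dir]

/-- The Laplacian minus its radial part is the Laplacian of the sphere. Written out, the integrand
is ∂_φ(sin φ Df(`dirLat`)) + ∂_θ(Df(`dirLon`)); the first flux vanishes at the poles and the second
is periodic in θ. -/
theorem integral_sphere_frameLap {f : E → ℂ} (hf : ContDiff ℝ 2 f) (x : E) (r : ℝ) :
    ∫ z in angles, Real.sin z.1 • (r • frameLap b f (ray b x r z)
      - (2 : ℝ) • fderiv ℝ f (ray b x r z) (dir b z)
      - r • fderiv ℝ (fderiv ℝ f) (ray b x r z) (dir b z) (dir b z)) = 0 := by
  have hD : ContDiff ℝ 1 (fderiv ℝ f) := hf.fderiv_right (by norm_num)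
  have hDd : ∀ y, HasFDerivAt (fderiv ℝ f) (fderiv ℝ (fderiv ℝ f) y) y := fun y =>
    ((hD.differentiable one_ne_zero) y).hasFDerivAt
  have hray := contDiff_ray b x r (n := 1)
  have hlat := contDiff_dirLat b (n := 1)
  have hlon := contDiff_dirLon b (n := 1)
  have hsin := Real.contDiff_sin (n := 1)
  have key := integral_angles_divergence_eq_zero
    (p := fun z => Real.sin z.1 • fderiv ℝ f (ray b x r z) (dirLat b z))
    (q := fun z => fderiv ℝ f (ray b x r z) (dirLon b z))
    (p' := fun z => Real.sin z.1 • (fderiv ℝ (fderiv ℝ f) (ray b x r z) (r • dirLat b z)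
        (dirLat b z) + fderiv ℝ f (ray b x r z) (-dir b z))
      + Real.cos z.1 • fderiv ℝ f (ray b x r z) (dirLat b z))
    (q' := fun z => fderiv ℝ (fderiv ℝ f) (ray b x r z) (r • Real.sin z.1 • dirLon b z)
      (dirLon b z) + fderiv ℝ f (ray b x r z) (-dirHor b z))
    (by fun_prop) (by fun_prop)
    (fun z => (Real.hasDerivAt_sin z.1).smul
      (((hDd _).comp_hasDerivAt z.1 (hasDerivAt_ray_lat b x r z)).clm_apply
        (hasDerivAt_dirLat b z)))
    (fun z => (((hDd _).comp_hasDerivAt z.2 (hasDerivAt_ray_lon b x r z)).clm_apply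
        (hasDerivAt_dirLon b z)))
    (by simp) (by simp) (by simp [ray_two_pi, dirLon_two_pi])
  rw [← key]
  refine integral_congr_ae (Eventually.of_forall fun z => ?_)
  simp only [frameLap]
  rw [← sum_dir_dir b _ z, ← sin_smul_dir_add_cos_smul_dirLat b z]
  simp only [map_add, map_smul, map_neg, smul_apply]
  module

/-- Green's formula on the sphere against cos φ, a spherical harmonic of degree one: its eigenvalue
-2 produces the extra term 2f. -/
theorem integral_sphere_cos_frameLap {f : E → ℂ} (hf : ContDiff ℝ 2 f) (x : E) (r : ℝ) :
    ∫ z in angles, (Real.sin z.1 * Real.cos z.1) • (r ^ 2 • frameLap b f (ray b x r z)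
      - (2 * r) • fderiv ℝ f (ray b x r z) (dir b z)
      - r ^ 2 • fderiv ℝ (fderiv ℝ f) (ray b x r z) (dir b z) (dir b z)
      + (2 : ℝ) • f (ray b x r z)) = 0 := by
  have hD : ContDiff ℝ 1 (fderiv ℝ f) := hf.fderiv_right (by norm_num)
  have hf1 : ContDiff ℝ 1 f := hf.of_le (by norm_num)
  have hDd : ∀ y, HasFDerivAt (fderiv ℝ f) (fderiv ℝ (fderiv ℝ f) y) y := fun y =>
    ((hD.differentiable one_ne_zero) y).hasFDerivAt
  have hfd : ∀ y, HasFDerivAt f (fderiv ℝ f y) y := fun y =>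
    ((hf1.differentiable one_ne_zero) y).hasFDerivAt
  have hray := contDiff_ray b x r (n := 1)
  have hlat := contDiff_dirLat b (n := 1)
  have hlon := contDiff_dirLon b (n := 1)
  have hsin := Real.contDiff_sin (n := 1)
  have hcos := Real.contDiff_cos (n := 1)
  have key := integral_angles_divergence_eq_zero
    (p := fun z => (Real.sin z.1 * Real.cos z.1) • r • fderiv ℝ f (ray b x r z) (dirLat b z)
      + (Real.sin z.1 * Real.sin z.1) • f (ray b x r z))
    (q := fun z => (r * Real.cos z.1) • fderiv ℝ f (ray b x r z) (dirLon b z))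
    (by fun_prop) (by fun_prop)
    (fun z => (((Real.hasDerivAt_sin z.1).mul (Real.hasDerivAt_cos z.1)).smul
      ((((hDd _).comp_hasDerivAt z.1 (hasDerivAt_ray_lat b x r z)).clm_apply
        (hasDerivAt_dirLat b z)).const_smul r)).add
      (((Real.hasDerivAt_sin z.1).mul (Real.hasDerivAt_sin z.1)).smul
        ((hfd _).comp_hasDerivAt z.1 (hasDerivAt_ray_lat b x r z))))
    (fun z => ((((hDd _).comp_hasDerivAt z.2 (hasDerivAt_ray_lon b x r z)).clm_apply
        (hasDerivAt_dirLon b z)).const_smul (r * Real.cos z.1)))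
    (by simp) (by simp) (by simp [ray_two_pi, dirLon_two_pi])
  rw [← key]
  refine integral_congr_ae (Eventually.of_forall fun z => ?_)
  simp only [frameLap]
  rw [← sum_dir_dir b _ z, ← sin_smul_dir_add_cos_smul_dirLat b z]
  simp only [map_add, map_smul, map_neg, smul_apply, Pi.mul_apply, Pi.smul_apply, Function.comp_apply]
  module

theorem continuous_frameLap {f : E → ℂ} (hf : ContDiff ℝ 2 f) : Continuous (frameLap b f) := by
  have hD : ContDiff ℝ 1 (fderiv ℝ f) := hf.fderiv_right (by norm_num)
  have := hD.continuous_fderiv one_ne_zero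
  unfold frameLap
  fun_prop

/-- The first harmonic extracts from a linear form its value in the polar direction: the horizontal
components integrate to zero in longitude. This turns the radial derivative at r = 0 of a weighted
spherical integral into a directional derivative. -/
theorem integral_sphere_cos_clm (T : E →L[ℝ] ℂ) :
    ∫ z in angles, (Real.sin z.1 * Real.cos z.1) • T (dir b z)
      = (4 * Real.pi / 3 : ℝ) • T (b 2) := by
  rw [setIntegral_angles (by fun_prop)]
  have h1 : ∀ φ : ℝ, ∫ θ in (0)..(2 * Real.pi),
      (Real.sin φ * Real.cos φ) • T (dir b (φ, θ))
        = (2 * Real.pi * (Real.sin φ * Real.cos φ ^ 2)) • T (b 2) := fun φ => by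
    have e : ∀ θ : ℝ, (Real.sin φ * Real.cos φ) • T (dir b (φ, θ))
        = Real.cos θ • ((Real.sin φ ^ 2 * Real.cos φ) • T (b 0))
          + Real.sin θ • ((Real.sin φ ^ 2 * Real.cos φ) • T (b 1))
          + (Real.sin φ * Real.cos φ ^ 2) • T (b 2) := fun θ => by
      simp only [dir, map_add, map_smul]
      module
    simp only [e]
    rw [intervalIntegral.integral_add, intervalIntegral.integral_add,
      intervalIntegral.integral_smul_const, intervalIntegral.integral_smul_const,
      intervalIntegral.integral_const, integral_sin, integral_cos]
    · simp [mul_smul]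
    all_goals exact Continuous.intervalIntegrable (by fun_prop) _ _
  simp only [h1]
  rw [intervalIntegral.integral_smul_const, intervalIntegral.integral_const_mul,
    integral_sin_mul_cos_sq]
  simp only [Real.cos_zero, Real.cos_pi]
  congr 1
  ring

/-- The interior gradient estimate for the Poisson equation on the unit ball. -/
theorem norm_fderiv_le_of_frameLap {f : E → ℂ} (hf : ContDiff ℝ 2 f) (hb : ∀ z, ‖dir b z‖ ≤ 1)
    (x : E) {M : ℝ} (hM : ∀ y, ‖y - x‖ ≤ 1 → ‖f y‖ ≤ M)
    (hM' : ∀ y, ‖y - x‖ ≤ 1 → ‖frameLap b f y‖ ≤ M) :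
    ‖fderiv ℝ f x (b 2)‖ ≤ 10 * M := by
  have hM0 : 0 ≤ M := (norm_nonneg _).trans (hM x (by simp))
  have hD : ContDiff ℝ 1 (fderiv ℝ f) := hf.fderiv_right (by norm_num)
  have hD2 := hD.continuous_fderiv one_ne_zero
  have hDd : ∀ y, HasFDerivAt (fderiv ℝ f) (fderiv ℝ (fderiv ℝ f) y) y := fun y =>
    ((hD.differentiable one_ne_zero) y).hasFDerivAt
  have hfd : ∀ y, HasFDerivAt f (fderiv ℝ f y) y := fun y =>
    ((hf.differentiable two_ne_zero) y).hasFDerivAt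
  have hfc := hf.continuous
  have hDc := hD.continuous
  have hLc := continuous_frameLap b hf
  have hrayc : Continuous (fun p : ℝ × ℝ × ℝ => ray b x p.1 p.2) := by unfold ray; fun_prop
  have hrays : ∀ r, Continuous (ray b x r) := fun r => (contDiff_ray b x r (n := 0)).continuous
  have hmem : ∀ r, 0 ≤ r → r ≤ 1 → ∀ z, ‖ray b x r z - x‖ ≤ 1 := fun r h0 h1 z => by
    simp only [ray, add_sub_cancel_left, norm_smul, Real.norm_eq_abs, abs_of_nonneg h0]
    exact mul_le_one₀ h1 (norm_nonneg _) (hb z)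
  have hsc : ∀ z : ℝ × ℝ, ‖Real.sin z.1 * Real.cos z.1‖ ≤ 1 := fun z => by
    rw [norm_mul]
    exact mul_le_one₀ (Real.abs_sin_le_one _) (norm_nonneg _) (Real.abs_cos_le_one _)
  have hbd : ∀ (g : E → ℂ), (∀ y, ‖y - x‖ ≤ 1 → ‖g y‖ ≤ M) → ∀ r, 0 ≤ r → r ≤ 1 →
      ‖∫ z in angles, (Real.sin z.1 * Real.cos z.1) • g (ray b x r z)‖ ≤ 2 * Real.pi ^ 2 * M :=
    fun g hg r h0 h1 => norm_setIntegral_angles_le fun z => by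
      rw [norm_smul]
      exact (mul_le_of_le_one_left (norm_nonneg _) (hsc z)).trans (hg _ (hmem r h0 h1 z))
  -- `A` is the first-harmonic coefficient of f on the sphere of radius r; `B` and `B'` are its
  -- first two derivatives and `L` is the coefficient of the Laplacian. They satisfy the Euler
  -- equation r²A'' + 2rA' - 2A = r²L, whose homogeneous solutions are r and r^{-2}.
  set A : ℝ → ℂ := fun r => ∫ z in angles, (Real.sin z.1 * Real.cos z.1) • f (ray b x r z) with hA
  set B : ℝ → ℂ := fun r => ∫ z in angles,
    (Real.sin z.1 * Real.cos z.1) • fderiv ℝ f (ray b x r z) (dir b z) with hB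
  set B' : ℝ → ℂ := fun r => ∫ z in angles, (Real.sin z.1 * Real.cos z.1) •
    fderiv ℝ (fderiv ℝ f) (ray b x r z) (dir b z) (dir b z) with hB'
  set L : ℝ → ℂ := fun r => ∫ z in angles,
    (Real.sin z.1 * Real.cos z.1) • frameLap b f (ray b x r z) with hL
  have hAd : ∀ r, HasDerivAt A (B r) r := fun r =>
    hasDerivAt_setIntegral (μ := volume) isCompact_angles
      (F := fun r z => (Real.sin z.1 * Real.cos z.1) • f (ray b x r z))
      (F' := fun r z => (Real.sin z.1 * Real.cos z.1) • fderiv ℝ f (ray b x r z) (dir b z))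
      (by fun_prop) (by fun_prop)
      (fun r z => ((hfd _).comp_hasDerivAt r (hasDerivAt_ray b x r z)).const_smul
        (Real.sin z.1 * Real.cos z.1)) r
  have hBd : ∀ r, HasDerivAt B (B' r) r := fun r =>
    hasDerivAt_setIntegral (μ := volume) isCompact_angles
      (F := fun r z => (Real.sin z.1 * Real.cos z.1) • fderiv ℝ f (ray b x r z) (dir b z))
      (F' := fun r z => (Real.sin z.1 * Real.cos z.1) •
        fderiv ℝ (fderiv ℝ f) (ray b x r z) (dir b z) (dir b z))
      (by fun_prop) (by fun_prop)
      (fun r z => (((hDd _).comp_hasDerivAt r (hasDerivAt_ray b x r z)).clm_apply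
        (hasDerivAt_const r (dir b z))).congr_deriv (by simp) |>.const_smul
          (Real.sin z.1 * Real.cos z.1)) r
  have hrel : ∀ r, r ^ 2 • L r = (2 * r) • B r + r ^ 2 • B' r - (2 : ℝ) • A r := fun r => by
    have h := integral_sphere_cos_frameLap b hf x r
    have hrr := hrays r
    have e : ∀ z : ℝ × ℝ, (Real.sin z.1 * Real.cos z.1) • (r ^ 2 • frameLap b f (ray b x r z)
      - (2 * r) • fderiv ℝ f (ray b x r z) (dir b z)
      - r ^ 2 • fderiv ℝ (fderiv ℝ f) (ray b x r z) (dir b z) (dir b z)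
      + (2 : ℝ) • f (ray b x r z)) =
      r ^ 2 • ((Real.sin z.1 * Real.cos z.1) • frameLap b f (ray b x r z))
      - (2 * r) • ((Real.sin z.1 * Real.cos z.1) • fderiv ℝ f (ray b x r z) (dir b z))
      - r ^ 2 • ((Real.sin z.1 * Real.cos z.1) •
          fderiv ℝ (fderiv ℝ f) (ray b x r z) (dir b z) (dir b z))
      + (2 : ℝ) • ((Real.sin z.1 * Real.cos z.1) • f (ray b x r z)) := fun z => by module
    simp only [e] at h
    rw [integral_add, integral_sub, integral_sub, integral_smul, integral_smul, integral_smul,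
      integral_smul] at h
    · linear_combination (exp := 1) h
    all_goals exact (Continuous.continuousOn (by fun_prop)).integrableOn_compact isCompact_angles
  -- Reduction of order with the solution r: the quantity r³A' - r²A = r⁴(A/r)' has derivative r³L
  -- and vanishes at r = 0. It is therefore O(r⁴), so (A/r)' is bounded.
  have hEd : ∀ r, HasDerivAt (fun r : ℝ => (r ^ 3) • B r - (r ^ 2) • A r) (r ^ 3 • L r) r :=
    fun r => by
      have := (((hasDerivAt_pow 3 r).smul (hBd r)).sub ((hasDerivAt_pow 2 r).smul (hAd r)))
      refine this.congr_deriv ?_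
      rw [show r ^ 3 • L r = r • (r ^ 2 • L r) by module, hrel]
      simp only [Nat.cast_ofNat, Nat.add_one_sub_one, pow_one]
      module
  have hEb : ∀ r, 0 ≤ r → r ≤ 1 →
      ‖(r ^ 3) • B r - (r ^ 2) • A r‖ ≤ 2 * Real.pi ^ 2 * M * r ^ 4 := fun r h0 h1 => by
    have h := Convex.norm_image_sub_le_of_norm_hasDerivWithin_le (s := Icc 0 r) (x := 0) (y := r)
      (C := r ^ 3 * (2 * Real.pi ^ 2 * M))
      (fun s _ => (hEd s).hasDerivWithinAt) (fun s hs => by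
        rw [norm_smul, Real.norm_eq_abs, abs_of_nonneg (pow_nonneg hs.1 3)]
        exact mul_le_mul (pow_le_pow_left₀ hs.1 hs.2 3) (hbd _ hM' s hs.1 (hs.2.trans h1))
          (norm_nonneg _) (pow_nonneg h0 3)) (convex_Icc 0 r) ⟨le_rfl, h0⟩ ⟨h0, le_rfl⟩
    simp only [ne_eq, OfNat.ofNat_ne_zero, not_false_eq_true, zero_pow, zero_smul, sub_zero,
      Real.norm_eq_abs, abs_of_nonneg h0] at h
    linarith
  have hhd : ∀ r, 0 < r → HasDerivAt (fun r : ℝ => r⁻¹ • A r)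
      ((r ^ 4)⁻¹ • ((r ^ 3) • B r - (r ^ 2) • A r)) r := fun r h0 => by
    have := (hasDerivAt_inv h0.ne').smul (hAd r)
    refine this.congr_deriv ?_
    have hne := h0.ne'
    match_scalars <;> field_simp
  -- Integration of (A/r)' inwards from r = 1, where A is controlled by the bound on f; a further
  -- 2π²M comes from the derivative.
  have hhb : ∀ r, 0 < r → r ≤ 1 → ‖r⁻¹ • A r‖ ≤ 4 * Real.pi ^ 2 * M := fun r h0 h1 => by
    have h := Convex.norm_image_sub_le_of_norm_hasDerivWithin_le (s := Icc r 1) (x := 1) (y := r)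
      (C := 2 * Real.pi ^ 2 * M)
      (fun s hs => (hhd s (h0.trans_le hs.1)).hasDerivWithinAt) (fun s hs => by
        have hs0 := h0.trans_le hs.1
        rw [norm_smul, Real.norm_eq_abs, abs_of_nonneg (by positivity), inv_mul_le_iff₀ (by positivity),
          mul_comm]
        exact hEb s hs0.le hs.2) (convex_Icc r 1) ⟨h1, le_rfl⟩ ⟨le_rfl, h1⟩
    have h2 := hbd f hM 1 zero_le_one le_rfl
    rw [inv_one, one_smul] at h
    have h3 : ‖r - 1‖ ≤ 1 := by rw [Real.norm_eq_abs, abs_le]; constructor <;> linarith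
    have h4 : 2 * Real.pi ^ 2 * M * ‖r - 1‖ ≤ 2 * Real.pi ^ 2 * M :=
      mul_le_of_le_one_right (by positivity) h3
    have h5 := norm_le_norm_add_norm_sub' (r⁻¹ • A r) (A 1)
    have h6 : ‖A 1‖ ≤ 2 * Real.pi ^ 2 * M := h2
    linarith
  have hA0 : A 0 = 0 := by
    have h := hrel 0
    simp only [ne_eq, OfNat.ofNat_ne_zero, not_false_eq_true, zero_pow, zero_smul, mul_zero,
      zero_add, zero_sub] at h
    simpa using h.symm
  have hlim : Tendsto (fun r : ℝ => r⁻¹ • A r) (𝓝[>] 0) (𝓝 (B 0)) := by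
    have := (hAd 0).tendsto_slope_zero_right
    simpa [hA0] using this
  have hB0 : ‖B 0‖ ≤ 4 * Real.pi ^ 2 * M := by
    refine le_of_tendsto hlim.norm ?_
    filter_upwards [Ioo_mem_nhdsGT (zero_lt_one' ℝ)] with r hr
    exact hhb r hr.1 hr.2.le
  have hB0' : B 0 = (4 * Real.pi / 3 : ℝ) • fderiv ℝ f x (b 2) := by
    rw [← integral_sphere_cos_clm]
    simp [hB, ray]
  rw [hB0', norm_smul, Real.norm_eq_abs, abs_of_pos (by positivity)] at hB0
  -- 4π²M divided by 4π/3 is 3πM, and 3π < 10.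
  have h4 : ‖fderiv ℝ f x (b 2)‖ ≤ 3 * Real.pi * M := by
    have hpi := Real.pi_pos
    have : (4 * Real.pi / 3) * ‖fderiv ℝ f x (b 2)‖ ≤ (4 * Real.pi / 3) * (3 * Real.pi * M) := by
      linarith
    exact le_of_mul_le_mul_left this (by positivity)
  have := Real.pi_lt_d2
  nlinarith

end Frame
end WaveDecay
end

noncomputable section

namespace WaveDecay

open Set MeasureTheory Filter Topology
open scoped Manifold EuclideanSpace

/-! ### Kirchhoff's formula -/

section Kirchhoff

variable {E : Type} [NormedAddCommGroup E] [NormedSpace ℝ E] (b : Fin 3 → E) (c : ℝ)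

/-- The integrand of Kirchhoff's formula. -/
def kirIntegrand (f₀ f₁ : E → ℂ) (p : E × ℝ) (z : ℝ × ℝ) : ℂ :=
  Real.sin z.1 • (f₀ (ray b p.1 (c * p.2) z)
    + (c * p.2) • fderiv ℝ f₀ (ray b p.1 (c * p.2) z) (dir b z)
    + p.2 • f₁ (ray b p.1 (c * p.2) z))

/-- Kirchhoff's formula for the solution with initial values `f₀` and initial velocity `f₁`. -/
def kir (f₀ f₁ : E → ℂ) (p : E × ℝ) : ℂ :=
  (4 * Real.pi)⁻¹ • ∫ z in angles, kirIntegrand b c f₀ f₁ p z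

variable {b c}

theorem contDiff_kirIntegrand {n : ℕ} {f₀ f₁ : E → ℂ} (h₀ : ContDiff ℝ (n + 1) f₀)
    (h₁ : ContDiff ℝ n f₁) :
    ContDiff ℝ n (fun w : (E × ℝ) × (ℝ × ℝ) => kirIntegrand b c f₀ f₁ w.1 w.2) := by
  have h0' : ContDiff ℝ n f₀ := h₀.of_le (by norm_cast; simp)
  have hD : ContDiff ℝ n (fderiv ℝ f₀) := h₀.fderiv_right le_rfl
  have hs := Real.contDiff_sin (n := n)
  have hd := contDiff_dir b (n := n)
  have hr : ContDiff ℝ n (fun w : (E × ℝ) × (ℝ × ℝ) => ray b w.1.1 (c * w.1.2) w.2) := by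
    unfold ray; fun_prop
  unfold kirIntegrand
  fun_prop

theorem continuous_kirIntegrand {f₀ f₁ : E → ℂ} (h₀ : ContDiff ℝ 1 f₀) (h₁ : Continuous f₁) :
    Continuous (fun w : (E × ℝ) × (ℝ × ℝ) => kirIntegrand b c f₀ f₁ w.1 w.2) :=
  (contDiff_kirIntegrand (n := 0) (by simpa using h₀) (contDiff_zero.2 h₁)).continuous

theorem integrableOn_kirIntegrand {f₀ f₁ : E → ℂ} (h₀ : ContDiff ℝ 1 f₀) (h₁ : Continuous f₁)
    (p : E × ℝ) : IntegrableOn (kirIntegrand b c f₀ f₁ p) angles :=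
  ((continuous_kirIntegrand h₀ h₁).comp
    (Continuous.prodMk_right p)).continuousOn.integrableOn_compact isCompact_angles

theorem kir_add {f₀ f₁ g₀ g₁ : E → ℂ} (h₀ : ContDiff ℝ 1 f₀) (h₁ : Continuous f₁)
    (k₀ : ContDiff ℝ 1 g₀) (k₁ : Continuous g₁) (p : E × ℝ) :
    kir b c (f₀ + g₀) (f₁ + g₁) p = kir b c f₀ f₁ p + kir b c g₀ g₁ p := by
  simp only [kir]
  rw [← smul_add, ← integral_add (integrableOn_kirIntegrand h₀ h₁ p)
    (integrableOn_kirIntegrand k₀ k₁ p)]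
  congr 2
  funext z
  simp only [kirIntegrand, Pi.add_apply]
  rw [fderiv_add ((h₀.differentiable one_ne_zero) _) ((k₀.differentiable one_ne_zero) _)]
  simp only [add_apply]
  module

theorem kir_add₃ {f₀ f₁ g₀ g₁ h₀ h₁ : E → ℂ} (hf₀ : ContDiff ℝ 1 f₀) (hf₁ : Continuous f₁)
    (hg₀ : ContDiff ℝ 1 g₀) (hg₁ : Continuous g₁) (hh₀ : ContDiff ℝ 1 h₀) (hh₁ : Continuous h₁)
    (p : E × ℝ) : kir b c (f₀ + g₀ + h₀) (f₁ + g₁ + h₁) p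
      = kir b c f₀ f₁ p + kir b c g₀ g₁ p + kir b c h₀ h₁ p := by
  have h : ContDiff ℝ 1 (f₀ + g₀) := hf₀.add hg₀
  rw [kir_add h (hf₁.add hg₁) hh₀ hh₁, kir_add hf₀ hf₁ hg₀ hg₁]

variable (b c)

theorem contDiff_kir [FiniteDimensional ℝ E] {n : ℕ} {f₀ f₁ : E → ℂ}
    (h₀ : ContDiff ℝ (n + 1) f₀) (h₁ : ContDiff ℝ n f₁) : ContDiff ℝ n (kir b c f₀ f₁) :=
  (contDiff_setIntegral (μ := volume) isCompact_angles n
    (F := fun w => kirIntegrand b c f₀ f₁ w.1 w.2)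
    (contDiff_kirIntegrand h₀ h₁)).const_smul (4 * Real.pi)⁻¹

/-- The time derivative of a wave is the wave with data (f₁, c²Δf₀). Differentiating the integrand
and subtracting the Kirchhoff integrand of these data leaves -c times the integrand of
`integral_sphere_frameLap` at radius ct, which has integral zero. -/
theorem hasDerivAt_kir_time {f₀ f₁ : E → ℂ} (h₀ : ContDiff ℝ 2 f₀) (h₁ : ContDiff ℝ 1 f₁)
    (x : E) (t : ℝ) :
    HasDerivAt (fun t => kir b c f₀ f₁ (x, t))
      (kir b c f₁ ((c : ℂ) ^ 2 • frameLap b f₀) (x, t)) t := by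
  have hD : ContDiff ℝ 1 (fderiv ℝ f₀) := h₀.fderiv_right (by norm_num)
  have hDd : ∀ y, HasFDerivAt (fderiv ℝ f₀) (fderiv ℝ (fderiv ℝ f₀) y) y := fun y =>
    ((hD.differentiable one_ne_zero) y).hasFDerivAt
  have h0d : ∀ y, HasFDerivAt f₀ (fderiv ℝ f₀ y) y := fun y =>
    ((h₀.differentiable two_ne_zero) y).hasFDerivAt
  have h1d : ∀ y, HasFDerivAt f₁ (fderiv ℝ f₁ y) y := fun y =>
    ((h₁.differentiable one_ne_zero) y).hasFDerivAt
  have c0 := h₀.continuous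
  have c1 := h₁.continuous
  have cD0 := hD.continuous
  have cD1 := h₁.continuous_fderiv one_ne_zero
  have cDD := hD.continuous_fderiv one_ne_zero
  have cL := continuous_frameLap b h₀
  have cr : Continuous (fun p : ℝ × ℝ × ℝ => ray b x (c * p.1) p.2) := by unfold ray; fun_prop
  have cr' : Continuous (fun z => ray b x (c * t) z) := by unfold ray; fun_prop
  have hr : ∀ z t, HasDerivAt (fun t => ray b x (c * t) z) (c • dir b z) t := fun z t => by
    have := (hasDerivAt_ray b x (c * t) z).scomp t ((hasDerivAt_id t).const_mul c)
    simpa [Function.comp_def] using this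
  have key := hasDerivAt_setIntegral (μ := volume) isCompact_angles
    (F := fun t z => kirIntegrand b c f₀ f₁ (x, t) z)
    (F' := fun t z => Real.sin z.1 • (fderiv ℝ f₀ (ray b x (c * t) z) (c • dir b z)
      + ((c * t) • fderiv ℝ (fderiv ℝ f₀) (ray b x (c * t) z) (c • dir b z) (dir b z)
        + c • fderiv ℝ f₀ (ray b x (c * t) z) (dir b z))
      + (t • fderiv ℝ f₁ (ray b x (c * t) z) (c • dir b z) + f₁ (ray b x (c * t) z))))
    (by simp only [kirIntegrand]; fun_prop) (by fun_prop)
    (fun t z => by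
      have e0 := (h0d _).comp_hasDerivAt t (hr z t)
      have e1 := (((hDd _).comp_hasDerivAt t (hr z t)).clm_apply (hasDerivAt_const t (dir b z)))
      have e2 := (h1d _).comp_hasDerivAt t (hr z t)
      have e3 := ((e0.add (((hasDerivAt_id t).const_mul c).smul e1)).add
        ((hasDerivAt_id t).smul e2)).const_smul (Real.sin z.1)
      refine e3.congr_deriv ?_
      simp) t
  refine (key.const_smul (4 * Real.pi)⁻¹).congr_deriv ?_
  have i1 : IntegrableOn (kirIntegrand b c f₁ ((c : ℂ) ^ 2 • frameLap b f₀) (x, t)) angles :=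
    integrableOn_kirIntegrand h₁ (cL.const_smul _) (x, t)
  have i2 : IntegrableOn (fun z => c • Real.sin z.1 • ((c * t) • frameLap b f₀ (ray b x (c * t) z)
      - (2 : ℝ) • fderiv ℝ f₀ (ray b x (c * t) z) (dir b z)
      - (c * t) • fderiv ℝ (fderiv ℝ f₀) (ray b x (c * t) z) (dir b z) (dir b z))) angles :=
    (Continuous.continuousOn (by fun_prop)).integrableOn_compact isCompact_angles
  rw [kir, ← sub_zero (∫ z in angles, kirIntegrand b c f₁ _ (x, t) z), ← smul_zero c,
    ← integral_sphere_frameLap b h₀ x (c * t), ← integral_smul c, ← integral_sub i1 i2]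
  congr 2
  funext z
  simp only [kirIntegrand, Pi.smul_apply, map_smul, smul_apply, smul_eq_mul, Complex.real_smul]
  push_cast
  ring

/-- The formula commutes with translations, hence with derivatives in a fixed direction v; symmetry
of the second derivative exchanges v with the radial direction. -/
theorem fderiv_kir_space [FiniteDimensional ℝ E] {f₀ f₁ : E → ℂ} (h₀ : ContDiff ℝ 2 f₀)
    (h₁ : ContDiff ℝ 1 f₁) (x : E) (t : ℝ) (v : E) :
    fderiv ℝ (fun x => kir b c f₀ f₁ (x, t)) x v
      = kir b c (fun y => fderiv ℝ f₀ y v) (fun y => fderiv ℝ f₁ y v) (x, t) := by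
  have hD : ContDiff ℝ 1 (fderiv ℝ f₀) := h₀.fderiv_right (by norm_num)
  have hDd : ∀ y, HasFDerivAt (fderiv ℝ f₀) (fderiv ℝ (fderiv ℝ f₀) y) y := fun y =>
    ((hD.differentiable one_ne_zero) y).hasFDerivAt
  have h0d : ∀ y, HasFDerivAt f₀ (fderiv ℝ f₀ y) y := fun y =>
    ((h₀.differentiable two_ne_zero) y).hasFDerivAt
  have h1d : ∀ y, HasFDerivAt f₁ (fderiv ℝ f₁ y) y := fun y =>
    ((h₁.differentiable one_ne_zero) y).hasFDerivAt
  have c0 := h₀.continuous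
  have c1 := h₁.continuous
  have cD0 := hD.continuous
  have cD1 := h₁.continuous_fderiv one_ne_zero
  have cDD := hD.continuous_fderiv one_ne_zero
  have hr : ∀ z s, HasDerivAt (fun s : ℝ => ray b (x + s • v) (c * t) z) v s := fun z s => by
    have := (((hasDerivAt_id s).smul_const v).const_add x).add_const ((c * t) • dir b z)
    simpa [ray] using this
  have cr : Continuous (fun p : ℝ × ℝ × ℝ => ray b (x + p.1 • v) (c * t) p.2) := by
    unfold ray; fun_prop
  have key := hasDerivAt_setIntegral (μ := volume) isCompact_angles
    (F := fun s z => kirIntegrand b c f₀ f₁ (x + s • v, t) z)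
    (F' := fun s z => Real.sin z.1 • (fderiv ℝ f₀ (ray b (x + s • v) (c * t) z) v
      + (c * t) • fderiv ℝ (fderiv ℝ f₀) (ray b (x + s • v) (c * t) z) v (dir b z)
      + t • fderiv ℝ f₁ (ray b (x + s • v) (c * t) z) v))
    (by simp only [kirIntegrand]; fun_prop) (by fun_prop)
    (fun s z => by
      have e0 := (h0d _).comp_hasDerivAt s (hr z s)
      have e1 := (((hDd _).comp_hasDerivAt s (hr z s)).clm_apply (hasDerivAt_const s (dir b z)))
      have e2 := (h1d _).comp_hasDerivAt s (hr z s)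
      have e3 := ((e0.add (e1.const_smul (c * t))).add
        (e2.const_smul t)).const_smul (Real.sin z.1)
      refine e3.congr_deriv ?_
      simp) 0
  have key' := key.const_smul (4 * Real.pi)⁻¹
  have hk : Differentiable ℝ (fun x => kir b c f₀ f₁ (x, t)) :=
    ((contDiff_kir b c (n := 1) (by simpa [one_add_one_eq_two] using h₀) h₁).differentiable one_ne_zero).comp
      (by fun_prop)
  have hl : HasDerivAt (fun s : ℝ => x + s • v) v 0 := by
    simpa using ((hasDerivAt_id (0 : ℝ)).smul_const v).const_add x
  have h2 := (hk x).hasFDerivAt.comp_hasDerivAt_of_eq 0 hl (by simp)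
  -- Both `key'` and `h2` differentiate the same function along the line x + s v at s = 0.
  rw [← key'.unique h2, kir]
  congr 2
  funext z
  simp only [kirIntegrand, zero_smul, add_zero]
  have hs : fderiv ℝ (fun y => fderiv ℝ f₀ y v) (ray b x (c * t) z) (dir b z)
      = fderiv ℝ (fderiv ℝ f₀) (ray b x (c * t) z) v (dir b z) := by
    rw [fderiv_clm_apply (hDd _).differentiableAt (differentiableAt_const v)]
    simp only [Pi.zero_apply, ContinuousLinearMap.comp_zero, zero_add,
      ContinuousLinearMap.flip_apply, fderiv_fun_const]
    exact (h₀.contDiffAt.isSymmSndFDerivAt (by simp)).eq _ _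
  rw [hs]

theorem frameLap_eq_sum {f : E → ℂ} (hf : ContDiff ℝ 2 f) (x : E) :
    frameLap b f x = ∑ i, fderiv ℝ (fun y => fderiv ℝ f y (b i)) x (b i) := by
  have hD : ContDiff ℝ 1 (fderiv ℝ f) := hf.fderiv_right (by norm_num)
  unfold frameLap
  congr 1
  funext i
  rw [fderiv_clm_apply ((hD.differentiable one_ne_zero) x) (differentiableAt_const (b i))]
  simp

theorem contDiff_fderiv_apply_const {n m : WithTop ℕ∞} {f : E → ℂ} (hf : ContDiff ℝ m f)
    (h : n + 1 ≤ m) (v : E) : ContDiff ℝ n (fun y => fderiv ℝ f y v) :=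
  (hf.fderiv_right h).clm_apply contDiff_const

/-- Two applications of the rule for directional derivatives, summed over the frame. The Laplacian
thus stays among the Kirchhoff integrals, with Laplacians as data, and full Hessians of the data
never have to be bounded. -/
theorem frameLap_kir [FiniteDimensional ℝ E] {f₀ f₁ : E → ℂ} (h₀ : ContDiff ℝ 3 f₀)
    (h₁ : ContDiff ℝ 2 f₁) (x : E) (t : ℝ) :
    frameLap b (fun x => kir b c f₀ f₁ (x, t)) x
      = kir b c (frameLap b f₀) (frameLap b f₁) (x, t) := by
  have hk : ContDiff ℝ 2 (fun x => kir b c f₀ f₁ (x, t)) :=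
    (contDiff_kir b c (n := 2) (by exact_mod_cast h₀) h₁).comp (contDiff_prodMk_left t)
  have h02 : ContDiff ℝ 2 f₀ := h₀.of_le (by norm_num)
  have h11 : ContDiff ℝ 1 f₁ := h₁.of_le (by norm_num)
  have hd0 : ∀ v, ContDiff ℝ 2 (fun y => fderiv ℝ f₀ y v) := fun v =>
    contDiff_fderiv_apply_const h₀ (by norm_num) v
  have hd1 : ∀ v, ContDiff ℝ 1 (fun y => fderiv ℝ f₁ y v) := fun v =>
    contDiff_fderiv_apply_const h₁ (by norm_num) v
  have hdd0 : ∀ v, ContDiff ℝ 1 (fun y => fderiv ℝ (fun y => fderiv ℝ f₀ y v) y v) := fun v =>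
    contDiff_fderiv_apply_const (hd0 v) (by norm_num) v
  have hdd1 : ∀ v, Continuous (fun y => fderiv ℝ (fun y => fderiv ℝ f₁ y v) y v) := fun v =>
    (contDiff_fderiv_apply_const (n := 0) (hd1 v) (by norm_num) v).continuous
  rw [frameLap_eq_sum b hk]
  simp only [fderiv_kir_space b c h02 h11, fderiv_kir_space b c (hd0 _) (hd1 _)]
  rw [show frameLap b f₀ = (fun y => fderiv ℝ (fun y => fderiv ℝ f₀ y (b 0)) y (b 0))
      + (fun y => fderiv ℝ (fun y => fderiv ℝ f₀ y (b 1)) y (b 1))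
      + (fun y => fderiv ℝ (fun y => fderiv ℝ f₀ y (b 2)) y (b 2)) from funext fun y => by
        simp [frameLap_eq_sum b h02, Fin.sum_univ_three],
    show frameLap b f₁ = (fun y => fderiv ℝ (fun y => fderiv ℝ f₁ y (b 0)) y (b 0))
      + (fun y => fderiv ℝ (fun y => fderiv ℝ f₁ y (b 1)) y (b 1))
      + (fun y => fderiv ℝ (fun y => fderiv ℝ f₁ y (b 2)) y (b 2)) from funext fun y => by
        simp [frameLap_eq_sum b h₁, Fin.sum_univ_three],
    kir_add₃ (hdd0 _) (hdd1 _) (hdd0 _) (hdd1 _) (hdd0 _) (hdd1 _), Fin.sum_univ_three]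

theorem contDiff_frameLap {n m : WithTop ℕ∞} {f : E → ℂ} (hf : ContDiff ℝ m f)
    (h : n + 2 ≤ m) : ContDiff ℝ n (frameLap b f) := by
  have h1 : n + 1 + 1 ≤ m := by rwa [add_assoc, one_add_one_eq_two]
  have := (hf.fderiv_right h1).fderiv_right le_rfl
  unfold frameLap
  fun_prop

end Kirchhoff
end WaveDecay
end

noncomputable section

namespace WaveDecay

open Set MeasureTheory Filter Topology
open scoped Manifold EuclideanSpace

/-! ### Kirchhoff's representation of an arbitrary C² solution -/

section Representation

variable {E : Type} [NormedAddCommGroup E] [NormedSpace ℝ E]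

theorem integral_sin_angles (a : ℂ) :
    ∫ z in angles, Real.sin z.1 • a = (4 * Real.pi) • a := by
  rw [setIntegral_angles (F := fun z => Real.sin z.1 • a) (by fun_prop)]
  simp only [intervalIntegral.integral_const, intervalIntegral.integral_smul,
    intervalIntegral.integral_smul_const, integral_sin]
  simp only [Real.cos_zero, Real.cos_pi]
  module

variable {v : E → ℝ → ℂ}

theorem hasFDerivAt_slice
    (hv : ContDiffOn ℝ 2 (fun p : E × ℝ => v p.1 p.2) (univ ×ˢ Ici 0)) {t : ℝ} (ht : 0 ≤ t)
    (x : E) :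
    HasFDerivAt (fun y => v y t) ((fderivWithin ℝ (fun p : E × ℝ => v p.1 p.2) (univ ×ˢ Ici 0)
      (x, t)).comp (.inl ℝ E ℝ)) x := by
  have h := (hv.differentiableOn two_ne_zero (x, t) ⟨mem_univ _, ht⟩).hasFDerivWithinAt
  exact hasFDerivWithinAt_univ.1 (h.comp (f := fun y => (y, t)) x
    (hasFDerivAt_prodMk_left x t).hasFDerivWithinAt (fun y _ => ⟨mem_univ _, ht⟩))

theorem hasDerivWithinAt_slice
    (hv : ContDiffOn ℝ 2 (fun p : E × ℝ => v p.1 p.2) (univ ×ˢ Ici 0)) {t : ℝ} (ht : 0 ≤ t)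
    (x : E) :
    HasDerivWithinAt (v x) (fderivWithin ℝ (fun p : E × ℝ => v p.1 p.2) (univ ×ˢ Ici 0)
      (x, t) (0, 1)) (Ici 0) t := by
  have h := (hv.differentiableOn two_ne_zero (x, t) ⟨mem_univ _, ht⟩).hasFDerivWithinAt
  exact h.comp_hasDerivWithinAt_of_eq t ((hasDerivWithinAt_const t (Ici 0) x).prodMk
    (hasDerivWithinAt_id t _)) (fun s hs => ⟨mem_univ _, hs⟩) rfl

/-- Kirchhoff's formula holds for classical solutions. -/
theorem eq_kir_of_wave_eq (b : Fin 3 → E) {c : ℝ} (hc : c ≠ 0)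
    (hv : ContDiffOn ℝ 2 (fun p : E × ℝ => v p.1 p.2) (univ ×ˢ Ici 0))
    (hw : ∀ x t, 0 < t → iteratedDeriv 2 (v x) t = (c : ℂ) ^ 2 * frameLap b (fun y => v y t) x)
    (x : E) {T : ℝ} (hT : 0 ≤ T) :
    v x T = kir b c (fun y => v y 0) (fun y => derivWithin (v y) (Ici 0) 0) (x, T) := by
  set V : E × ℝ → ℂ := fun p => v p.1 p.2 with hV
  set S : Set (E × ℝ) := univ ×ˢ Ici 0 with hS
  set D := fderivWithin ℝ V S with hD
  have hSu : UniqueDiffOn ℝ S := uniqueDiffOn_univ.prod (uniqueDiffOn_Ici 0)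
  have hD1 : ContDiffOn ℝ 1 D S := hv.fderivWithin hSu (by norm_num)
  have hSn : ∀ y : E, ∀ t : ℝ, 0 < t → S ∈ 𝓝 (y, t) := fun y t ht =>
    prod_mem_nhds univ_mem (Ici_mem_nhds ht)
  have hO : IsOpen (univ ×ˢ Ioi 0 : Set (E × ℝ)) := isOpen_univ.prod isOpen_Ioi
  have hOS : (univ ×ˢ Ioi 0 : Set (E × ℝ)) ⊆ S := prod_mono_right Ioi_subset_Ici_self
  have hVd : ∀ y t, 0 < t → HasFDerivAt V (D (y, t)) (y, t) := fun y t ht =>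
    ((hv.differentiableOn two_ne_zero (y, t) ⟨mem_univ _, ht.le⟩).hasFDerivWithinAt).hasFDerivAt
      (hSn y t ht)
  have hDd : ∀ y t, 0 < t → HasFDerivAt D (fderiv ℝ D (y, t)) (y, t) := fun y t ht =>
    ((hD1.contDiffAt (hSn y t ht)).differentiableAt one_ne_zero).hasFDerivAt
  have hD2c : ContinuousOn (fderiv ℝ D) (univ ×ˢ Ioi 0) :=
    (hD1.mono hOS).continuousOn_fderiv_of_isOpen hO le_rfl
  have hslice : ∀ t, 0 ≤ t → ∀ y, HasFDerivAt (fun y => v y t)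
      ((D (y, t)).comp (.inl ℝ E ℝ)) y := fun t ht y => hasFDerivAt_slice hv ht y
  have hslice' : ∀ t, 0 ≤ t → fderiv ℝ (fun y => v y t) = fun y => (D (y, t)).comp (.inl ℝ E ℝ) :=
    fun t ht => funext fun y => (hslice t ht y).fderiv
  have hslice2 : ∀ t, 0 < t → ∀ y w w', fderiv ℝ (fderiv ℝ (fun y => v y t)) y w w'
      = fderiv ℝ D (y, t) (w, 0) (w', 0) := fun t ht y w w' => by
    rw [hslice' t ht.le]
    have h := (hDd y t ht).comp (f := fun y => (y, t)) y (hasFDerivAt_prodMk_left y t)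
    have h' := h.clm_comp (hasFDerivAt_const (ContinuousLinearMap.inl ℝ E ℝ) y)
    rw [HasFDerivAt.fderiv (f := fun y => (D (y, t)).comp (.inl ℝ E ℝ)) h']
    simp
  have htime2 : ∀ t, 0 < t → ∀ y, iteratedDeriv 2 (v y) t
      = fderiv ℝ D (y, t) (0, 1) (0, 1) := fun t ht y => by
    rw [iteratedDeriv_succ, iteratedDeriv_one]
    have hp : ∀ s : ℝ, HasDerivAt (fun s : ℝ => (y, s)) ((0 : E), (1 : ℝ)) s := fun s =>
      (hasDerivAt_const s y).prodMk (hasDerivAt_id s)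
    have e : deriv (v y) =ᶠ[𝓝 t] fun s => D (y, s) (0, 1) := by
      filter_upwards [Ioi_mem_nhds ht] with s hs
      exact ((hVd y s hs).comp_hasDerivAt s (hp s)).deriv
    rw [e.deriv_eq]
    have h := ((hDd y t ht).comp_hasDerivAt t (hp t)).clm_apply
      (hasDerivAt_const t ((0 : E), (1 : ℝ)))
    rw [HasDerivAt.deriv (f := fun s => D (y, s) (0, 1)) h]
    simp
  have hsymm : ∀ t, 0 < t → ∀ y w w', fderiv ℝ D (y, t) w w' = fderiv ℝ D (y, t) w' w :=
    fun t ht y w w' => by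
      have e : D =ᶠ[𝓝 (y, t)] fderiv ℝ V := by
        filter_upwards [hO.mem_nhds (⟨mem_univ _, ht⟩ : (y, t) ∈ (univ ×ˢ Ioi 0 : Set (E × ℝ)))]
          with p hp
        exact (hVd p.1 p.2 hp.2).fderiv.symm
      rw [e.fderiv_eq]
      exact ((hv.contDiffAt (hSn y t ht)).isSymmSndFDerivAt (by simp)).eq _ _
  have htime0 : ∀ y, derivWithin (v y) (Ici 0) 0 = D (y, 0) (0, 1) := fun y =>
    (hasDerivWithinAt_slice hv le_rfl y).derivWithin (uniqueDiffOn_Ici 0 0 self_mem_Ici)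
  clear_value D
  have hc2 : ∀ t, 0 < t → ContDiff ℝ 2 (fun y => v y t) := fun t ht =>
    contDiff_iff_contDiffAt.2 fun y =>
      (hv.contDiffAt (hSn y t ht)).comp y (contDiff_prodMk_left t).contDiffAt
  -- With r = c(T - s), the radius at time s of the backward light cone with vertex (x, T), the
  -- integrand is sin φ (r ∂_t v + c ∂_r(r v)). Its integral is 4πc v(x, T) at s = T and 4πc times
  -- Kirchhoff's integral at s = 0, so it is enough that it is constant.
  let F : ℝ → ℝ × ℝ → ℂ := fun s z => Real.sin z.1 •
    ((c * (T - s)) • D (ray b x (c * (T - s)) z, s) (0, 1)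
      + c • V (ray b x (c * (T - s)) z, s)
      + c • (c * (T - s)) • D (ray b x (c * (T - s)) z, s) (dir b z, 0))
  let F' : ℝ → ℝ × ℝ → ℂ := fun s z => Real.sin z.1 •
    (((c * (T - s)) • fderiv ℝ D (ray b x (c * (T - s)) z, s) (-c • dir b z, 1) (0, 1)
        + (-c) • D (ray b x (c * (T - s)) z, s) (0, 1))
      + c • D (ray b x (c * (T - s)) z, s) (-c • dir b z, 1)
      + c • ((c * (T - s)) • fderiv ℝ D (ray b x (c * (T - s)) z, s) (-c • dir b z, 1) (dir b z, 0)
        + (-c) • D (ray b x (c * (T - s)) z, s) (dir b z, 0)))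
  have hrc : Continuous (fun p : ℝ × ℝ × ℝ => ray b x (c * (T - p.1)) p.2) := by
    unfold ray; fun_prop
  have hcont : ContinuousOn (fun s => ∫ z in angles, F s z) (Ici 0) := by
    -- Regularity is known only for t ≥ 0. Replacing s by max s 0 makes the integrand continuous on
    -- the whole line without changing it for s ≥ 0; this supplies continuity at s = 0, where no
    -- derivative is available.
    have h1 : Continuous (fun p : ℝ × ℝ × ℝ => D (ray b x (c * (T - p.1)) p.2, max p.1 0)) :=
      hD1.continuousOn.comp_continuous (by fun_prop) (fun p => ⟨mem_univ _, le_max_right p.1 0⟩)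
    have h2 : Continuous (fun p : ℝ × ℝ × ℝ => V (ray b x (c * (T - p.1)) p.2, max p.1 0)) :=
      hv.continuousOn.comp_continuous (by fun_prop) (fun p => ⟨mem_univ _, le_max_right p.1 0⟩)
    have k6 : Continuous (fun p : ℝ × ℝ × ℝ => ((dir b p.2, 0) : E × ℝ)) := by fun_prop
    have k7 : Continuous (fun p : ℝ × ℝ × ℝ => Real.sin p.2.1) := by fun_prop
    have k8 : Continuous (fun p : ℝ × ℝ × ℝ => c * (T - p.1)) := by fun_prop
    have h3 := continuous_parametric_integral_of_continuous (μ := volume) (f := fun s z =>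
      Real.sin z.1 • ((c * (T - s)) • D (ray b x (c * (T - s)) z, max s 0) (0, 1)
      + c • V (ray b x (c * (T - s)) z, max s 0)
      + c • (c * (T - s)) • D (ray b x (c * (T - s)) z, max s 0) (dir b z, 0)))
      (k7.smul (((k8.smul (h1.clm_apply continuous_const)).add (h2.const_smul c)).add
        ((k8.smul (h1.clm_apply k6)).const_smul c))) isCompact_angles
    refine h3.continuousOn.congr fun s hs => ?_
    simp only [F, max_eq_left (mem_Ici.1 hs)]
  have hder : ∀ s ∈ Ioi (0 : ℝ), HasDerivAt (fun s => ∫ z in angles, F s z)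
      (∫ z in angles, F' s z) s := by
    intro s hs
    have hm : MapsTo (fun p : ℝ × ℝ × ℝ => (ray b x (c * (T - p.1)) p.2, p.1))
        (Ioi 0 ×ˢ angles) (univ ×ˢ Ioi 0) := fun p hp => ⟨mem_univ _, hp.1⟩
    have h1 : ContinuousOn (fun p : ℝ × ℝ × ℝ => D (ray b x (c * (T - p.1)) p.2, p.1))
        (Ioi 0 ×ˢ angles) :=
      (hD1.continuousOn.mono hOS).comp (Continuous.continuousOn (by fun_prop)) hm
    have h2 : ContinuousOn (fun p : ℝ × ℝ × ℝ => V (ray b x (c * (T - p.1)) p.2, p.1))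
        (Ioi 0 ×ˢ angles) :=
      (hv.continuousOn.mono hOS).comp (Continuous.continuousOn (by fun_prop)) hm
    have h3 : ContinuousOn (fun p : ℝ × ℝ × ℝ => fderiv ℝ D (ray b x (c * (T - p.1)) p.2, p.1))
        (Ioi 0 ×ˢ angles) := hD2c.comp (Continuous.continuousOn (by fun_prop)) hm
    have h5 : ContinuousOn (fun p : ℝ × ℝ × ℝ => ((-c • dir b p.2, 1) : E × ℝ))
        (Ioi 0 ×ˢ angles) := Continuous.continuousOn (by fun_prop)
    have h6 : ContinuousOn (fun p : ℝ × ℝ × ℝ => ((dir b p.2, 0) : E × ℝ))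
        (Ioi 0 ×ˢ angles) := Continuous.continuousOn (by fun_prop)
    have h7 : ContinuousOn (fun p : ℝ × ℝ × ℝ => Real.sin p.2.1) (Ioi 0 ×ˢ angles) :=
      Continuous.continuousOn (by fun_prop)
    have h8 : ContinuousOn (fun p : ℝ × ℝ × ℝ => c * (T - p.1)) (Ioi 0 ×ˢ angles) :=
      Continuous.continuousOn (by fun_prop)
    refine hasDerivAt_setIntegral_of_continuousOn (μ := volume) isOpen_Ioi isCompact_angles
      (F := F) (F' := F')
      (h7.smul (((h8.smul (h1.clm_apply continuousOn_const)).add (h2.const_smul c)).add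
        ((h8.smul (h1.clm_apply h6)).const_smul c)))
      (h7.smul ((((h8.smul ((h3.clm_apply h5).clm_apply continuousOn_const)).add
        ((h1.clm_apply continuousOn_const).const_smul (-c))).add
        ((h1.clm_apply h5).const_smul c)).add (((h8.smul ((h3.clm_apply h5).clm_apply h6)).add
        ((h1.clm_apply h6).const_smul (-c))).const_smul c)))
      (fun s hs z _ => ?_) hs
    have hl : HasDerivAt (fun s => c * (T - s)) (-c) s := by
      simpa using ((hasDerivAt_id s).const_sub T).const_mul c
    have hX : HasDerivAt (fun s => (ray b x (c * (T - s)) z, s)) (-c • dir b z, (1 : ℝ)) s :=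
      (HasDerivAt.scomp (h := fun s => c * (T - s)) s
        (hasDerivAt_ray b x (c * (T - s)) z) hl).prodMk (hasDerivAt_id s)
    have e1 := HasFDerivAt.comp_hasDerivAt (f := fun s => (ray b x (c * (T - s)) z, s)) s
      (hVd _ s hs) hX
    have e2 := (HasFDerivAt.comp_hasDerivAt (f := fun s => (ray b x (c * (T - s)) z, s)) s
      (hDd _ s hs) hX).clm_apply
      (hasDerivAt_const s ((0 : E), (1 : ℝ)))
    have e3 := (HasFDerivAt.comp_hasDerivAt (f := fun s => (ray b x (c * (T - s)) z, s)) s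
      (hDd _ s hs) hX).clm_apply
      (hasDerivAt_const s (dir b z, (0 : ℝ)))
    have e4 := (((hl.smul e2).add (e1.const_smul c)).add
      ((hl.smul e3).const_smul c)).const_smul (Real.sin z.1)
    refine e4.congr_deriv ?_
    simp [F']
  -- The mixed derivatives ∂_t∂_r cancel by symmetry. Replacing ∂_t² by c²Δ then leaves c² times the
  -- integrand of `integral_sphere_frameLap`.
  have hzero : ∀ s ∈ Ioi (0 : ℝ), ∫ z in angles, F' s z = 0 := by
    intro s hs
    have hI := integral_sphere_frameLap b (hc2 s hs) x (c * (T - s))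
    rw [← smul_zero (c ^ 2), ← hI, ← integral_smul (c ^ 2)]
    congr 1
    funext z
    set y := ray b x (c * (T - s)) z
    have hlap : (c ^ 2) • frameLap b (fun y => v y s) y = fderiv ℝ D (y, s) (0, 1) (0, 1) := by
      rw [← htime2 s hs, hw y s hs, Complex.real_smul]
      push_cast; rfl
    have hsy := hsymm s hs y (dir b z, 0) (0, 1)
    have hsplit : ((-c • dir b z, 1) : E × ℝ) = (0, 1) - c • (dir b z, 0) := by simp
    rw [show ∀ A B C : ℂ, (c ^ 2) • Real.sin z.1 • ((c * (T - s)) • A - B - C)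
      = Real.sin z.1 • ((c * (T - s)) • (c ^ 2) • A - (c ^ 2) • B - (c ^ 2) • C) from
        fun A B C => by module, hlap, hslice2 s hs, hslice' s hs.le]
    simp only [F', hsplit, map_sub, map_smul, sub_apply, smul_apply,
      ContinuousLinearMap.comp_apply, ContinuousLinearMap.inl_apply]
    change Real.sin z.1 • _ = _
    rw [hsy]
    module
  have hconst : (∫ z in angles, F T z) = ∫ z in angles, F 0 z := by
    have h := intervalIntegral.integral_eq_sub_of_hasDerivAt_of_le hT
      (hcont.mono Icc_subset_Ici_self) (f' := fun _ => 0)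
      (fun s hs => (hder s hs.1).congr_deriv (hzero s hs.1)) (by simp)
    rw [intervalIntegral.integral_zero] at h
    exact (sub_eq_zero.1 h.symm)
  have h1 : (∫ z in angles, F T z) = (4 * Real.pi) • c • v x T := by
    rw [← integral_sin_angles]
    simp [F, ray, hV]
  have h2 : (∫ z in angles, F 0 z) = (4 * Real.pi) • c • kir b c (fun y => v y 0)
      (fun y => derivWithin (v y) (Ici 0) 0) (x, T) := by
    have hpi : (4 * Real.pi) ≠ 0 := by positivity
    rw [kir, smul_comm c, smul_inv_smul₀ hpi, ← integral_smul c]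
    congr 1
    funext z
    simp only [kirIntegrand, F, sub_zero, hslice' 0 le_rfl, ContinuousLinearMap.comp_apply,
      ContinuousLinearMap.inl_apply,
      htime0]
    change Real.sin z.1 • (_ + c • v _ 0 + _) = _
    module
  have hpi : (4 * Real.pi) ≠ 0 := by positivity
  rw [h1, h2] at hconst
  exact smul_right_injective ℂ hc (smul_right_injective ℂ hpi hconst)

end Representation
end WaveDecay
end

noncomputable section

namespace WaveDecay

open Set MeasureTheory Filter Topology
open scoped Manifold EuclideanSpace

/-! ### Reduction to the decay of Kirchhoff's formula -/

/-- Three vectors of `ℝ^d` that span its unit ball and represent the Laplacian. -/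
structure IsFrame {d : ℕ} (b : Fin 3 → Sp d) : Prop where
  lap_eq : ∀ f : Sp d → ℂ, lap f = frameLap b f
  norm_sq_le : ∀ a : Fin 3 → ℝ, ‖∑ i, a i • b i‖ ^ 2 ≤ ∑ i, a i ^ 2
  exists_eq_single : ∀ j, ∃ i, b i = EuclideanSpace.single j 1

theorem frameLap_eq_iteratedFDeriv {d : ℕ} (b : Fin 3 → Sp d) (f : Sp d → ℂ) (x : Sp d) :
    frameLap b f x = ∑ i, iteratedFDeriv ℝ 2 f x ![b i, b i] := by
  simp [frameLap, iteratedFDeriv_two_apply]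

theorem isFrame_three : IsFrame (fun i : Fin 3 => (EuclideanSpace.single i 1 : Sp 3)) where
  lap_eq f := by
    funext x
    rw [frameLap_eq_iteratedFDeriv, lap, InnerProductSpace.laplacian_eq_iteratedFDeriv_orthonormalBasis f
      (EuclideanSpace.basisFun (Fin 3) ℝ)]
    simp
  norm_sq_le a := by
    rw [EuclideanSpace.norm_sq_eq]
    simp [Fin.sum_univ_three]
  exists_eq_single j := ⟨j, rfl⟩

/-- Method of descent: with third vector zero, planar functions are treated as functions of three
variables independent of the last one, and directions on the sphere project to the unit disc. -/
theorem isFrame_two : IsFrame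
    (![EuclideanSpace.single 0 1, EuclideanSpace.single 1 1, 0] : Fin 3 → Sp 2) where
  lap_eq f := by
    funext x
    rw [frameLap_eq_iteratedFDeriv, lap, InnerProductSpace.laplacian_eq_iteratedFDeriv_orthonormalBasis f
      (EuclideanSpace.basisFun (Fin 2) ℝ)]
    simp [Fin.sum_univ_three, iteratedFDeriv_two_apply]
  norm_sq_le a := by
    rw [EuclideanSpace.norm_sq_eq]
    simp [Fin.sum_univ_three]
    positivity
  exists_eq_single j := by
    fin_cases j
    · exact ⟨0, rfl⟩
    · exact ⟨1, rfl⟩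

section

variable {d : ℕ} {b : Fin 3 → Sp d}

/-- The coefficients of a direction form a unit vector of ℝ³, whatever their order. Permutations are
needed because the gradient estimate bounds only the derivative along the third vector. -/
theorem IsFrame.norm_dir_comp_le (hb : IsFrame b) (σ : Equiv.Perm (Fin 3)) (z : ℝ × ℝ) :
    ‖dir (b ∘ σ) z‖ ≤ 1 := by
  let a : Fin 3 → ℝ :=
    ![Real.sin z.1 * Real.cos z.2, Real.sin z.1 * Real.sin z.2, Real.cos z.1]
  have h1 : dir (b ∘ σ) z = ∑ i, a (σ.symm i) • b i := by
    rw [← Equiv.sum_comp σ]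
    simp [dir, Fin.sum_univ_three, a]
  have h2 : ∑ i, a (σ.symm i) ^ 2 = 1 := by
    rw [Equiv.sum_comp σ.symm (fun i => a i ^ 2)]
    simp only [Fin.sum_univ_three, a, Matrix.cons_val]
    linear_combination Real.sin z.1 ^ 2 * Real.sin_sq_add_cos_sq z.2
      + Real.sin_sq_add_cos_sq z.1
  have h3 := hb.norm_sq_le (fun i => a (σ.symm i))
  rw [h2, ← h1] at h3
  exact (sq_le_one_iff₀ (norm_nonneg _)).1 h3

theorem IsFrame.norm_dir_le (hb : IsFrame b) (z : ℝ × ℝ) : ‖dir b z‖ ≤ 1 :=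
  hb.norm_dir_comp_le 1 z

theorem norm_toLp_le_sum (a : Fin d → ℂ) : ‖WithLp.toLp 2 a‖ ≤ ∑ i, ‖a i‖ := by
  rw [EuclideanSpace.norm_eq]
  refine Real.sqrt_le_iff.2 ⟨Finset.sum_nonneg fun i _ => norm_nonneg _, ?_⟩
  exact Finset.sum_sq_le_sq_sum_of_nonneg (fun i _ => norm_nonneg (a i))

/-- Each coordinate vector occurs in the frame and can be swapped into the third place; the
Laplacian, a sum over the frame, is unchanged. -/
theorem IsFrame.norm_grad_le (hb : IsFrame b) {f : Sp d → ℂ} (hf : ContDiff ℝ 2 f) (x : Sp d)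
    {M : ℝ} (hM : ∀ y, ‖y - x‖ ≤ 1 → ‖f y‖ ≤ M)
    (hM' : ∀ y, ‖y - x‖ ≤ 1 → ‖frameLap b f y‖ ≤ M) : ‖grad f x‖ ≤ d * (10 * M) := by
  refine (norm_toLp_le_sum _).trans ?_
  have : ∀ j : Fin d, ‖partialDeriv f j x‖ ≤ 10 * M := fun j => by
    obtain ⟨i, hi⟩ := hb.exists_eq_single j
    have h := norm_fderiv_le_of_frameLap (b ∘ Equiv.swap i 2) hf
      (hb.norm_dir_comp_le _) x hM (fun y hy => by
        have : frameLap (b ∘ Equiv.swap i 2) f y = frameLap b f y :=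
          Equiv.sum_comp (Equiv.swap i 2) (fun i => fderiv ℝ (fderiv ℝ f) y (b i) (b i))
        rw [this]
        exact hM' y hy)
    simpa [hi, partialDeriv] using h
  calc ∑ j, ‖partialDeriv f j x‖ ≤ ∑ _j : Fin d, 10 * M := Finset.sum_le_sum fun j _ => this j
    _ = d * (10 * M) := by simp

theorem frameLap_const_smul (b : Fin 3 → Sp d) {f : Sp d → ℂ} (hf : ContDiff ℝ 2 f) (a : ℂ) :
    frameLap b (a • f) = a • frameLap b f := by
  have hD : ContDiff ℝ 1 (fderiv ℝ f) := hf.fderiv_right (by norm_num)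
  have e : fderiv ℝ (a • f) = a • fderiv ℝ f :=
    funext fun y => fderiv_const_smul (hf.differentiable two_ne_zero y) a
  funext x
  simp only [frameLap, e, fderiv_const_smul (hD.differentiable one_ne_zero x) a, Pi.smul_apply,
    smul_apply, Finset.smul_sum]

theorem frameLap_add (b : Fin 3 → Sp d) {f g : Sp d → ℂ} (hf : ContDiff ℝ 2 f)
    (hg : ContDiff ℝ 2 g) : frameLap b (f + g) = frameLap b f + frameLap b g := by
  have hD : ContDiff ℝ 1 (fderiv ℝ f) := hf.fderiv_right (by norm_num)
  have hD' : ContDiff ℝ 1 (fderiv ℝ g) := hg.fderiv_right (by norm_num)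
  have e : fderiv ℝ (f + g) = fderiv ℝ f + fderiv ℝ g := funext fun y =>
    fderiv_add (hf.differentiable two_ne_zero y) (hg.differentiable two_ne_zero y)
  funext x
  simp only [frameLap, e, fderiv_add (hD.differentiable one_ne_zero x)
    (hD'.differentiable one_ne_zero x), Pi.add_apply, add_apply, Finset.sum_add_distrib]

/-- Decay of a function of `(x, t)` as `1 / t`, uniformly for `x` in bounded sets. -/
def DecaysLocally {d : ℕ} (u : Sp d × ℝ → ℂ) : Prop :=
  ∀ R : ℝ, ∃ C : ℝ, ∀ x t, ‖x‖ ≤ R → 0 ≤ t → ‖u (x, t)‖ ≤ C / (1 + t)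

/-- Mixed space and time derivatives of a function of class `C²` commute. -/
theorem hasDerivAt_partialDeriv {u : Sp d × ℝ → ℂ} (hu : ContDiff ℝ 2 u) {w : Sp d → ℝ → ℂ}
    (hw : ∀ x t, HasDerivAt (fun s => u (x, s)) (w x t) t) (j : Fin d) (x : Sp d) (t : ℝ) :
    HasDerivAt (fun s => partialDeriv (fun y => u (y, s)) j x)
      (partialDeriv (fun y => w y t) j x) t := by
  have hD : ContDiff ℝ 1 (fderiv ℝ u) := hu.fderiv_right (by norm_num)
  have hud : ∀ p, HasFDerivAt u (fderiv ℝ u p) p := fun p =>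
    ((hu.differentiable two_ne_zero) p).hasFDerivAt
  have hDd : ∀ p, HasFDerivAt (fderiv ℝ u) (fderiv ℝ (fderiv ℝ u) p) p := fun p =>
    ((hD.differentiable one_ne_zero) p).hasFDerivAt
  have hp : ∀ y : Sp d, ∀ s : ℝ, HasDerivAt (fun s : ℝ => (y, s)) ((0 : Sp d), (1 : ℝ)) s :=
    fun y s => (hasDerivAt_const s y).prodMk (hasDerivAt_id s)
  have e1 : ∀ s, partialDeriv (fun y => u (y, s)) j x
      = fderiv ℝ u (x, s) (EuclideanSpace.single j 1, 0) := fun s => by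
    have h := (hud (x, s)).comp (f := fun y => (y, s)) x (hasFDerivAt_prodMk_left x s)
    rw [partialDeriv, HasFDerivAt.fderiv (f := fun y => u (y, s)) h]
    simp
  have e2 : (fun y => w y t) = fun y => fderiv ℝ u (y, t) (0, 1) := funext fun y =>
    (hw y t).unique ((hud (y, t)).comp_hasDerivAt t (hp y t))
  simp only [e1]
  have h1 := ((hDd (x, t)).comp_hasDerivAt t (hp x t)).clm_apply
    (hasDerivAt_const t ((EuclideanSpace.single j 1 : Sp d), (0 : ℝ)))
  refine HasDerivAt.congr_deriv h1 ?_
  have h2 := ((hDd (x, t)).comp (f := fun y => (y, t)) x (hasFDerivAt_prodMk_left x t)).clm_apply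
    (hasFDerivAt_const ((0 : Sp d), (1 : ℝ)) x)
  rw [partialDeriv, e2, HasFDerivAt.fderiv (f := fun y => fderiv ℝ u (y, t) (0, 1)) h2]
  simp only [map_zero, add_zero, zero_add, ContinuousLinearMap.comp_zero,
    ContinuousLinearMap.flip_apply, ContinuousLinearMap.comp_apply, ContinuousLinearMap.inl_apply]
  exact (hu.contDiffAt.isSymmSndFDerivAt (by simp)).eq _ _

theorem hasDerivAt_grad {u : Sp d × ℝ → ℂ} (hu : ContDiff ℝ 2 u) {w : Sp d → ℝ → ℂ}
    (hw : ∀ x t, HasDerivAt (fun s => u (x, s)) (w x t) t) (x : Sp d) (t : ℝ) :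
    HasDerivAt (fun s => grad (fun y => u (y, s)) x) (grad (fun y => w y t) x) t :=
  ((PiLp.continuousLinearEquiv 2 ℝ (fun _ : Fin d => ℂ)).symm.toContinuousLinearMap.hasFDerivAt
    ).comp_hasDerivAt t (hasDerivAt_pi.2 fun j => hasDerivAt_partialDeriv hu hw j x t)

theorem timeDeriv_eq {F : Type*} [NormedAddCommGroup F] [NormedSpace ℝ F] {w w' : Sp d → ℝ → F}
    {x : Sp d} {t : ℝ} {g : F} (h : ∀ s, 0 ≤ s → w x s = w' x s) (hg : HasDerivAt (w' x) g t)
    (ht : 0 ≤ t) : timeDeriv w x t = g :=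
  (hg.hasDerivWithinAt.congr (fun s hs => h s hs) (h t ht)).derivWithin (uniqueDiffOn_Ici 0 t ht)

/-- The assumptions `D₁`, `D₂`, `D₃`, `D₄` are the decay of v, ∂_t v, Δv and ∂_tΔv. The interior
estimate gives ∇v from the first and third, and ∂_t∇v = ∇∂_t v from the second and fourth. Since v
agrees with a Kirchhoff integral of C⁴ and C³ data, it is of class C³. -/
theorem IsFrame.solutionDecaysOn (hb : IsFrame b) {c : ℝ} (hc : 0 < c) {v₀ v₁ : Sp d → ℂ}
    (h₀ : ContDiff ℝ 4 v₀) (h₁ : ContDiff ℝ 3 v₁) {Ω : Set (Sp d)} {ρ : ℝ}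
    (hΩ : CompactlyInBall Ω ρ) (D₁ : DecaysLocally (kir b c v₀ v₁))
    (D₂ : DecaysLocally (kir b c v₁ ((c : ℂ) ^ 2 • frameLap b v₀)))
    (D₃ : DecaysLocally (kir b c (frameLap b v₀) (frameLap b v₁)))
    (D₄ : DecaysLocally (kir b c (frameLap b v₁) ((c : ℂ) ^ 2 • frameLap b (frameLap b v₀)))) :
    SolutionDecaysOn c Ω v₀ v₁ := by
  obtain ⟨ε, hε, hΩ⟩ := hΩ
  -- The radius is enlarged by one because the gradient estimate at x uses the unit ball about x.
  obtain ⟨C₁, hC₁⟩ := D₁ (ρ + 1)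
  obtain ⟨C₂, hC₂⟩ := D₂ (ρ + 1)
  obtain ⟨C₃, hC₃⟩ := D₃ (ρ + 1)
  obtain ⟨C₄, hC₄⟩ := D₄ (ρ + 1)
  set M : ℝ := |C₁| + |C₂| + |C₃| + |C₄| with hM
  have hM0 : 0 ≤ M := by positivity
  have h02 : ContDiff ℝ 2 v₀ := h₀.of_le (by norm_num)
  have h03 : ContDiff ℝ 3 v₀ := h₀.of_le (by norm_num)
  have h11 : ContDiff ℝ 1 v₁ := h₁.of_le (by norm_num)
  have h12 : ContDiff ℝ 2 v₁ := h₁.of_le (by norm_num)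
  have hL0 : ContDiff ℝ 2 (frameLap b v₀) := contDiff_frameLap b h₀ (by norm_num)
  have hL0' : ContDiff ℝ 2 ((c : ℂ) ^ 2 • frameLap b v₀) := hL0.const_smul ((c : ℂ) ^ 2)
  have hL1 : ContDiff ℝ 1 (frameLap b v₁) := contDiff_frameLap b h₁ (by norm_num)
  have hLs : frameLap b ((c : ℂ) ^ 2 • frameLap b v₀)
      = (c : ℂ) ^ 2 • frameLap b (frameLap b v₀) := frameLap_const_smul b hL0 _
  have hu : ContDiff ℝ 3 (kir b c v₀ v₁) := contDiff_kir b c (n := 3) (by exact_mod_cast h₀) h₁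
  -- Four terms are bounded directly and two gradients cost a factor 10d each; adding 1 makes the
  -- constant positive.
  refine ⟨(4 + 2 * (d * 10)) * M + 1, by positivity, fun v hv => ?_⟩
  have hrep : ∀ x t, 0 ≤ t → v x t = kir b c v₀ v₁ (x, t) := fun x t ht => by
    have h := eq_kir_of_wave_eq b hc.ne' hv.regular (fun x t ht => by
      rw [← hb.lap_eq]
      exact sub_eq_zero.1 (hv.wave_eq x t ht)) x ht
    rw [h, show (fun y => v y 0) = v₀ from funext hv.init_value,
      show (fun y => derivWithin (v y) (Ici 0) 0) = v₁ from funext hv.init_velocity]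
  have hslice : ∀ t, 0 ≤ t → (fun y => v y t) = fun y => kir b c v₀ v₁ (y, t) := fun t ht =>
    funext fun y => hrep y t ht
  refine ⟨hu.contDiffOn.congr fun p hp => hrep p.1 p.2 hp.2, fun x hx t ht => ?_⟩
  have hxR : ‖x‖ ≤ ρ := by
    have := mem_ball_zero_iff.1 (hΩ hx)
    linarith
  have hball : ∀ y, ‖y - x‖ ≤ 1 → ‖y‖ ≤ ρ + 1 := fun y hy => by
    have := norm_le_norm_add_norm_sub' y x
    linarith
  have hxR' : ‖x‖ ≤ ρ + 1 := by linarith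
  have ht1 : 0 < 1 + t := by linarith
  have hle : ∀ C : ℝ, C ≤ M → C / (1 + t) ≤ M / (1 + t) := fun C hC =>
    div_le_div_of_nonneg_right hC ht1.le
  have b₁ := hle C₁ (by rw [hM]; linarith [le_abs_self C₁, abs_nonneg C₂, abs_nonneg C₃, abs_nonneg C₄])
  have b₂ := hle C₂ (by rw [hM]; linarith [le_abs_self C₂, abs_nonneg C₁, abs_nonneg C₃, abs_nonneg C₄])
  have b₃ := hle C₃ (by rw [hM]; linarith [le_abs_self C₃, abs_nonneg C₂, abs_nonneg C₁, abs_nonneg C₄])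
  have b₄ := hle C₄ (by rw [hM]; linarith [le_abs_self C₄, abs_nonneg C₂, abs_nonneg C₃, abs_nonneg C₁])
  have hut : ContDiff ℝ 2 (fun y => kir b c v₀ v₁ (y, t)) :=
    (hu.of_le (by norm_num)).comp (contDiff_prodMk_left t)
  have hwt : ContDiff ℝ 2 (fun y => kir b c v₁ ((c : ℂ) ^ 2 • frameLap b v₀) (y, t)) :=
    (contDiff_kir b c (n := 2) (by exact_mod_cast h₁) hL0').comp (contDiff_prodMk_left t)
  have htime := hasDerivAt_kir_time b c h02 h11
  have q₁ : ‖v x t‖ ≤ M / (1 + t) := by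
    rw [hrep x t ht]
    exact (hC₁ x t hxR' ht).trans b₁
  have q₂ : ‖grad (fun y => v y t) x‖ ≤ d * (10 * (M / (1 + t))) := by
    rw [hslice t ht]
    refine hb.norm_grad_le hut x (fun y hy => (hC₁ y t (hball y hy) ht).trans b₁) fun y hy => ?_
    rw [frameLap_kir b c h03 h12]
    exact (hC₃ y t (hball y hy) ht).trans b₃
  have q₃ : ‖timeDeriv v x t‖ ≤ M / (1 + t) := by
    rw [timeDeriv_eq (w' := fun x t => kir b c v₀ v₁ (x, t)) (hrep x) (htime x t) ht]
    exact (hC₂ x t hxR' ht).trans b₂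
  have hlap : ∀ s, 0 ≤ s → lap (fun y => v y s) x
      = kir b c (frameLap b v₀) (frameLap b v₁) (x, s) := fun s hs => by
    rw [hslice s hs, hb.lap_eq, frameLap_kir b c h03 h12]
  have q₄ : ‖lap (fun y => v y t) x‖ ≤ M / (1 + t) := by
    rw [hlap t ht]
    exact (hC₃ x t hxR' ht).trans b₃
  have q₅ : ‖timeDeriv (fun y s => grad (fun z => v z s) y) x t‖ ≤ d * (10 * (M / (1 + t))) := by
    rw [timeDeriv_eq (w' := fun x s => grad (fun z => kir b c v₀ v₁ (z, s)) x)
      (fun s hs => by simp only [hslice s hs])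
      (hasDerivAt_grad (hu.of_le (by norm_num)) htime x t) ht]
    refine hb.norm_grad_le hwt x (fun y hy => (hC₂ y t (hball y hy) ht).trans b₂) fun y hy => ?_
    rw [frameLap_kir b c h₁ hL0', hLs]
    exact (hC₄ y t (hball y hy) ht).trans b₄
  have q₆ : ‖timeDeriv (fun y s => lap (fun z => v z s) y) x t‖ ≤ M / (1 + t) := by
    rw [timeDeriv_eq (w' := fun x s => kir b c (frameLap b v₀) (frameLap b v₁) (x, s)) hlap
      (hasDerivAt_kir_time b c hL0 hL1 x t) ht]
    exact (hC₄ x t hxR' ht).trans b₄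
  have hsqrt : (1 + t ^ 2) ^ (1 / 2 : ℝ) ≤ 1 + t := by
    rw [← Real.sqrt_eq_rpow]
    exact Real.sqrt_le_iff.2 ⟨ht1.le, by nlinarith⟩
  calc solutionSize v x t ≤ (4 + 2 * (d * 10)) * M / (1 + t) := by
        rw [mul_div_assoc]
        unfold solutionSize
        linarith
    _ ≤ ((4 + 2 * (d * 10)) * M + 1) / (1 + t) := by gcongr; linarith
    _ ≤ _ := by gcongr

end
end WaveDecay
end

noncomputable section

namespace WaveDecay

open Set MeasureTheory Filter Topology
open scoped Manifold EuclideanSpace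

/-! ### Sobolev functions of order `(k + 1, ∞)` are of class `C^k` -/

section Sobolev

open scoped Convolution NNReal
open ContinuousLinearMap (lsmul)

variable {d : ℕ}

/-- Convolution with a normalized bump function. -/
abbrev mollify (φ : ContDiffBump (0 : Sp d)) (f : Sp d → ℂ) : Sp d → ℂ :=
  (φ.normed volume ⋆[lsmul ℝ ℝ, volume] f : Sp d → ℂ)

theorem locallyIntegrable_of_memLp_top {f : Sp d → ℂ} (hf : MemLp f ⊤ volume) :
    LocallyIntegrable f volume := hf.locallyIntegrable le_top

theorem norm_mollify_le (φ : ContDiffBump (0 : Sp d)) {f : Sp d → ℂ} {M : ℝ}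
    (hM : ∀ᵐ x, ‖f x‖ ≤ M) (x : Sp d) : ‖mollify φ f x‖ ≤ M := by
  have h1 : ∀ᵐ t : Sp d, ‖f (x - t)‖ ≤ M :=
    (quasiMeasurePreserving_sub_left volume x).ae hM
  calc ‖mollify φ f x‖ ≤ ∫ t, φ.normed volume t * M := by
        refine norm_integral_le_of_norm_le (φ.integrable_normed.mul_const M) ?_
        filter_upwards [h1] with t ht
        rw [ContinuousLinearMap.lsmul_apply, norm_smul, Real.norm_eq_abs,
          abs_of_nonneg (φ.nonneg_normed t)]
        exact mul_le_mul_of_nonneg_left ht (φ.nonneg_normed t)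
    _ = M := by rw [integral_mul_const, φ.integral_normed, one_mul]

theorem differentiable_mollify (φ : ContDiffBump (0 : Sp d)) {f : Sp d → ℂ}
    (hf : LocallyIntegrable f volume) : Differentiable ℝ (mollify φ f) := fun x =>
  (φ.hasCompactSupport_normed.hasFDerivAt_convolution_left _ (φ.contDiff_normed (n := 1)) hf
    x).differentiableAt

/-- The derivative of the convolution falls on the kernel, and y ↦ φ(x - y) is an admissible test
function for the weak derivative. -/
theorem partialDeriv_mollify (φ : ContDiffBump (0 : Sp d)) {f g : Sp d → ℂ} {j : Fin d}
    (hf : LocallyIntegrable f volume) (h : HasWeakPartialDeriv f j g) (x : Sp d) :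
    fderiv ℝ (mollify φ f) x (EuclideanSpace.single j 1) = mollify φ g x := by
  set e : Sp d := EuclideanSpace.single j 1
  have hc : ContDiff ℝ ((⊤ : ℕ∞) : WithTop ℕ∞) (φ.normed volume) := φ.contDiff_normed
  have hs : HasCompactSupport (φ.normed volume) := φ.hasCompactSupport_normed
  have h1 : ContDiff ℝ 1 (φ.normed volume) := φ.contDiff_normed (n := 1)
  rw [(hs.hasFDerivAt_convolution_left _ h1 hf x).fderiv]
  have hex := (hs.fderiv ℝ).convolutionExists_left ((lsmul ℝ ℝ : ℝ →L[ℝ] ℂ →L[ℝ] ℂ).precompL (Sp d))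
    (h1.continuous_fderiv one_ne_zero) hf x
  rw [convolution_def, ContinuousLinearMap.integral_apply hex]
  have hψ : ContDiff ℝ ((⊤ : ℕ∞) : WithTop ℕ∞) (fun y => φ.normed volume (x - y)) :=
    hc.comp (contDiff_const.sub contDiff_id)
  have hψs : HasCompactSupport (fun y => φ.normed volume (x - y)) :=
    hs.comp_homeomorph (Homeomorph.subLeft x)
  have hw := h _ hψ hψs
  have hd : ∀ y, partialDeriv (fun y => φ.normed volume (x - y)) j y
      = -fderiv ℝ (φ.normed volume) (x - y) e := fun y => by
    have := ((h1.differentiable one_ne_zero) (x - y)).hasFDerivAt.comp (f := fun y => x - y) y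
      ((hasFDerivAt_id y).const_sub x)
    rw [partialDeriv, HasFDerivAt.fderiv (f := fun y => φ.normed volume (x - y)) this]
    simp [e]
  simp only [hd, neg_smul, integral_neg, neg_inj] at hw
  rw [mollify, convolution_eq_swap]
  simp only [ContinuousLinearMap.lsmul_apply]
  rw [← hw, ← integral_sub_left_eq_self _ volume x]
  simp [ContinuousLinearMap.precompL_apply]

/-- A sequence of bump functions shrinking to the origin. -/
def bumpSeq (d : ℕ) (n : ℕ) : ContDiffBump (0 : Sp d) where
  rIn := 1 / (n + 1) / 2
  rOut := 1 / (n + 1)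
  rIn_pos := by positivity
  rIn_lt_rOut := half_lt_self (by positivity)

theorem tendsto_rOut_bumpSeq : Tendsto (fun n => (bumpSeq d n).rOut) atTop (𝓝 0) :=
  tendsto_one_div_add_atTop_nhds_zero_nat

theorem norm_clm_le_sum {F : Type*} [NormedAddCommGroup F] [NormedSpace ℝ F] (T : Sp d →L[ℝ] F) :
    ‖T‖ ≤ ∑ j, ‖T (EuclideanSpace.single j 1)‖ := by
  refine T.opNorm_le_bound (Finset.sum_nonneg fun _ _ => norm_nonneg _) fun x => ?_
  have hx : x = ∑ j, x j • EuclideanSpace.single j (1 : ℝ) := by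
    ext i
    simp [Pi.single_apply]
  conv_lhs => rw [hx, map_sum]
  rw [Finset.sum_mul]
  refine (norm_sum_le _ _).trans (Finset.sum_le_sum fun j _ => ?_)
  rw [map_smul, norm_smul, mul_comm]
  exact mul_le_mul_of_nonneg_left (PiLp.norm_apply_le x j) (norm_nonneg _)

theorem ae_bound_of_memLp_top {f : Sp d → ℂ} (hf : MemLp f ⊤ volume) :
    ∃ M : ℝ, ∀ᵐ x, ‖f x‖ ≤ M := by
  refine ⟨(eLpNormEssSup f volume).toReal, ?_⟩
  have hfin : eLpNormEssSup f volume < ⊤ := by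
    have := hf.2
    rwa [eLpNorm_exponent_top] at this
  filter_upwards [enorm_ae_le_eLpNormEssSup f volume] with x hx
  rw [← toReal_enorm]
  exact ENNReal.toReal_mono hfin.ne hx

/-- The mollifications have gradients bounded uniformly by the essential bounds of the weak
derivatives, so they share a Lipschitz constant. They converge to f almost everywhere, so f is
Lipschitz on a set of full measure and extends from there. -/
theorem exists_lipschitz_of_memSobolevInf {k : ℕ} {f : Sp d → ℂ}
    (hf : MemSobolevInf (k + 1) f) : ∃ K : ℝ≥0, ∃ f' : Sp d → ℂ, LipschitzWith K f' ∧
      f =ᵐ[volume] f' := by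
  obtain ⟨hfm, hw⟩ := hf
  choose g hg hgs using hw
  have hgm : ∀ j, MemLp (g j) ⊤ volume := fun j => by
    have := hgs j
    cases k with
    | zero => exact this
    | succ k => exact this.1
  choose M hM using fun j => ae_bound_of_memLp_top (hgm j)
  have hfl := locallyIntegrable_of_memLp_top hfm
  have hlip : ∀ n, LipschitzWith (Real.toNNReal (∑ j, M j)) (mollify (bumpSeq d n) f) := fun n => by
    refine lipschitzWith_of_nnnorm_fderiv_le (𝕜 := ℝ) (differentiable_mollify _ hfl) fun x => ?_
    rw [← NNReal.coe_le_coe, coe_nnnorm]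
    refine le_trans ?_ (Real.le_coe_toNNReal _)
    refine (norm_clm_le_sum _).trans (Finset.sum_le_sum fun j _ => ?_)
    rw [partialDeriv_mollify _ hfl (hg j)]
    exact norm_mollify_le _ (hM j) x
  have hconv : ∀ᵐ x, Tendsto (fun n => mollify (bumpSeq d n) f x) atTop (𝓝 (f x)) :=
    -- Here 2 is the ratio of outer to inner radius of the bumps; a bounded ratio makes Lebesgue
    -- differentiation applicable.
    ContDiffBump.ae_convolution_tendsto_right_of_locallyIntegrable (K := 2) tendsto_rOut_bumpSeq
      (Eventually.of_forall fun n => by simp [bumpSeq]; linarith) hfl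
  set A := {x | Tendsto (fun n => mollify (bumpSeq d n) f x) atTop (𝓝 (f x))}
  have hA : LipschitzOnWith (Real.toNNReal (∑ j, M j)) f A := by
    refine LipschitzOnWith.of_dist_le_mul fun x hx y hy => ?_
    exact le_of_tendsto (Tendsto.dist hx hy) (Eventually.of_forall fun n => (hlip n).dist_le_mul x y)
  obtain ⟨f', hf', he⟩ := hA.extend_finite_dimension
  refine ⟨_, f', hf', ?_⟩
  filter_upwards [hconv] with x hx
  exact he hx

/-- The partial derivatives of the mollifications of f are mollifications of the g j. These converge
uniformly because the g j are Lipschitz, so the limit may be differentiated. -/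
theorem hasFDerivAt_of_hasWeakPartialDeriv {f : Sp d → ℂ} {g : Fin d → Sp d → ℂ} {K : Fin d → ℝ≥0}
    (hf : Continuous f) (hg : ∀ j, LipschitzWith (K j) (g j))
    (h : ∀ j, HasWeakPartialDeriv f j (g j)) (x : Sp d) :
    HasFDerivAt f (∑ j, (EuclideanSpace.proj j : Sp d →L[ℝ] ℝ).smulRight (g j x)) x := by
  have hfl : LocallyIntegrable f volume := hf.locallyIntegrable
  refine hasFDerivAt_of_tendstoUniformly (l := atTop) (f := fun n => mollify (bumpSeq d n) f)
    (f' := fun n x => fderiv ℝ (mollify (bumpSeq d n) f) x)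
    (g' := fun x => ∑ j, (EuclideanSpace.proj j : Sp d →L[ℝ] ℝ).smulRight (g j x)) ?_
    (fun n x => (differentiable_mollify _ hfl x).hasFDerivAt)
    (fun x => ContDiffBump.convolution_tendsto_right_of_continuous tendsto_rOut_bumpSeq hf x) x
  rw [Metric.tendstoUniformly_iff]
  intro ε hε
  have hlim : Tendsto (fun n => ∑ j, (K j : ℝ) * (bumpSeq d n).rOut) atTop (𝓝 0) := by
    have := tendsto_finsetSum (Finset.univ : Finset (Fin d)) fun j _ =>
      (tendsto_rOut_bumpSeq (d := d)).const_mul (K j : ℝ)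
    simpa using this
  filter_upwards [hlim.eventually_lt_const hε] with n hn x
  refine lt_of_le_of_lt ?_ hn
  rw [dist_comm, dist_eq_norm]
  refine (norm_clm_le_sum _).trans (Finset.sum_le_sum fun j _ => ?_)
  have e : (∑ i, (EuclideanSpace.proj i : Sp d →L[ℝ] ℝ).smulRight (g i x))
      (EuclideanSpace.single j 1) = g j x := by
    simp
  rw [sub_apply, e, partialDeriv_mollify _ hfl (h j), ← dist_eq_norm]
  refine ContDiffBump.dist_normed_convolution_le (hg j).continuous.aestronglyMeasurable fun y hy => ?_
  refine ((hg j).dist_le_mul y x).trans ?_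
  exact mul_le_mul_of_nonneg_left (Metric.mem_ball.1 hy).le (K j).2

theorem HasWeakPartialDeriv.congr_right {f g g' : Sp d → ℂ} {j : Fin d}
    (h : HasWeakPartialDeriv f j g) (hg : g =ᵐ[volume] g') : HasWeakPartialDeriv f j g' :=
  fun φ hφ hs => by
    rw [h φ hφ hs]
    congr 1
    refine integral_congr_ae ?_
    filter_upwards [hg] with x hx
    rw [hx]

theorem MemSobolevInf.congr {k : ℕ} {f f' : Sp d → ℂ} (h : MemSobolevInf k f)
    (hf : f =ᵐ[volume] f') : MemSobolevInf k f' := by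
  cases k with
  | zero => exact (memLp_congr_ae hf).1 h
  | succ k =>
    refine ⟨(memLp_congr_ae hf).1 h.1, fun j => ?_⟩
    obtain ⟨g, hg, hgs⟩ := h.2 j
    refine ⟨g, fun φ hφ hs => ?_, hgs⟩
    rw [← hg φ hφ hs]
    refine integral_congr_ae ?_
    filter_upwards [hf] with x hx
    rw [hx]

/-- Induction on k: the weak derivatives have Lipschitz representatives, which are then classical
derivatives and lie one step lower in the Sobolev scale. The last weak derivative yields only a
Lipschitz function, hence the loss of one order. -/
theorem contDiff_of_memSobolevInf {k : ℕ} {f : Sp d → ℂ} (hf : Continuous f)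
    (h : MemSobolevInf (k + 1) f) : ContDiff ℝ k f := by
  induction k generalizing f with
  | zero => exact contDiff_zero.2 hf
  | succ k ih =>
    obtain ⟨-, hw⟩ := h
    choose g hg hgs using hw
    choose K g' hg' he using fun j => exists_lipschitz_of_memSobolevInf (hgs j)
    have hd := hasFDerivAt_of_hasWeakPartialDeriv hf hg' fun j => (hg j).congr_right (he j)
    have hc : ∀ j, ContDiff ℝ k (g' j) := fun j =>
      ih (hg' j).continuous ((hgs j).congr (he j))
    rw [Nat.cast_add, Nat.cast_one, contDiff_succ_iff_fderiv]
    refine ⟨fun x => (hd x).differentiableAt, by simp, ?_⟩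
    rw [show fderiv ℝ f = _ from funext fun x => (hd x).fderiv]
    exact ContDiff.sum fun j _ => contDiff_const.smulRight (hc j)

end Sobolev
end WaveDecay
end

noncomputable section

namespace WaveDecay

open Set MeasureTheory Filter Topology
open scoped Manifold EuclideanSpace

/-! ### Decay from the decay of the data -/

section

variable {d : ℕ}

/-- Decay of the spherical integrals of `G`, uniformly for centers in bounded sets. -/
def SphereDecays (b : Fin 3 → Sp d) (G : Sp d → ℝ) : Prop :=
  ∀ R : ℝ, ∃ C : ℝ, ∀ x r, ‖x‖ ≤ R → 0 ≤ r →
    ∫ z in angles, Real.sin z.1 * G (ray b x r z) ≤ C / (1 + r ^ 2)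

theorem sin_nonneg_of_mem_angles {z : ℝ × ℝ} (hz : z ∈ angles) : 0 ≤ Real.sin z.1 :=
  Real.sin_nonneg_of_nonneg_of_le_pi hz.1.1 hz.2.1

/-- The weights of the three terms of Kirchhoff's integrand, 1, ct and t, against quadratic decay of
the spherical integrals. -/
theorem add_mul_div_le {c t : ℝ} (hc : 0 < c) (ht : 0 ≤ t) :
    (1 + c * t + t) / (1 + (c * t) ^ 2) ≤ (2 * (c + 1) * (1 + 1 / c ^ 2)) / (1 + t) := by
  rw [div_le_div_iff₀ (by positivity) (by positivity)]
  have h1 : 1 + t ^ 2 ≤ (1 + 1 / c ^ 2) * (1 + (c * t) ^ 2) := by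
    have : (1 + 1 / c ^ 2) * (1 + (c * t) ^ 2) = 1 + (c * t) ^ 2 + 1 / c ^ 2 + t ^ 2 := by
      field_simp
      ring
    rw [this]
    have : 0 ≤ (c * t) ^ 2 + 1 / c ^ 2 := by positivity
    linarith
  have h2 : (1 + c * t + t) * (1 + t) ≤ (c + 1) * (2 * (1 + t ^ 2)) := by
    nlinarith [sq_nonneg (t - 1), mul_nonneg hc.le ht, mul_nonneg hc.le (sq_nonneg (t - 1))]
  calc (1 + c * t + t) * (1 + t) ≤ (c + 1) * (2 * (1 + t ^ 2)) := h2
    _ ≤ (c + 1) * (2 * ((1 + 1 / c ^ 2) * (1 + (c * t) ^ 2))) := by gcongr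
    _ = _ := by ring

/-- No cancellation is used: the terms of Kirchhoff's formula grow at most linearly in t, and the
spherical integral of the majorant is O((1 + c²t²)^{-1}). -/
theorem DecaysLocally.of_sphereDecays {b : Fin 3 → Sp d} (hb : IsFrame b) {c : ℝ} (hc : 0 < c)
    {G : Sp d → ℝ} (hG : SphereDecays b G) (hGc : Continuous G) {f₀ f₁ : Sp d → ℂ}
    (h₀ : ∀ y, ‖f₀ y‖ ≤ G y) (h₀' : ∀ y, ‖fderiv ℝ f₀ y‖ ≤ G y)
    (h₁ : ∀ y, ‖f₁ y‖ ≤ G y) : DecaysLocally (kir b c f₀ f₁) := fun R => by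
  obtain ⟨C, hC⟩ := hG R
  refine ⟨|C| * (2 * (c + 1) * (1 + 1 / c ^ 2)), fun x t hx ht => ?_⟩
  have hct : 0 ≤ c * t := by positivity
  have hr : Continuous (ray b x (c * t)) := (contDiff_ray b x (c * t) (n := 0)).continuous
  have h1 : ‖∫ z in angles, kirIntegrand b c f₀ f₁ (x, t) z‖
      ≤ ∫ z in angles, (1 + c * t + t) * (Real.sin z.1 * G (ray b x (c * t) z)) := by
    refine norm_integral_le_of_norm_le
      ((Continuous.continuousOn (by fun_prop)).integrableOn_compact isCompact_angles)
      ((ae_restrict_iff' isCompact_angles.measurableSet).2 (Eventually.of_forall fun z hz => ?_))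
    have hs := sin_nonneg_of_mem_angles hz
    rw [kirIntegrand, norm_smul, Real.norm_eq_abs, abs_of_nonneg hs, mul_left_comm]
    refine mul_le_mul_of_nonneg_left ?_ hs
    set y := ray b x (c * t) z
    have e2 : ‖fderiv ℝ f₀ y (dir b z)‖ ≤ G y :=
      ((fderiv ℝ f₀ y).le_opNorm _).trans
        ((mul_le_of_le_one_right (norm_nonneg _) (hb.norm_dir_le z)).trans (h₀' y))
    calc _ ≤ ‖f₀ y‖ + (c * t) * ‖fderiv ℝ f₀ y (dir b z)‖ + t * ‖f₁ y‖ := by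
          refine (norm_add₃_le).trans_eq ?_
          rw [norm_smul, norm_smul, Real.norm_eq_abs, Real.norm_eq_abs, abs_of_nonneg hct,
            abs_of_nonneg ht]
      _ ≤ G y + (c * t) * G y + t * G y := by gcongr <;> simp only [h₀, h₁]
      _ = _ := by ring
  have h2 := hC x (c * t) hx hct
  have h3 : (0 : ℝ) < 1 + c * t + t := by positivity
  have hpi : (4 * Real.pi)⁻¹ ≤ 1 := by
    have := Real.pi_gt_three
    exact inv_le_one_of_one_le₀ (by linarith)
  rw [integral_const_mul] at h1
  calc ‖kir b c f₀ f₁ (x, t)‖ = (4 * Real.pi)⁻¹ * ‖∫ z in angles, kirIntegrand b c f₀ f₁ (x, t) z‖ := by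
        rw [kir, norm_smul, Real.norm_eq_abs, abs_of_nonneg (by positivity)]
    _ ≤ 1 * ((1 + c * t + t) * (|C| / (1 + (c * t) ^ 2))) := by
        refine mul_le_mul hpi (h1.trans ?_) (norm_nonneg _) zero_le_one
        refine mul_le_mul_of_nonneg_left (h2.trans ?_) h3.le
        gcongr
        exact le_abs_self C
    _ = |C| * ((1 + c * t + t) / (1 + (c * t) ^ 2)) := by ring
    _ ≤ |C| * ((2 * (c + 1) * (1 + 1 / c ^ 2)) / (1 + t)) :=
        mul_le_mul_of_nonneg_left (add_mul_div_le hc ht) (abs_nonneg C)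
    _ = _ := by ring

theorem norm_fderiv_le_grad (f : Sp d → ℂ) (y : Sp d) : ‖fderiv ℝ f y‖ ≤ d * ‖grad f y‖ := by
  refine (norm_clm_le_sum _).trans ?_
  calc _ ≤ ∑ _j : Fin d, ‖grad f y‖ :=
        Finset.sum_le_sum fun j _ => PiLp.norm_apply_le (grad f y) j
    _ = _ := by simp

/-- Bounds of the terms of `biharmonicSize`, with gradients replaced by Fréchet derivatives. -/
theorem le_biharmonicSize (f g : Sp d → ℂ) (y : Sp d) :
    (‖f y‖ ≤ (d + 1) * (biharmonicSize f y + biharmonicSize g y) ∧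
      ‖fderiv ℝ f y‖ ≤ (d + 1) * (biharmonicSize f y + biharmonicSize g y) ∧
      ‖lap f y‖ ≤ (d + 1) * (biharmonicSize f y + biharmonicSize g y) ∧
      ‖fderiv ℝ (lap f) y‖ ≤ (d + 1) * (biharmonicSize f y + biharmonicSize g y) ∧
      ‖lap (lap f) y‖ ≤ (d + 1) * (biharmonicSize f y + biharmonicSize g y)) ∧
    (‖g y‖ ≤ (d + 1) * (biharmonicSize f y + biharmonicSize g y) ∧
      ‖fderiv ℝ g y‖ ≤ (d + 1) * (biharmonicSize f y + biharmonicSize g y) ∧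
      ‖lap g y‖ ≤ (d + 1) * (biharmonicSize f y + biharmonicSize g y) ∧
      ‖fderiv ℝ (lap g) y‖ ≤ (d + 1) * (biharmonicSize f y + biharmonicSize g y) ∧
      ‖lap (lap g) y‖ ≤ (d + 1) * (biharmonicSize f y + biharmonicSize g y)) := by
  have hd : (0 : ℝ) ≤ d := d.cast_nonneg
  have key : ∀ S : ℝ, ∀ (w : Sp d → ℂ), biharmonicSize w y ≤ S →
      ‖w y‖ ≤ (d + 1) * S ∧ ‖fderiv ℝ w y‖ ≤ (d + 1) * S ∧ ‖lap w y‖ ≤ (d + 1) * S ∧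
      ‖fderiv ℝ (lap w) y‖ ≤ (d + 1) * S ∧ ‖lap (lap w) y‖ ≤ (d + 1) * S := fun S w hS => by
    unfold biharmonicSize at hS
    have n₁ := norm_nonneg (w y)
    have n₂ := norm_nonneg (grad w y)
    have n₃ := norm_nonneg (lap w y)
    have n₄ := norm_nonneg (grad (lap w) y)
    have n₅ := norm_nonneg (lap (lap w) y)
    have hS0 : 0 ≤ S := by linarith
    have hdS : 0 ≤ d * S := by positivity
    have g₁ := (norm_fderiv_le_grad w y).trans
      (mul_le_mul_of_nonneg_left (show ‖grad w y‖ ≤ S by linarith) hd)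
    have g₂ := (norm_fderiv_le_grad (lap w) y).trans
      (mul_le_mul_of_nonneg_left (show ‖grad (lap w) y‖ ≤ S by linarith) hd)
    refine ⟨?_, ?_, ?_, ?_, ?_⟩ <;> linarith
  have h0 : ∀ w : Sp d → ℂ, 0 ≤ biharmonicSize w y := fun w => by
    unfold biharmonicSize
    positivity
  exact ⟨key _ f (by linarith [h0 g]), key _ g (by linarith [h0 f])⟩

/-- The decay theorem for data dominated by a function with decaying spherical integrals. -/
theorem IsFrame.solutionDecaysOn_of_le {b : Fin 3 → Sp d} (hb : IsFrame b) {c : ℝ} (hc : 0 < c)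
    {v₀ v₁ : Sp d → ℂ} (h₀ : ContDiff ℝ 4 v₀) (h₁ : ContDiff ℝ 3 v₁) {Ω : Set (Sp d)} {ρ : ℝ}
    (hΩ : CompactlyInBall Ω ρ) {G : Sp d → ℝ} (hG : SphereDecays b G) (hGc : Continuous G)
    (a₁ : ∀ y, ‖v₀ y‖ ≤ G y) (a₂ : ∀ y, ‖fderiv ℝ v₀ y‖ ≤ G y)
    (a₃ : ∀ y, ‖lap v₀ y‖ ≤ G y) (a₄ : ∀ y, ‖fderiv ℝ (lap v₀) y‖ ≤ G y)
    (a₅ : ∀ y, ‖lap (lap v₀) y‖ ≤ G y)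
    (a₆ : ∀ y, ‖v₁ y‖ ≤ G y) (a₇ : ∀ y, ‖fderiv ℝ v₁ y‖ ≤ G y)
    (a₈ : ∀ y, ‖lap v₁ y‖ ≤ G y) (a₉ : ∀ y, ‖fderiv ℝ (lap v₁) y‖ ≤ G y) :
    SolutionDecaysOn c Ω v₀ v₁ := by
  -- The second and fourth Kirchhoff integrals have c² times a Laplacian as velocity; the factor 1 +
  -- c² lets one majorant serve both data.
  have hG' : SphereDecays b (fun y => (1 + c ^ 2) * G y) := fun R => by
    obtain ⟨C, hC⟩ := hG R
    refine ⟨(1 + c ^ 2) * C, fun x r hx hr => ?_⟩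
    simp only [mul_left_comm _ (1 + c ^ 2)]
    rw [integral_const_mul, mul_div_assoc]
    exact mul_le_mul_of_nonneg_left (hC x r hx hr) (by positivity)
  have hG0 : ∀ y, 0 ≤ G y := fun y => (norm_nonneg _).trans (a₁ y)
  have up : ∀ y, G y ≤ (1 + c ^ 2) * G y := fun y =>
    le_mul_of_one_le_left (hG0 y) (by nlinarith [sq_nonneg c])
  have up' : ∀ f : Sp d → ℂ, (∀ y, ‖f y‖ ≤ G y) → ∀ y, ‖((c : ℂ) ^ 2 • f) y‖ ≤ (1 + c ^ 2) * G y :=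
    fun f hf y => by
      rw [Pi.smul_apply, norm_smul, norm_pow, Complex.norm_real, Real.norm_eq_abs, sq_abs]
      exact mul_le_mul (by linarith) (hf y) (norm_nonneg _) (by positivity)
  have hGc' : Continuous (fun y => (1 + c ^ 2) * G y) := by fun_prop
  simp only [hb.lap_eq] at *
  exact hb.solutionDecaysOn hc h₀ h₁ hΩ
    (.of_sphereDecays hb hc hG hGc a₁ a₂ a₆)
    (.of_sphereDecays hb hc hG' hGc' (fun y => (a₆ y).trans (up y)) (fun y => (a₇ y).trans (up y))
      (up' _ a₃))
    (.of_sphereDecays hb hc hG hGc a₃ a₄ a₈)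
    (.of_sphereDecays hb hc hG' hGc' (fun y => (a₈ y).trans (up y)) (fun y => (a₉ y).trans (up y))
      (up' _ a₅))

end

/-! ### Dimension three -/

theorem norm_dir_three (z : ℝ × ℝ) :
    ‖dir (fun i : Fin 3 => (EuclideanSpace.single i 1 : Sp 3)) z‖ = 1 := by
  have h : ‖dir (fun i : Fin 3 => (EuclideanSpace.single i 1 : Sp 3)) z‖ ^ 2 = 1 := by
    rw [EuclideanSpace.norm_sq_eq]
    simp [dir, Fin.sum_univ_three]
    linear_combination Real.sin z.1 ^ 2 * Real.sin_sq_add_cos_sq z.2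
      + Real.sin_sq_add_cos_sq z.1
  exact (pow_eq_one_iff_of_nonneg (norm_nonneg _) two_ne_zero).1 h

theorem le_norm_ray_add {d : ℕ} (b : Fin 3 → Sp d) (x : Sp d) {r : ℝ} (hr : 0 ≤ r) (z : ℝ × ℝ) :
    r * ‖dir b z‖ ≤ ‖ray b x r z‖ + ‖x‖ := by
  have h : r • dir b z = ray b x r z - x := by simp [ray]
  have h' := norm_sub_le (ray b x r z) x
  rwa [← h, norm_smul, Real.norm_eq_abs, abs_of_nonneg hr] at h'

/-- Directions are unit vectors in ℝ³, so every point of the sphere is at distance at least r - R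
from the origin. The majorant is therefore pointwise O((1 + r²)^{-1}) on the sphere. -/
theorem sphereDecays_three (M : ℝ) : SphereDecays
    (fun i : Fin 3 => (EuclideanSpace.single i 1 : Sp 3)) (fun y => |M| / (1 + ‖y‖ ^ 2)) := by
  intro R
  refine ⟨2 * Real.pi ^ 2 * (|M| * (2 + 2 * R ^ 2)), fun x r hx hr => ?_⟩
  set b := fun i : Fin 3 => (EuclideanSpace.single i 1 : Sp 3)
  have hb : ∀ z ∈ angles, ‖Real.sin z.1 * (|M| / (1 + ‖ray b x r z‖ ^ 2))‖
      ≤ |M| * (2 + 2 * R ^ 2) / (1 + r ^ 2) := fun z hz => by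
    have h1 := le_norm_ray_add b x hr z
    rw [norm_dir_three, mul_one] at h1
    have h2 : r ≤ ‖ray b x r z‖ + R := by linarith
    have hR : 0 ≤ R := (norm_nonneg x).trans hx
    have h3 : 1 + r ^ 2 ≤ (2 + 2 * R ^ 2) * (1 + ‖ray b x r z‖ ^ 2) := by
      have : r ^ 2 ≤ (‖ray b x r z‖ + R) ^ 2 := pow_le_pow_left₀ hr h2 2
      nlinarith [sq_nonneg (‖ray b x r z‖ - R), mul_nonneg (sq_nonneg R)
        (sq_nonneg ‖ray b x r z‖)]
    rw [norm_mul, Real.norm_eq_abs, Real.norm_eq_abs (|M| / _), abs_of_nonneg (a := |M| / _)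
      (by positivity)]
    refine (mul_le_of_le_one_left (by positivity) (Real.abs_sin_le_one _)).trans ?_
    rw [div_le_div_iff₀ (by positivity) (by positivity), mul_assoc]
    exact mul_le_mul_of_nonneg_left h3 (abs_nonneg M)
  have h := norm_setIntegral_le_of_norm_le_const (μ := volume) isCompact_angles.measure_lt_top hb
  rw [volume_real_angles] at h
  refine (le_abs_self _).trans ((Real.norm_eq_abs _ ▸ h).trans_eq (by ring))

/-- For continuous f the inequality holds on a closed set, and a closed set of full measure is
everything. The behaviour near the origin, where the weight vanishes, is covered by compactness. -/
theorem exists_le_div_of_ae_le {d : ℕ} {F : Type*} [NormedAddCommGroup F] {f : Sp d → F}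
    (hf : Continuous f) {C : ℝ} (h : ∀ᵐ y : Sp d, ‖y‖ ^ 2 * ‖f y‖ ≤ C) :
    ∃ M, 0 ≤ M ∧ ∀ y, ‖f y‖ ≤ M / (1 + ‖y‖ ^ 2) := by
  have hcl : IsClosed {y : Sp d | ‖y‖ ^ 2 * ‖f y‖ ≤ C} := isClosed_le (by fun_prop) continuous_const
  have hall : ∀ y : Sp d, ‖y‖ ^ 2 * ‖f y‖ ≤ C := fun y => by
    have hd : Dense {y : Sp d | ‖y‖ ^ 2 * ‖f y‖ ≤ C} := Measure.dense_of_ae h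
    have h' := hd.closure_eq
    rw [hcl.closure_eq] at h'
    exact (Set.eq_univ_iff_forall.1 h') y
  obtain ⟨B, hB⟩ := (isCompact_closedBall (0 : Sp d) 1).exists_bound_of_continuousOn
    hf.continuousOn
  refine ⟨|B| + |C| + |C|, by positivity, fun y => ?_⟩
  rw [le_div_iff₀ (by positivity)]
  have h1 := (hall y).trans (le_abs_self C)
  by_cases hy : ‖y‖ ≤ 1
  · have := (hB y (by simpa using hy)).trans (le_abs_self B)
    nlinarith [abs_nonneg C]
  · push Not at hy
    have : ‖f y‖ ≤ ‖y‖ ^ 2 * ‖f y‖ := le_mul_of_one_le_left (norm_nonneg _) (one_le_pow₀ hy.le)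
    nlinarith [abs_nonneg B]

theorem solutionDecaysOn_three {c ρ : ℝ} (hc : 0 < c) {Ω : Set (Sp 3)} (hΩ : CompactlyInBall Ω ρ)
    {v₀ v₁ : Sp 3 → ℂ} (h : AdmissibleData3D v₀ v₁) : SolutionDecaysOn c Ω v₀ v₁ := by
  obtain ⟨c₀, c₁, s₀, s₁, C, hC, hle⟩ := h
  have h₀ : ContDiff ℝ 4 v₀ := contDiff_of_memSobolevInf (k := 4) c₀ s₀
  have h₁ : ContDiff ℝ 3 v₁ := contDiff_of_memSobolevInf (k := 3) c₁ s₁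
  have hb := isFrame_three
  have hl₀ : ContDiff ℝ 2 (lap v₀) := hb.lap_eq v₀ ▸ contDiff_frameLap _ h₀ (by norm_num)
  have hl₁ : ContDiff ℝ 1 (lap v₁) := hb.lap_eq v₁ ▸ contDiff_frameLap _ h₁ (by norm_num)
  have hll : Continuous (lap (lap v₀)) := hb.lap_eq (lap v₀) ▸ continuous_frameLap _ hl₀
  have key : ∀ {F : Type} [NormedAddCommGroup F] {f : Sp 3 → F}, Continuous f →
      (∀ y, ‖f y‖ ≤ ((3 : ℕ) + 1) * (biharmonicSize v₀ y + biharmonicSize v₁ y)) →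
      ∃ M, 0 ≤ M ∧ ∀ y, ‖f y‖ ≤ M / (1 + ‖y‖ ^ 2) := fun {F} _ {f} hf hfb =>
    exists_le_div_of_ae_le hf (C := 4 * C) (by
      filter_upwards [hle] with y hy
      have := mul_le_mul_of_nonneg_left (hfb y) (sq_nonneg ‖y‖)
      push_cast at this
      linarith)
  obtain ⟨M₁, p₁, k₁⟩ := key (f := v₀) c₀ fun y => (le_biharmonicSize v₀ v₁ y).1.1
  obtain ⟨M₂, p₂, k₂⟩ := key (f := fderiv ℝ v₀) (h₀.continuous_fderiv (by norm_num))
    fun y => (le_biharmonicSize v₀ v₁ y).1.2.1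
  obtain ⟨M₃, p₃, k₃⟩ := key (f := lap v₀) hl₀.continuous
    fun y => (le_biharmonicSize v₀ v₁ y).1.2.2.1
  obtain ⟨M₄, p₄, k₄⟩ := key (f := fderiv ℝ (lap v₀)) (hl₀.continuous_fderiv (by norm_num))
    fun y => (le_biharmonicSize v₀ v₁ y).1.2.2.2.1
  obtain ⟨M₅, p₅, k₅⟩ := key (f := lap (lap v₀)) hll
    fun y => (le_biharmonicSize v₀ v₁ y).1.2.2.2.2
  obtain ⟨M₆, p₆, k₆⟩ := key (f := v₁) c₁ fun y => (le_biharmonicSize v₀ v₁ y).2.1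
  obtain ⟨M₇, p₇, k₇⟩ := key (f := fderiv ℝ v₁) (h₁.continuous_fderiv (by norm_num))
    fun y => (le_biharmonicSize v₀ v₁ y).2.2.1
  obtain ⟨M₈, p₈, k₈⟩ := key (f := lap v₁) hl₁.continuous
    fun y => (le_biharmonicSize v₀ v₁ y).2.2.2.1
  obtain ⟨M₉, p₉, k₉⟩ := key (f := fderiv ℝ (lap v₁)) (hl₁.continuous_fderiv (by norm_num))
    fun y => (le_biharmonicSize v₀ v₁ y).2.2.2.2.1
  set M := M₁ + M₂ + M₃ + M₄ + M₅ + M₆ + M₇ + M₈ + M₉ with hM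
  have hup : ∀ N, N ≤ M → ∀ y : Sp 3, N / (1 + ‖y‖ ^ 2) ≤ |M| / (1 + ‖y‖ ^ 2) := fun N hN y =>
    div_le_div_of_nonneg_right (hN.trans (le_abs_self M)) (by positivity)
  have hGc : Continuous (fun y : Sp 3 => |M| / (1 + ‖y‖ ^ 2)) :=
    continuous_const.div (by fun_prop) fun y => by positivity
  exact hb.solutionDecaysOn_of_le hc h₀ h₁ hΩ (sphereDecays_three M) hGc
    (fun y => (k₁ y).trans (hup M₁ (by linarith) y))
    (fun y => (k₂ y).trans (hup M₂ (by linarith) y))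
    (fun y => (k₃ y).trans (hup M₃ (by linarith) y))
    (fun y => (k₄ y).trans (hup M₄ (by linarith) y))
    (fun y => (k₅ y).trans (hup M₅ (by linarith) y))
    (fun y => (k₆ y).trans (hup M₆ (by linarith) y))
    (fun y => (k₇ y).trans (hup M₇ (by linarith) y))
    (fun y => (k₈ y).trans (hup M₈ (by linarith) y))
    (fun y => (k₉ y).trans (hup M₉ (by linarith) y))

end WaveDecay
end

noncomputable section

namespace WaveDecay

open Set MeasureTheory Filter Topology
open scoped Manifold EuclideanSpace

/-! ### One-dimensional integrals -/

theorem integral_comp_sin_zero_pi {F : Type} [NormedAddCommGroup F] [NormedSpace ℝ F] {f : ℝ → F}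
    (hf : ContinuousOn f (Icc 0 1)) :
    ∫ φ in (0)..Real.pi, f (Real.sin φ) = (2 : ℝ) • ∫ φ in (0)..(Real.pi / 2), f (Real.sin φ) := by
  have hpi := Real.pi_pos
  have hc : ContinuousOn (fun φ => f (Real.sin φ)) (Icc 0 Real.pi) :=
    hf.comp Real.continuous_sin.continuousOn fun φ hφ =>
      ⟨Real.sin_nonneg_of_nonneg_of_le_pi hφ.1 hφ.2, Real.sin_le_one φ⟩
  have h1 : ∫ φ in (Real.pi / 2)..Real.pi, f (Real.sin φ)
      = ∫ φ in (0)..(Real.pi / 2), f (Real.sin φ) := by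
    have := intervalIntegral.integral_comp_sub_left (a := 0) (b := Real.pi / 2)
      (fun φ => f (Real.sin φ)) Real.pi
    rw [sub_zero, sub_half] at this
    rw [← this]
    simp only [Real.sin_pi_sub]
  rw [← intervalIntegral.integral_add_adjacent_intervals (b := Real.pi / 2), h1, two_smul]
  · exact (hc.mono (Icc_subset_Icc_right (by linarith))).intervalIntegrable_of_Icc (by linarith)
  · exact (hc.mono (Icc_subset_Icc_left (by linarith))).intervalIntegrable_of_Icc (by linarith)

theorem continuousOn_one_add_mul_rpow {T : ℝ} (hT : 0 ≤ T) (p : ℝ) :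
    ContinuousOn (fun s : ℝ => (1 + T * s) ^ p) (Ici 0) :=
  ContinuousOn.rpow_const (by fun_prop) fun s hs => Or.inl (by
    have : 0 ≤ T * s := mul_nonneg hT hs
    positivity)

theorem continuousOn_one_add_mul_sin_rpow {T : ℝ} (hT : 0 ≤ T) (p : ℝ) :
    ContinuousOn (fun φ : ℝ => (1 + T * Real.sin φ) ^ p) (Icc 0 Real.pi) :=
  (continuousOn_one_add_mul_rpow hT p).comp Real.continuous_sin.continuousOn fun _ hφ =>
    Real.sin_nonneg_of_nonneg_of_le_pi hφ.1 hφ.2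

/-- Jordan's inequality sin φ ≥ 2φ/π reduces the integral to one with an explicit primitive. -/
theorem integral_one_add_mul_sin_rpow_le {T : ℝ} (hT : 0 < T) :
    ∫ φ in (0)..(Real.pi / 2), (1 + T * Real.sin φ) ^ (-(3 / 2) : ℝ) ≤ Real.pi / T := by
  have hpi := Real.pi_pos
  set a := T * (2 / Real.pi) with ha
  have ha0 : 0 < a := by positivity
  have hsub : Icc 0 (Real.pi / 2) ⊆ Icc 0 Real.pi := Icc_subset_Icc_right (by linarith)
  have hc1 := (continuousOn_one_add_mul_sin_rpow hT.le (-(3 / 2))).mono hsub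
  have hc2 : ContinuousOn (fun φ : ℝ => (1 + a * φ) ^ (-(3 / 2) : ℝ)) (Icc 0 (Real.pi / 2)) :=
    (continuousOn_one_add_mul_rpow ha0.le _).mono Icc_subset_Ici_self
  have h1 : ∫ φ in (0)..(Real.pi / 2), (1 + T * Real.sin φ) ^ (-(3 / 2) : ℝ)
      ≤ ∫ φ in (0)..(Real.pi / 2), (1 + a * φ) ^ (-(3 / 2) : ℝ) := by
    refine intervalIntegral.integral_mono_on (by linarith)
      (hc1.intervalIntegrable_of_Icc (by linarith)) (hc2.intervalIntegrable_of_Icc (by linarith))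
      fun φ hφ => ?_
    have h2 := Real.mul_le_sin hφ.1 hφ.2
    refine Real.rpow_le_rpow_of_nonpos ?_ ?_ (by norm_num)
    · have := mul_nonneg ha0.le hφ.1
      positivity
    · have := mul_le_mul_of_nonneg_left h2 hT.le
      rw [ha]
      linarith
  have h2 : ∀ φ ∈ uIcc 0 (Real.pi / 2), HasDerivAt
      (fun φ : ℝ => -(2 / a) * (1 + a * φ) ^ (-(1 / 2) : ℝ)) ((1 + a * φ) ^ (-(3 / 2) : ℝ)) φ :=
    fun φ hφ => by
      rw [uIcc_of_le (by linarith)] at hφ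
      have hp : 0 < 1 + a * φ := by
        have := mul_nonneg ha0.le hφ.1
        positivity
      have h3 : HasDerivAt (fun φ : ℝ => 1 + a * φ) a φ := by
        simpa using ((hasDerivAt_id φ).const_mul a).const_add 1
      refine ((h3.rpow_const (p := -(1 / 2)) (Or.inl hp.ne')).const_mul (-(2 / a))).congr_deriv ?_
      rw [show (-(1 / 2) - 1 : ℝ) = -(3 / 2) by norm_num]
      field_simp
  rw [intervalIntegral.integral_eq_sub_of_hasDerivAt h2
    (hc2.intervalIntegrable_of_Icc (by linarith))] at h1
  refine h1.trans ?_
  have h4 : 0 ≤ (1 + a * (Real.pi / 2)) ^ (-(1 / 2) : ℝ) := by positivity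
  have h5 : 2 / a = Real.pi / T := by rw [ha]; field_simp
  simp only [mul_zero, add_zero, Real.one_rpow]
  rw [h5]
  have : 0 ≤ Real.pi / T * (1 + a * (Real.pi / 2)) ^ (-(1 / 2) : ℝ) := by positivity
  linarith

/-- The factor sin φ absorbs one power near the poles: s(1 + Ts)^{-5/2} ≤ T^{-1}(1 + Ts)^{-3/2}, and
the remaining integral is again O(1/T). The trivial bound π covers small T, and 3π = π + 2π. -/
theorem integral_sin_mul_rpow_le {T : ℝ} (hT : 0 ≤ T) :
    ∫ φ in (0)..Real.pi, Real.sin φ * (1 + T * Real.sin φ) ^ (-(5 / 2) : ℝ)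
      ≤ 3 * Real.pi / (1 + T ^ 2) := by
  have hpi := Real.pi_pos
  have hcI : ContinuousOn (fun φ => Real.sin φ * (1 + T * Real.sin φ) ^ (-(5 / 2) : ℝ))
      (Icc 0 Real.pi) :=
    Real.continuous_sin.continuousOn.mul (continuousOn_one_add_mul_sin_rpow hT _)
  have hI := hcI.intervalIntegrable_of_Icc (μ := volume) hpi.le
  rw [le_div_iff₀ (by positivity)]
  have h1 : ∫ φ in (0)..Real.pi, Real.sin φ * (1 + T * Real.sin φ) ^ (-(5 / 2) : ℝ)
      ≤ Real.pi := by
    have := intervalIntegral.integral_mono_on hpi.le hI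
      (intervalIntegrable_const (c := (1 : ℝ))) fun φ hφ => by
        have hs := Real.sin_nonneg_of_nonneg_of_le_pi hφ.1 hφ.2
        have h2 : (1 + T * Real.sin φ) ^ (-(5 / 2) : ℝ) ≤ 1 :=
          Real.rpow_le_one_of_one_le_of_nonpos (by nlinarith [mul_nonneg hT hs]) (by norm_num)
        exact mul_le_one₀ (Real.sin_le_one φ) (by positivity) h2
    simpa using this
  have h2 : T ^ 2 * ∫ φ in (0)..Real.pi, Real.sin φ * (1 + T * Real.sin φ) ^ (-(5 / 2) : ℝ)
      ≤ 2 * Real.pi := by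
    rcases hT.eq_or_lt with rfl | hT0
    · simpa using hpi.le
    have hc : ContinuousOn (fun s : ℝ => s * (1 + T * s) ^ (-(5 / 2) : ℝ)) (Icc 0 1) :=
      continuousOn_id.mul ((continuousOn_one_add_mul_rpow hT _).mono Icc_subset_Ici_self)
    rw [integral_comp_sin_zero_pi (f := fun s => s * (1 + T * s) ^ (-(5 / 2) : ℝ)) hc]
    have hsub : Icc 0 (Real.pi / 2) ⊆ Icc 0 Real.pi := Icc_subset_Icc_right (by linarith)
    have h3 : ∫ φ in (0)..(Real.pi / 2), Real.sin φ * (1 + T * Real.sin φ) ^ (-(5 / 2) : ℝ)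
        ≤ ∫ φ in (0)..(Real.pi / 2), T⁻¹ * (1 + T * Real.sin φ) ^ (-(3 / 2) : ℝ) := by
      refine intervalIntegral.integral_mono_on (by linarith)
        ((hcI.mono hsub).intervalIntegrable_of_Icc (by linarith))
        ((continuousOn_const.mul ((continuousOn_one_add_mul_sin_rpow hT _).mono
          hsub)).intervalIntegrable_of_Icc (by linarith)) fun φ hφ => ?_
      have hs := Real.sin_nonneg_of_nonneg_of_le_pi hφ.1 (hsub hφ).2
      have hp : 0 < 1 + T * Real.sin φ := by positivity
      rw [show (-(3 / 2) : ℝ) = 1 + -(5 / 2) by norm_num, Real.rpow_add hp, Real.rpow_one,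
        ← mul_assoc]
      refine mul_le_mul_of_nonneg_right ?_ (by positivity)
      rw [mul_add, inv_mul_cancel_left₀ hT0.ne']
      have : 0 ≤ T⁻¹ * 1 := by positivity
      linarith
    rw [intervalIntegral.integral_const_mul] at h3
    have h4 := integral_one_add_mul_sin_rpow_le hT0
    have h5 := h3.trans (mul_le_mul_of_nonneg_left h4 (inv_nonneg.2 hT))
    rw [smul_eq_mul]
    calc _ ≤ T ^ 2 * (2 * (T⁻¹ * (Real.pi / T))) := by gcongr
      _ = 2 * Real.pi := by field_simp
  linarith

/-! ### Stationary phase at the equator -/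

theorem rpow_mul_sq_le {T s : ℝ} (hT : 0 < T) (h0 : 0 ≤ s) (h1 : s ≤ 1) :
    s ^ 2 * (1 + T * s) ^ (-(3 / 2) : ℝ) ≤ T ^ (-(3 / 2) : ℝ) := by
  rcases h0.eq_or_lt with rfl | hs
  · simp; positivity
  calc s ^ 2 * (1 + T * s) ^ (-(3 / 2) : ℝ) ≤ s ^ 2 * (T * s) ^ (-(3 / 2) : ℝ) := by
        gcongr ?_ * ?_
        exact Real.rpow_le_rpow_of_nonpos (by positivity) (by linarith) (by norm_num)
    _ = T ^ (-(3 / 2) : ℝ) * s ^ (1 / 2 : ℝ) := by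
        rw [Real.mul_rpow hT.le hs.le, ← Real.rpow_natCast s 2, mul_left_comm, ← Real.rpow_add hs]
        norm_num
    _ ≤ T ^ (-(3 / 2) : ℝ) * 1 := by
        gcongr
        exact Real.rpow_le_one h0 h1 (by norm_num)
    _ = _ := mul_one _

/-- Stationary phase estimate for the amplitudes `w φ * (1 + T sin φ) ^ (-3/2)`, where `w` is a
function of the size of `sin φ`. -/
theorem exists_norm_oscillatory_integral_le {k : ℝ} (hk : 0 < k) : ∃ C : ℝ, 0 ≤ C ∧ ∀ w w' : ℝ → ℝ,
    (∀ φ, HasDerivAt w (w' φ) φ) → Continuous w' →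
    (∀ φ ∈ Icc 0 (Real.pi / 2), 0 ≤ w φ ∧ w φ ≤ Real.sin φ ∧ |w' φ| ≤ 2 * Real.cos φ) →
    ∀ T : ℝ, 1 ≤ T → ‖∫ φ in (0)..(Real.pi / 2), Complex.exp (Complex.I * (k * T * Real.sin φ : ℝ))
      * ((w φ * (1 + T * Real.sin φ) ^ (-(3 / 2) : ℝ) : ℝ) : ℂ)‖ ≤ C / T ^ 2 := by
  refine ⟨k⁻¹ * (6 * Real.pi) + 2, by have := Real.pi_pos; positivity,
    fun w w' hw hw' hwb T hT => ?_⟩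
  have hpi := Real.pi_pos
  have hpi3 := Real.pi_gt_three
  have hT0 : 0 < T := by linarith
  -- The width of the stationary zone at φ = π/2, on which the phase kT sin φ varies by O(1).
  -- Integration by parts is used up to β = π/2 - δ, absolute values beyond.
  set δ : ℝ := T ^ (-(1 / 2) : ℝ) with hδ
  have hδ0 : 0 < δ := by positivity
  have hδ1 : δ ≤ 1 := Real.rpow_le_one_of_one_le_of_nonpos hT (by norm_num)
  set β := Real.pi / 2 - δ with hβ
  have hβ0 : 0 < β := by rw [hβ]; linarith
  have hβ1 : β < Real.pi / 2 := by rw [hβ]; linarith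
  have hsub : Icc 0 β ⊆ Icc 0 (Real.pi / 2) := Icc_subset_Icc_right hβ1.le
  have hsub' : Icc 0 (Real.pi / 2) ⊆ Icc 0 Real.pi := Icc_subset_Icc_right (by linarith)
  have hδ3 : T ^ (-(3 / 2) : ℝ) = δ * T⁻¹ := by
    rw [hδ, ← Real.rpow_neg_one T, ← Real.rpow_add hT0]; norm_num
  have hδ2 : δ * δ = T⁻¹ := by
    rw [hδ, ← Real.rpow_neg_one T, ← Real.rpow_add hT0]; norm_num
  set p : ℝ → ℝ := fun φ => (1 + T * Real.sin φ) ^ (-(3 / 2) : ℝ) with hp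
  set p' : ℝ → ℝ := fun φ => -(3 / 2) * (T * Real.cos φ) * (1 + T * Real.sin φ) ^ (-(5 / 2) : ℝ)
    with hp'
  have hsin : ∀ φ ∈ Icc 0 (Real.pi / 2), 0 ≤ Real.sin φ := fun φ hφ =>
    Real.sin_nonneg_of_nonneg_of_le_pi hφ.1 (by linarith [hφ.2])
  have hbase : ∀ φ ∈ Icc 0 (Real.pi / 2), 0 < 1 + T * Real.sin φ := fun φ hφ => by
    have := hsin φ hφ
    positivity
  have hpd : ∀ φ ∈ Icc 0 (Real.pi / 2), HasDerivAt p (p' φ) φ := fun φ hφ => by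
    have h := (((Real.hasDerivAt_sin φ).const_mul T).const_add 1).rpow_const (p := -(3 / 2))
      (Or.inl (hbase φ hφ).ne')
    refine h.congr_deriv ?_
    rw [hp', show (-(3 / 2) - 1 : ℝ) = -(5 / 2) by norm_num]
    ring
  have hpc : ContinuousOn p (Icc 0 (Real.pi / 2)) :=
    (continuousOn_one_add_mul_sin_rpow hT0.le _).mono hsub'
  have hp'c : ContinuousOn p' (Icc 0 (Real.pi / 2)) := ContinuousOn.mul (by fun_prop)
    ((continuousOn_one_add_mul_sin_rpow hT0.le _).mono hsub')
  have hwc : Continuous w := continuous_iff_continuousAt.2 fun φ => (hw φ).continuousAt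
  have hp0 : ∀ φ ∈ Icc 0 (Real.pi / 2), 0 ≤ p φ := fun φ hφ => Real.rpow_nonneg (hbase φ hφ).le _
  have hws : ∀ φ ∈ Icc 0 (Real.pi / 2), w φ * p φ * Real.sin φ ≤ δ * T⁻¹ := fun φ hφ => by
    rw [← hδ3]
    refine le_trans ?_ (rpow_mul_sq_le hT0 (hsin φ hφ) (Real.sin_le_one φ))
    have := mul_le_mul_of_nonneg_right (hwb φ hφ).2.1 (mul_nonneg (hp0 φ hφ) (hsin φ hφ))
    nlinarith
  have hcos : ∀ φ ∈ Icc 0 β, 2 / Real.pi * δ ≤ Real.cos φ := fun φ hφ => by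
    rw [← Real.sin_pi_div_two_sub]
    refine le_trans ?_ (Real.mul_le_sin (by linarith [hφ.2]) (by linarith [hφ.1]))
    gcongr
    linarith [hφ.2]
  have hcos0 : ∀ φ ∈ Icc 0 β, 0 < Real.cos φ := fun φ hφ =>
    lt_of_lt_of_le (by positivity) (hcos φ hφ)
  -- The amplitude depends on φ through sin φ, so its derivative carries a factor cos φ. This
  -- compensates the division by the derivative of the phase.
  have hp'b : ∀ φ ∈ Icc 0 β, |w' φ * p φ + w φ * p' φ| ≤ 4 * Real.cos φ * p φ := fun φ hφ => by
    have hm := hsub hφ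
    have hc := hcos0 φ hφ
    have h1 : |p' φ| = 3 / 2 * (T * Real.cos φ) * (1 + T * Real.sin φ) ^ (-(5 / 2) : ℝ) := by
      have := hbase φ hm
      rw [hp', abs_mul, abs_mul, abs_of_nonneg (a := (1 + T * Real.sin φ) ^ _) (by positivity),
        abs_of_pos (a := T * Real.cos φ) (by positivity), abs_neg, abs_of_pos (by norm_num)]
    have h2 : T * Real.sin φ * (1 + T * Real.sin φ) ^ (-(5 / 2) : ℝ) ≤ p φ := by
      have hb := hbase φ hm
      rw [hp]
      simp only
      rw [show (-(3 / 2) : ℝ) = 1 + -(5 / 2) by norm_num, Real.rpow_add hb, Real.rpow_one]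
      refine mul_le_mul_of_nonneg_right (by linarith) (by positivity)
    have h3 : w φ * |p' φ| ≤ 2 * Real.cos φ * p φ := by
      have hq : 0 ≤ (1 + T * Real.sin φ) ^ (-(5 / 2) : ℝ) := Real.rpow_nonneg (hbase φ hm).le _
      calc w φ * |p' φ| ≤ Real.sin φ * |p' φ| := by gcongr; exact (hwb φ hm).2.1
        _ = 3 / 2 * Real.cos φ * (T * Real.sin φ * (1 + T * Real.sin φ) ^ (-(5 / 2) : ℝ)) := by
          rw [h1]; ring
        _ ≤ 2 * Real.cos φ * p φ := by
          have := mul_nonneg (mul_nonneg hT0.le (hsin φ hm)) hq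
          gcongr
          norm_num
    calc |w' φ * p φ + w φ * p' φ| ≤ |w' φ * p φ| + |w φ * p' φ| := abs_add_le _ _
      _ = |w' φ| * p φ + w φ * |p' φ| := by
        rw [abs_mul, abs_mul, abs_of_nonneg (hp0 φ hm), abs_of_nonneg (hwb φ hm).1]
      _ ≤ 2 * Real.cos φ * p φ + 2 * Real.cos φ * p φ := by
        gcongr
        · exact hp0 φ hm
        · exact (hwb φ hm).2.2
      _ = _ := by ring
  -- The amplitude divided by the derivative of the phase, up to the constant kT.
  set ψ : ℝ → ℝ := fun φ => w φ * p φ / Real.cos φ with hψ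
  set ψ' : ℝ → ℝ := fun φ => ((w' φ * p φ + w φ * p' φ) * Real.cos φ
    - w φ * p φ * -Real.sin φ) / Real.cos φ ^ 2 with hψ'
  have hψd : ∀ φ ∈ Icc 0 β, HasDerivAt ψ (ψ' φ) φ := fun φ hφ =>
    ((hw φ).mul (hpd φ (hsub hφ))).div (Real.hasDerivAt_cos φ) (hcos0 φ hφ).ne'
  have hψ'c : ContinuousOn ψ' (Icc 0 β) := by
    have h1 := hpc.mono hsub
    have h2 := hp'c.mono hsub
    refine ContinuousOn.div (by fun_prop) (by fun_prop) fun φ hφ => ?_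
    exact pow_ne_zero 2 (hcos0 φ hφ).ne'
  have hψ'b : ∀ φ ∈ Icc 0 β, |ψ' φ| ≤ 4 * p φ + δ * T⁻¹ * (1 / Real.cos φ ^ 2) := fun φ hφ => by
    have hc := hcos0 φ hφ
    have hm := hsub hφ
    have e : ψ' φ = (w' φ * p φ + w φ * p' φ) / Real.cos φ
        + w φ * p φ * Real.sin φ * (1 / Real.cos φ ^ 2) := by
      simp only [hψ']
      field_simp
      ring
    rw [e]
    refine (abs_add_le _ _).trans (add_le_add ?_ ?_)
    · rw [abs_div, abs_of_pos hc, div_le_iff₀ hc]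
      linarith [hp'b φ hφ]
    · have h0 : 0 ≤ w φ * p φ * Real.sin φ :=
        mul_nonneg (mul_nonneg (hwb φ hm).1 (hp0 φ hm)) (hsin φ hm)
      rw [abs_of_nonneg (by positivity)]
      exact mul_le_mul_of_nonneg_right (hws φ hm) (by positivity)
  set u : ℝ → ℂ := fun φ => Complex.exp (Complex.I * (k * T * Real.sin φ : ℝ)) with hu
  have hu1 : ∀ φ, ‖u φ‖ = 1 := fun φ => by
    rw [hu]; simp only
    rw [mul_comm, Complex.norm_exp_ofReal_mul_I]
  have hud : ∀ φ, HasDerivAt u (Complex.I * (k * T * Real.cos φ : ℝ) * u φ) φ := fun φ => by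
    have h1 : HasDerivAt (fun φ => ((k * T * Real.sin φ : ℝ) : ℂ)) ((k * T * Real.cos φ : ℝ) : ℂ) φ :=
      ((Real.hasDerivAt_sin φ).const_mul (k * T)).ofReal_comp
    have h2 := (h1.const_mul Complex.I).cexp
    refine h2.congr_deriv ?_
    rw [hu]; ring
  have huc : Continuous u := by rw [hu]; fun_prop
  have hkT : (Complex.I * (k * T : ℝ)) ≠ 0 :=
    mul_ne_zero Complex.I_ne_zero (by exact_mod_cast (mul_pos hk hT0).ne')
  have hparts : ∫ φ in (0)..β, u φ * ((w φ * p φ : ℝ) : ℂ) = (Complex.I * (k * T : ℝ))⁻¹ *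
      (u β * (ψ β : ℂ) - ∫ φ in (0)..β, u φ * (ψ' φ : ℂ)) := by
    have h1 := intervalIntegral.integral_mul_deriv_eq_deriv_mul (a := 0) (b := β)
      (u := fun φ => (ψ φ : ℂ)) (u' := fun φ => (ψ' φ : ℂ)) (v := u)
      (v' := fun φ => Complex.I * (k * T * Real.cos φ : ℝ) * u φ)
      (fun φ hφ => by
        rw [uIcc_of_le hβ0.le] at hφ
        exact (hψd φ hφ).ofReal_comp) (fun φ _ => hud φ)
      (((Complex.continuous_ofReal.comp_continuousOn hψ'c)).intervalIntegrable_of_Icc hβ0.le)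
      (Continuous.intervalIntegrable (by fun_prop) _ _)
    -- The bounds 0 ≤ w ≤ sin force w to vanish at 0, so there is no boundary term at the pole.
    have hψ0 : ψ 0 = 0 := by
      have := hwb 0 ⟨le_rfl, by linarith⟩
      rw [Real.sin_zero] at this
      simp [hψ, le_antisymm this.2.1 this.1]
    have h2 : ∫ φ in (0)..β, (ψ φ : ℂ) * (Complex.I * (k * T * Real.cos φ : ℝ) * u φ)
        = (Complex.I * (k * T : ℝ)) * ∫ φ in (0)..β, u φ * ((w φ * p φ : ℝ) : ℂ) := by
      rw [← intervalIntegral.integral_const_mul]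
      refine intervalIntegral.integral_congr fun φ hφ => ?_
      rw [uIcc_of_le hβ0.le] at hφ
      have hc : Complex.cos φ ≠ 0 := by
        rw [← Complex.ofReal_cos]
        exact_mod_cast (hcos0 φ hφ).ne'
      simp only [hψ]
      push_cast
      field_simp
    rw [h2, hψ0] at h1
    rw [eq_inv_mul_iff_mul_eq₀ hkT, h1]
    simp only [Complex.ofReal_zero, zero_mul, sub_zero]
    congr 1
    · ring
    · congr 1
      funext φ
      ring
  -- At β the amplitude is at most 2δ/T because sin β ≥ 1/2, while cos β ≥ 2δ/π.
  have hψβ : |ψ β| ≤ Real.pi * T⁻¹ := by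
    have hm : β ∈ Icc 0 β := ⟨hβ0.le, le_rfl⟩
    have hc := hcos β hm
    have hs : 1 / 2 ≤ Real.sin β := by
      rw [hβ, Real.sin_pi_div_two_sub]
      have := Real.one_sub_sq_div_two_le_cos (x := δ)
      nlinarith
    have h1 := hws β (hsub hm)
    have h2 : 0 ≤ w β * p β := mul_nonneg (hwb β (hsub hm)).1 (hp0 β (hsub hm))
    have h3 : w β * p β ≤ 2 * (δ * T⁻¹) := by nlinarith
    rw [hψ]; simp only
    rw [abs_of_nonneg (div_nonneg h2 (hcos0 β hm).le), div_le_iff₀ (hcos0 β hm)]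
    calc w β * p β ≤ 2 * (δ * T⁻¹) := h3
      _ = Real.pi * T⁻¹ * (2 / Real.pi * δ) := by field_simp
      _ ≤ _ := by gcongr
  -- The part 4p integrates to at most 4π/T. The part with 1/cos² has primitive tan, and δ tan β ≤ π
  -- gives another π/T.
  have hint : ‖∫ φ in (0)..β, u φ * (ψ' φ : ℂ)‖ ≤ 5 * Real.pi * T⁻¹ := by
    have hci : ContinuousOn (fun φ => 4 * p φ + δ * T⁻¹ * (1 / Real.cos φ ^ 2)) (Icc 0 β) := by
      have h1 := hpc.mono hsub
      refine (h1.const_mul 4 |>.add (ContinuousOn.mul continuousOn_const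
        (ContinuousOn.div continuousOn_const (by fun_prop) fun φ hφ =>
          pow_ne_zero 2 (hcos0 φ hφ).ne')))
    have hi := hci.intervalIntegrable_of_Icc (μ := volume) hβ0.le
    have h1 : ‖∫ φ in (0)..β, u φ * (ψ' φ : ℂ)‖
        ≤ ∫ φ in (0)..β, (4 * p φ + δ * T⁻¹ * (1 / Real.cos φ ^ 2)) := by
      refine intervalIntegral.norm_integral_le_of_norm_le hβ0.le
        (Eventually.of_forall fun φ hφ => ?_) hi
      rw [norm_mul, hu1, one_mul, Complex.norm_real, Real.norm_eq_abs]
      exact hψ'b φ ⟨hφ.1.le, hφ.2⟩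
    have hc4 : ContinuousOn (fun φ => 1 / Real.cos φ ^ 2) (Icc 0 β) :=
      ContinuousOn.div continuousOn_const (by fun_prop) fun φ hφ =>
          pow_ne_zero 2 (hcos0 φ hφ).ne'
    have hip := (hpc.mono hsub).intervalIntegrable_of_Icc (μ := volume) hβ0.le
    have hic := hc4.intervalIntegrable_of_Icc (μ := volume) hβ0.le
    have h2 : ∫ φ in (0)..β, (4 * p φ + δ * T⁻¹ * (1 / Real.cos φ ^ 2))
        = 4 * (∫ φ in (0)..β, p φ) + δ * T⁻¹ * Real.tan β := by
      rw [intervalIntegral.integral_add (hip.const_mul 4) (hic.const_mul _),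
        intervalIntegral.integral_const_mul, intervalIntegral.integral_const_mul,
        intervalIntegral.integral_eq_sub_of_hasDerivAt (f := Real.tan) (fun φ hφ => by
          rw [uIcc_of_le hβ0.le] at hφ
          exact Real.hasDerivAt_tan (hcos0 φ hφ).ne') hic, Real.tan_zero, sub_zero]
    have h3 : ∫ φ in (0)..β, p φ ≤ Real.pi * T⁻¹ := by
      refine le_trans ?_ (integral_one_add_mul_sin_rpow_le hT0)
      refine intervalIntegral.integral_mono_interval le_rfl hβ0.le hβ1.le ?_
        (hpc.intervalIntegrable_of_Icc (by linarith))
      refine (ae_restrict_iff' measurableSet_Ioc).2 (Eventually.of_forall fun φ hφ => ?_)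
      exact hp0 φ ⟨hφ.1.le, hφ.2⟩
    have h4 : Real.tan β * δ ≤ Real.pi := by
      have hm : β ∈ Icc 0 β := ⟨hβ0.le, le_rfl⟩
      rw [Real.tan_eq_sin_div_cos, div_mul_eq_mul_div, div_le_iff₀ (hcos0 β hm)]
      calc Real.sin β * δ ≤ 1 * δ := by gcongr; exact Real.sin_le_one β
        _ ≤ 2 * δ := by linarith
        _ = Real.pi * (2 / Real.pi * δ) := by field_simp
        _ ≤ _ := by gcongr; exact hcos β hm
    have h5 : δ * T⁻¹ * Real.tan β ≤ Real.pi * T⁻¹ := by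
      have := mul_le_mul_of_nonneg_right h4 (inv_nonneg.2 hT0.le)
      linarith
    linarith
  -- An amplitude at most 2δ/T over an interval of length δ, with δ² = 1/T.
  have hend : ‖∫ φ in β..(Real.pi / 2), u φ * ((w φ * p φ : ℝ) : ℂ)‖ ≤ 2 * (T⁻¹ * T⁻¹) := by
    have h1 := intervalIntegral.norm_integral_le_of_norm_le_const (a := β) (b := Real.pi / 2)
      (f := fun φ => u φ * ((w φ * p φ : ℝ) : ℂ)) (C := 2 * (δ * T⁻¹)) fun φ hφ => by
        rw [uIoc_of_le hβ1.le] at hφ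
        have hm : φ ∈ Icc 0 (Real.pi / 2) := ⟨by linarith [hφ.1], hφ.2⟩
        have hs : 1 / 2 ≤ Real.sin φ := by
          rw [← Real.cos_pi_div_two_sub]
          have := Real.one_sub_sq_div_two_le_cos (x := Real.pi / 2 - φ)
          have h5 : 0 ≤ Real.pi / 2 - φ := by linarith [hφ.2]
          have h6 : Real.pi / 2 - φ ≤ 1 := by linarith [hφ.1]
          nlinarith
        have h2 : 0 ≤ w φ * p φ := mul_nonneg (hwb φ hm).1 (hp0 φ hm)
        rw [norm_mul, hu1, one_mul, Complex.norm_real, Real.norm_eq_abs, abs_of_nonneg h2]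
        nlinarith [hws φ hm]
    refine h1.trans_eq ?_
    rw [hβ, sub_sub_cancel, abs_of_pos hδ0, ← hδ2]
    have : δ * δ * (δ * δ) = δ * (δ * δ) * δ := by ring
    rw [mul_assoc, this]
  have hcw : ContinuousOn (fun φ => u φ * ((w φ * p φ : ℝ) : ℂ)) (Icc 0 (Real.pi / 2)) :=
    huc.continuousOn.mul (Complex.continuous_ofReal.comp_continuousOn (hwc.continuousOn.mul hpc))
  rw [← intervalIntegral.integral_add_adjacent_intervals (b := β)
    ((hcw.mono hsub).intervalIntegrable_of_Icc hβ0.le)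
    ((hcw.mono (Icc_subset_Icc_left hβ0.le)).intervalIntegrable_of_Icc hβ1.le), hparts]
  refine (norm_add_le _ _).trans ?_
  have hn : ‖(Complex.I * (k * T : ℝ))⁻¹‖ = k⁻¹ * T⁻¹ := by
    rw [norm_inv, norm_mul, Complex.norm_I, one_mul, Complex.norm_real, Real.norm_eq_abs,
      abs_of_pos (by positivity), mul_inv]
  have h7 : ‖u β * (ψ β : ℂ) - ∫ φ in (0)..β, u φ * (ψ' φ : ℂ)‖ ≤ 6 * Real.pi * T⁻¹ := by
    refine (norm_sub_le _ _).trans ?_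
    rw [norm_mul, hu1, one_mul, Complex.norm_real, Real.norm_eq_abs]
    linarith
  rw [norm_mul, hn]
  calc _ ≤ k⁻¹ * T⁻¹ * (6 * Real.pi * T⁻¹) + 2 * (T⁻¹ * T⁻¹) := by gcongr
    _ = _ := by field_simp

end WaveDecay
end

noncomputable section

namespace WaveDecay

open Set MeasureTheory Filter Topology
open scoped Manifold EuclideanSpace

/-! ### Decay in the plane for data with an oscillating far field -/

/-- The standard basis of the plane, completed by zero to a family of three vectors. -/
def planeFrame : Fin 3 → Sp 2 := ![EuclideanSpace.single 0 1, EuclideanSpace.single 1 1, 0]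

theorem dir_planeFrame (z : ℝ × ℝ) : dir planeFrame z = Real.sin z.1 • dirHor planeFrame z := by
  simp [dir, dirHor, planeFrame, smul_smul]

theorem norm_dirHor_planeFrame (z : ℝ × ℝ) : ‖dirHor planeFrame z‖ = 1 := by
  rw [EuclideanSpace.norm_eq]
  simp [dirHor, planeFrame]

theorem continuous_dirHor (b : Fin 3 → Sp 2) : Continuous (dirHor b) := by
  unfold dirHor
  fun_prop

theorem ray_planeFrame (x : Sp 2) (r : ℝ) (z : ℝ × ℝ) :
    ray planeFrame x r z = x + (r * Real.sin z.1) • dirHor planeFrame z := by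
  rw [ray, dir_planeFrame, smul_smul]

/-- `f (x + r e) = e^{ikr} (1 + r)^{-3/2} α(x, e) + O((1 + r)^{-5/2})`, locally uniformly in `x`. -/
def HasFarField (k : ℝ) (f : Sp 2 → ℂ) : Prop :=
  ∃ α : Sp 2 → Sp 2 → ℂ, (∀ x, ContinuousOn (α x) (Metric.sphere 0 1)) ∧
    ∀ R : ℝ, ∃ C : ℝ, 0 ≤ C ∧ ∀ x r e, ‖x‖ ≤ R → 0 ≤ r → ‖e‖ = 1 →
      ‖α x e‖ ≤ C ∧ ‖f (x + r • e) - Complex.exp (Complex.I * (k * r : ℝ))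
        * (((1 + r) ^ (-(3 / 2) : ℝ) : ℝ) : ℂ) * α x e‖ ≤ C * (1 + r) ^ (-(5 / 2) : ℝ)

/-- `∂_r f (x + r e) = i k f (x + r e) + O((1 + r)^{-5/2})`, locally uniformly in `x`. -/
def Radiates (k : ℝ) (f : Sp 2 → ℂ) : Prop :=
  ∀ R : ℝ, ∃ C : ℝ, 0 ≤ C ∧ ∀ x r e, ‖x‖ ≤ R → 0 ≤ r → ‖e‖ = 1 →
    ‖fderiv ℝ f (x + r • e) e - Complex.I * (k : ℂ) * f (x + r • e)‖ ≤ C * (1 + r) ^ (-(5 / 2) : ℝ)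

theorem HasFarField.add {k : ℝ} {f g : Sp 2 → ℂ} (hf : HasFarField k f) (hg : HasFarField k g) :
    HasFarField k (f + g) := by
  obtain ⟨α, hα, hf⟩ := hf
  obtain ⟨β, hβ, hg⟩ := hg
  refine ⟨fun x e => α x e + β x e, fun x => (hα x).add (hβ x), fun R => ?_⟩
  obtain ⟨C, hC, h⟩ := hf R
  obtain ⟨C', hC', h'⟩ := hg R
  refine ⟨C + C', add_nonneg hC hC', fun x r e hx hr he => ⟨?_, ?_⟩⟩
  · exact (norm_add_le _ _).trans (add_le_add (h x r e hx hr he).1 (h' x r e hx hr he).1)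
  · rw [Pi.add_apply, mul_add, add_sub_add_comm, add_mul]
    exact (norm_add_le _ _).trans (add_le_add (h x r e hx hr he).2 (h' x r e hx hr he).2)

theorem HasFarField.smul {k : ℝ} {f : Sp 2 → ℂ} (hf : HasFarField k f) (a : ℂ) :
    HasFarField k (a • f) := by
  obtain ⟨α, hα, hf⟩ := hf
  refine ⟨fun x e => a * α x e, fun x => continuousOn_const.mul (hα x), fun R => ?_⟩
  obtain ⟨C, hC, h⟩ := hf R
  refine ⟨‖a‖ * C, by positivity, fun x r e hx hr he => ⟨?_, ?_⟩⟩
  · rw [norm_mul]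
    exact mul_le_mul_of_nonneg_left (h x r e hx hr he).1 (norm_nonneg a)
  · rw [Pi.smul_apply, smul_eq_mul, mul_left_comm, ← mul_sub, norm_mul, mul_assoc ‖a‖]
    exact mul_le_mul_of_nonneg_left (h x r e hx hr he).2 (norm_nonneg a)

theorem Radiates.add {k : ℝ} {f g : Sp 2 → ℂ} (hf : Radiates k f) (hg : Radiates k g)
    (df : Differentiable ℝ f) (dg : Differentiable ℝ g) : Radiates k (f + g) := fun R => by
  obtain ⟨C, hC, h⟩ := hf R
  obtain ⟨C', hC', h'⟩ := hg R
  refine ⟨C + C', add_nonneg hC hC', fun x r e hx hr he => ?_⟩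
  rw [fderiv_add (df _) (dg _), add_apply, Pi.add_apply, mul_add, add_sub_add_comm, add_mul]
  exact (norm_add_le _ _).trans (add_le_add (h x r e hx hr he) (h' x r e hx hr he))

theorem Radiates.smul {k : ℝ} {f : Sp 2 → ℂ} (hf : Radiates k f) (df : Differentiable ℝ f) (a : ℂ) :
    Radiates k (a • f) := fun R => by
  obtain ⟨C, hC, h⟩ := hf R
  refine ⟨‖a‖ * C, by positivity, fun x r e hx hr he => ?_⟩
  rw [fderiv_const_smul (df _), smul_apply, Pi.smul_apply, smul_eq_mul, smul_eq_mul, mul_left_comm,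
    ← mul_sub, norm_mul, mul_assoc ‖a‖]
  exact mul_le_mul_of_nonneg_left (h x r e hx hr he) (norm_nonneg a)

/-- Comparison of the weights along a ray and in space. -/
theorem one_add_norm_rpow_le {p R r : ℝ} (hp : p ≤ 0) {x e : Sp 2} (hx : ‖x‖ ≤ R) (hr : 0 ≤ r)
    (he : ‖e‖ = 1) : (1 + ‖x + r • e‖) ^ p ≤ (1 + R) ^ (-p) * (1 + r) ^ p := by
  have hR : 0 ≤ R := (norm_nonneg x).trans hx
  have h1 : r ≤ ‖x + r • e‖ + ‖x‖ := by
    have := norm_sub_le (x + r • e) x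
    rwa [add_sub_cancel_left, norm_smul, he, mul_one, Real.norm_eq_abs, abs_of_nonneg hr] at this
  have h2 : (1 + R)⁻¹ * (1 + r) ≤ 1 + ‖x + r • e‖ := by
    rw [inv_mul_le_iff₀ (by positivity)]
    nlinarith [norm_nonneg (x + r • e)]
  refine (Real.rpow_le_rpow_of_nonpos (by positivity) h2 hp).trans_eq ?_
  rw [Real.mul_rpow (by positivity) (by positivity), Real.inv_rpow (by positivity),
    Real.rpow_neg (by positivity)]

/-- A function of the size of the error terms has far field zero. -/
theorem HasFarField.of_norm_le {k M : ℝ} {f : Sp 2 → ℂ}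
    (h : ∀ y, ‖f y‖ ≤ M * (1 + ‖y‖) ^ (-(5 / 2) : ℝ)) : HasFarField k f := by
  have hM : 0 ≤ M := by
    have := (norm_nonneg _).trans (h 0)
    simpa using this
  refine ⟨fun _ _ => 0, fun _ => continuousOn_const, fun R =>
    ⟨M * |(1 + R) ^ (-(-(5 / 2)) : ℝ)|, by positivity, fun x r e hx hr he => ⟨?_, ?_⟩⟩⟩
  · rw [norm_zero]
    positivity
  · rw [mul_zero, sub_zero, mul_assoc]
    refine (h _).trans (mul_le_mul_of_nonneg_left ?_ hM)
    refine (one_add_norm_rpow_le (by norm_num) hx hr he).trans ?_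
    gcongr
    exact le_abs_self _

theorem Radiates.of_norm_le {k M : ℝ} {f : Sp 2 → ℂ}
    (h : ∀ y, ‖f y‖ ≤ M * (1 + ‖y‖) ^ (-(5 / 2) : ℝ))
    (h' : ∀ y, ‖fderiv ℝ f y‖ ≤ M * (1 + ‖y‖) ^ (-(5 / 2) : ℝ)) : Radiates k f := fun R => by
  have hM : 0 ≤ M := by
    have := (norm_nonneg _).trans (h 0)
    simpa using this
  refine ⟨(1 + |k|) * (M * |(1 + R) ^ (-(-(5 / 2)) : ℝ)|), by positivity, fun x r e hx hr he => ?_⟩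
  have h3 := (one_add_norm_rpow_le (p := -(5 / 2)) (by norm_num) hx hr he).trans
    (mul_le_mul_of_nonneg_right (le_abs_self _) (by positivity))
  have h1 : ‖fderiv ℝ f (x + r • e) e‖ ≤ M * (1 + ‖x + r • e‖) ^ (-(5 / 2) : ℝ) := by
    refine ((fderiv ℝ f _).le_opNorm e).trans ?_
    rw [he, mul_one]
    exact h' _
  have h2 : ‖Complex.I * (k : ℂ) * f (x + r • e)‖
      ≤ |k| * (M * (1 + ‖x + r • e‖) ^ (-(5 / 2) : ℝ)) := by
    rw [norm_mul, norm_mul, Complex.norm_I, one_mul, Complex.norm_real, Real.norm_eq_abs]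
    exact mul_le_mul_of_nonneg_left (h _) (abs_nonneg k)
  calc _ ≤ M * (1 + ‖x + r • e‖) ^ (-(5 / 2) : ℝ)
        + |k| * (M * (1 + ‖x + r • e‖) ^ (-(5 / 2) : ℝ)) :=
        (norm_sub_le _ _).trans (add_le_add h1 h2)
    _ = (1 + |k|) * (M * (1 + ‖x + r • e‖) ^ (-(5 / 2) : ℝ)) := by ring
    _ ≤ (1 + |k|) * (M * (|(1 + R) ^ (-(-(5 / 2)) : ℝ)| * (1 + r) ^ (-(5 / 2) : ℝ))) := by gcongr
    _ = _ := by ring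

theorem DecaysLocally.of_le_div {d : ℕ} {u : Sp d × ℝ → ℂ} (hu : Continuous u) {t₀ : ℝ}
    (h0 : 0 < t₀) (h : ∀ R, ∃ C, ∀ x t, ‖x‖ ≤ R → t₀ ≤ t → ‖u (x, t)‖ ≤ C / t) :
    DecaysLocally u := fun R => by
  obtain ⟨C, hC⟩ := h R
  obtain ⟨M, hM⟩ := ((isCompact_closedBall (0 : Sp d) R).prod
    (isCompact_Icc (a := 0) (b := t₀))).exists_bound_of_continuousOn hu.continuousOn
  refine ⟨|M| * (1 + t₀) + |C| * (1 / t₀ + 1), fun x t hx ht => ?_⟩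
  rw [le_div_iff₀ (by positivity)]
  rcases le_total t t₀ with h1 | h1
  · have := (hM (x, t) ⟨by simpa using hx, ht, h1⟩).trans (le_abs_self M)
    have h2 : 0 ≤ |C| * (1 / t₀ + 1) := by positivity
    have h3 : ‖u (x, t)‖ * (1 + t) ≤ |M| * (1 + t₀) := by gcongr
    linarith
  · have ht0 : 0 < t := h0.trans_le h1
    have h2 : ‖u (x, t)‖ ≤ |C| / t := (hC x t hx h1).trans (by gcongr; exact le_abs_self C)
    have h3 : 0 ≤ |M| * (1 + t₀) := by positivity
    have h4 : ‖u (x, t)‖ * (1 + t) ≤ |C| * (1 / t₀ + 1) := by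
      calc ‖u (x, t)‖ * (1 + t) ≤ |C| / t * (1 + t) := by gcongr
        _ = |C| * (1 / t + 1) := by field_simp
        _ ≤ |C| * (1 / t₀ + 1) := by gcongr
    linarith

/-! ### Oscillating integrals over the sphere and decay of planar Kirchhoff integrals -/

/-- The oscillating factor `e^{ikr} (1 + |r|)^{-3/2}`. -/
def oscFactor (k r : ℝ) : ℂ :=
  Complex.exp (Complex.I * (k * r : ℝ)) * (((1 + |r|) ^ (-(3 / 2) : ℝ) : ℝ) : ℂ)

@[fun_prop] theorem continuous_one_add_abs_rpow (p : ℝ) : Continuous fun r : ℝ => (1 + |r|) ^ p :=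
  Continuous.rpow_const (by fun_prop) fun r => Or.inl (by positivity)

@[fun_prop] theorem continuous_oscFactor (k : ℝ) : Continuous (oscFactor k) := by
  unfold oscFactor
  have := continuous_one_add_abs_rpow (-(3 / 2))
  fun_prop

/-- The weight sin φ is the area element. The weight sin² φ occurs with the radial derivative, since
a planar direction is sin φ times a unit vector. -/
theorem exists_norm_integral_oscFactor_le {k : ℝ} (hk : 0 < k) : ∃ C : ℝ, 0 ≤ C ∧
    ∀ n : ℕ, (n = 1 ∨ n = 2) → ∀ T : ℝ, 1 ≤ T →
      ‖∫ φ in (0)..Real.pi, (Real.sin φ ^ n : ℝ) • oscFactor k (T * Real.sin φ)‖ ≤ C / T ^ 2 := by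
  obtain ⟨C, hC, h⟩ := exists_norm_oscillatory_integral_le hk
  refine ⟨2 * C, by positivity, fun n hn T hT => ?_⟩
  have hpi := Real.pi_pos
  rw [integral_comp_sin_zero_pi (f := fun s => (s ^ n : ℝ) • oscFactor k (T * s))
    (Continuous.continuousOn (by fun_prop)), norm_smul, Real.norm_eq_abs, abs_two, mul_div_assoc]
  refine mul_le_mul_of_nonneg_left ?_ two_pos.le
  have e : ∫ φ in (0)..(Real.pi / 2), (Real.sin φ ^ n : ℝ) • oscFactor k (T * Real.sin φ)
      = ∫ φ in (0)..(Real.pi / 2), Complex.exp (Complex.I * (k * T * Real.sin φ : ℝ))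
        * (((Real.sin φ ^ n) * (1 + T * Real.sin φ) ^ (-(3 / 2) : ℝ) : ℝ) : ℂ) := by
    refine intervalIntegral.integral_congr fun φ hφ => ?_
    rw [uIcc_of_le (by positivity)] at hφ
    have hs : 0 ≤ Real.sin φ := Real.sin_nonneg_of_nonneg_of_le_pi hφ.1 (by linarith [hφ.2])
    simp only [oscFactor]
    rw [abs_of_nonneg (by positivity), Complex.real_smul, mul_assoc k]
    push_cast
    ring
  rw [e]
  refine h (fun φ => Real.sin φ ^ n) (fun φ => (n : ℝ) * Real.sin φ ^ (n - 1) * Real.cos φ)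
    (fun φ => (Real.hasDerivAt_sin φ).pow n) (by fun_prop) (fun φ hφ => ?_) T hT
  have hs : 0 ≤ Real.sin φ := Real.sin_nonneg_of_nonneg_of_le_pi hφ.1 (by linarith [hφ.2])
  have hs1 := Real.sin_le_one φ
  have hc : 0 ≤ Real.cos φ := Real.cos_nonneg_of_neg_pi_div_two_le_of_le (by linarith [hφ.1]) hφ.2
  rcases hn with rfl | rfl
  · refine ⟨by positivity, by simp, ?_⟩
    simp only [Nat.cast_one, Nat.sub_self, pow_zero, one_mul, abs_of_nonneg hc]
    linarith
  · refine ⟨by positivity, by nlinarith, ?_⟩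
    rw [abs_of_nonneg (by positivity)]
    simp only [Nat.cast_ofNat, Nat.add_one_sub_one, pow_one]
    nlinarith

/-- The spherical integral of an oscillating amplitude. -/
theorem exists_norm_integral_angles_oscFactor_le {k : ℝ} (hk : 0 < k) : ∃ C : ℝ, 0 ≤ C ∧
    ∀ n : ℕ, (n = 1 ∨ n = 2) → ∀ (a : ℝ → ℂ) (A : ℝ), Continuous a → (∀ θ, ‖a θ‖ ≤ A) →
      ∀ T : ℝ, 1 ≤ T → ‖∫ z in angles, (Real.sin z.1 ^ n : ℝ) •
        (oscFactor k (T * Real.sin z.1) * a z.2)‖ ≤ C * A / T ^ 2 := by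
  obtain ⟨C, hC, h⟩ := exists_norm_integral_oscFactor_le hk
  have hpi := Real.pi_pos
  refine ⟨C * (2 * Real.pi), by positivity, fun n hn a A ha hA T hT => ?_⟩
  rw [setIntegral_angles (by fun_prop)]
  simp only
  have e : (fun φ => ∫ θ in (0)..(2 * Real.pi), (Real.sin φ ^ n : ℝ) •
      (oscFactor k (T * Real.sin φ) * a θ)) = fun φ => ((Real.sin φ ^ n : ℝ) •
      oscFactor k (T * Real.sin φ)) * ∫ θ in (0)..(2 * Real.pi), a θ := by
    funext φ
    rw [← intervalIntegral.integral_const_mul]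
    simp only [smul_mul_assoc]
  rw [e, intervalIntegral.integral_mul_const, norm_mul]
  have h1 : ‖∫ θ in (0)..(2 * Real.pi), a θ‖ ≤ A * (2 * Real.pi) := by
    have := intervalIntegral.norm_integral_le_of_norm_le_const (a := 0) (b := 2 * Real.pi)
      (f := a) fun θ _ => hA θ
    rwa [sub_zero, abs_of_pos (by positivity)] at this
  calc _ ≤ C / T ^ 2 * (A * (2 * Real.pi)) := by
        gcongr
        exact h n hn T hT
    _ = _ := by ring

theorem integral_angles_sin_mul_rpow_le {T : ℝ} (hT : 0 ≤ T) :
    ∫ z in angles, Real.sin z.1 * (1 + |T * Real.sin z.1|) ^ (-(5 / 2) : ℝ)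
      ≤ 6 * Real.pi ^ 2 / (1 + T ^ 2) := by
  have hpi := Real.pi_pos
  have hc := continuous_one_add_abs_rpow (-(5 / 2))
  rw [setIntegral_angles (F := fun z => Real.sin z.1 * (1 + |T * Real.sin z.1|) ^ (-(5 / 2) : ℝ))
    (Continuous.mul (by fun_prop) (hc.comp (by fun_prop)))]
  simp only [intervalIntegral.integral_const, sub_zero, smul_eq_mul]
  rw [intervalIntegral.integral_const_mul]
  have e : ∫ φ in (0)..Real.pi, Real.sin φ * (1 + |T * Real.sin φ|) ^ (-(5 / 2) : ℝ)
      = ∫ φ in (0)..Real.pi, Real.sin φ * (1 + T * Real.sin φ) ^ (-(5 / 2) : ℝ) := by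
    refine intervalIntegral.integral_congr fun φ hφ => ?_
    rw [uIcc_of_le hpi.le] at hφ
    have hs : 0 ≤ Real.sin φ := Real.sin_nonneg_of_nonneg_of_le_pi hφ.1 hφ.2
    rw [abs_of_nonneg (by positivity)]
  rw [e]
  calc _ ≤ 2 * Real.pi * (3 * Real.pi / (1 + T ^ 2)) :=
        mul_le_mul_of_nonneg_left (integral_sin_mul_rpow_le hT) (by positivity)
    _ = _ := by ring

/-- Far fields replace f₀ and f₁, and ik f₀ replaces the radial derivative of f₀. The model integral
is oscillatory of order T^{-2}, the errors have order T^{-2} by the -5/2 bound, and the weights in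
Kirchhoff's formula cost one factor T. -/
theorem decaysLocally_kir_planeFrame {k c : ℝ} (hk : 0 < k) (hc : 0 < c) {f₀ f₁ : Sp 2 → ℂ}
    (h₀ : ContDiff ℝ 1 f₀) (h₁ : Continuous f₁) (F₀ : HasFarField k f₀) (S₀ : Radiates k f₀)
    (F₁ : HasFarField k f₁) : DecaysLocally (kir planeFrame c f₀ f₁) := by
  have hcont : Continuous (kir planeFrame c f₀ f₁) :=
    (contDiff_kir planeFrame c (n := 0) (by simpa using h₀) (contDiff_zero.2 h₁)).continuous
  -- Only t ≥ 1/c matters, so that T = ct ≥ 1; earlier times are covered by continuity on a compact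
  -- set.
  refine DecaysLocally.of_le_div hcont (inv_pos.2 hc) fun R => ?_
  obtain ⟨α₀, hα₀, F₀⟩ := F₀
  obtain ⟨α₁, hα₁, F₁⟩ := F₁
  obtain ⟨C₀, hC₀, F₀⟩ := F₀ R
  obtain ⟨C₁, hC₁, F₁⟩ := F₁ R
  obtain ⟨B, hB, S₀⟩ := S₀ R
  obtain ⟨D, hD, hosc⟩ := exists_norm_integral_angles_oscFactor_le hk
  refine ⟨((C₀ + B + k * C₀ + C₁ / c) * (6 * Real.pi ^ 2) + (D * C₀ + k * (D * C₀) + D * C₁ / c)) / c,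
    fun x t hx ht => ?_⟩
  set T := c * t with hT
  have hT1 : 1 ≤ T := by
    rw [hT]
    calc (1 : ℝ) = c * c⁻¹ := (mul_inv_cancel₀ hc.ne').symm
      _ ≤ c * t := by gcongr
  have hT0 : 0 < T := by linarith
  have ht0 : 0 < t := (inv_pos.2 hc).trans_le ht
  have htT : t = T / c := by rw [hT]; field_simp
  set e : ℝ × ℝ → Sp 2 := fun z => dirHor planeFrame z with he
  have he1 : ∀ z, ‖e z‖ = 1 := norm_dirHor_planeFrame
  -- The horizontal unit vector depends on the longitude only, so the latitude 0 is a dummy value.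
  -- The amplitude factors out of the oscillatory integral in φ.
  have hamp : ∀ α : Sp 2 → Sp 2 → ℂ, (∀ x, ContinuousOn (α x) (Metric.sphere 0 1)) →
      Continuous fun θ : ℝ => α x (e (0, θ)) := fun α hα =>
    (hα x).comp_continuous ((continuous_dirHor planeFrame).comp (by fun_prop))
      fun θ => by simpa using he1 (0, θ)
  have hb₀ : ∀ θ : ℝ, ‖α₀ x (e (0, θ))‖ ≤ C₀ := fun θ => (F₀ x 0 _ hx le_rfl (he1 _)).1
  have hb₁ : ∀ θ : ℝ, ‖α₁ x (e (0, θ))‖ ≤ C₁ := fun θ => (F₁ x 0 _ hx le_rfl (he1 _)).1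
  have hc₀ := hamp α₀ hα₀
  have hc₁ := hamp α₁ hα₁
  set M : ℕ → (ℝ → ℂ) → ℝ × ℝ → ℂ := fun n a z =>
    (Real.sin z.1 ^ n : ℝ) • (oscFactor k (T * Real.sin z.1) * a z.2) with hM
  have hMi : ∀ n a, Continuous a → IntegrableOn (M n a) angles := fun n a ha =>
    (Continuous.continuousOn (by rw [hM]; fun_prop)).integrableOn_compact isCompact_angles
  set a₀ : ℝ → ℂ := fun θ => α₀ x (e (0, θ)) with ha₀
  set a₁ : ℝ → ℂ := fun θ => α₁ x (e (0, θ)) with ha₁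
  -- The Kirchhoff integrand with far fields inserted and the radial derivative replaced by
  -- multiplication with ik.
  set N : ℝ × ℝ → ℂ := fun z => M 1 a₀ z + (Complex.I * (k * T : ℝ)) * M 2 a₀ z
    + (t : ℂ) * M 1 a₁ z with hN
  have hNi : IntegrableOn N angles :=
    ((hMi 1 _ hc₀).add ((hMi 2 _ hc₀).const_mul _)).add ((hMi 1 _ hc₁).const_mul _)
  have hNle : ‖∫ z in angles, N z‖ ≤ (D * C₀ + k * (D * C₀) + D * C₁ / c) / T := by
    have e1 : ∫ z in angles, N z = (∫ z in angles, M 1 a₀ z)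
        + (Complex.I * (k * T : ℝ)) * (∫ z in angles, M 2 a₀ z)
        + (t : ℂ) * (∫ z in angles, M 1 a₁ z) := by
      have i : IntegrableOn (fun z => M 1 a₀ z + (Complex.I * (k * T : ℝ)) * M 2 a₀ z) angles :=
        (hMi 1 _ hc₀).add ((hMi 2 _ hc₀).const_mul _)
      simp only [hN]
      rw [integral_add i ((hMi 1 _ hc₁).const_mul _), integral_add (hMi 1 _ hc₀) ((hMi 2 _ hc₀).const_mul _),
        integral_const_mul, integral_const_mul]
    have m1 := hosc 1 (Or.inl rfl) a₀ C₀ hc₀ hb₀ T hT1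
    have m2 := hosc 2 (Or.inr rfl) a₀ C₀ hc₀ hb₀ T hT1
    have m3 := hosc 1 (Or.inl rfl) a₁ C₁ hc₁ hb₁ T hT1
    rw [e1]
    refine norm_add₃_le.trans ?_
    rw [norm_mul, norm_mul, norm_mul, Complex.norm_I, one_mul, Complex.norm_real, Complex.norm_real,
      Real.norm_eq_abs, Real.norm_eq_abs, abs_of_pos ht0, abs_of_pos (a := k * T) (by positivity)]
    calc _ ≤ D * C₀ / T ^ 2 + k * T * (D * C₀ / T ^ 2) + t * (D * C₁ / T ^ 2) := by gcongr
      _ ≤ D * C₀ / T + k * T * (D * C₀ / T ^ 2) + t * (D * C₁ / T ^ 2) := by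
        gcongr
        nlinarith
      _ = _ := by rw [htT]; field_simp
  set E : ℝ := C₀ + T * B + T * (k * C₀) + t * C₁ with hE
  have hEnn : 0 ≤ E := by rw [hE]; positivity
  have hdiff : ‖∫ z in angles, (kirIntegrand planeFrame c f₀ f₁ (x, t) z - N z)‖
      ≤ E * (6 * Real.pi ^ 2 / (1 + T ^ 2)) := by
    have h1 : ‖∫ z in angles, (kirIntegrand planeFrame c f₀ f₁ (x, t) z - N z)‖
        ≤ ∫ z in angles, E * (Real.sin z.1 * (1 + |T * Real.sin z.1|) ^ (-(5 / 2) : ℝ)) := by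
      have hcr := continuous_one_add_abs_rpow (-(5 / 2))
      refine norm_integral_le_of_norm_le ((Continuous.continuousOn (continuous_const.mul
        (Continuous.mul (by fun_prop) (hcr.comp (by fun_prop))))).integrableOn_compact
        isCompact_angles) ((ae_restrict_iff' isCompact_angles.measurableSet).2
          (Eventually.of_forall fun z hz => ?_))
      have hs := sin_nonneg_of_mem_angles hz
      have hTs : 0 ≤ T * Real.sin z.1 := by positivity
      have hs1 := Real.sin_le_one z.1
      rw [abs_of_nonneg hTs]
      set s := Real.sin z.1 with hsdef
      obtain ⟨-, A₀⟩ := F₀ x (T * s) (e z) hx hTs (he1 z)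
      obtain ⟨-, A₁⟩ := F₁ x (T * s) (e z) hx hTs (he1 z)
      have A₂ := S₀ x (T * s) (e z) hx hTs (he1 z)
      have hof : oscFactor k (T * s) = Complex.exp (Complex.I * (k * (T * s) : ℝ))
          * (((1 + T * s) ^ (-(3 / 2) : ℝ) : ℝ) : ℂ) := by rw [oscFactor, abs_of_nonneg hTs]
      rw [← hof] at A₀ A₁
      set q := (1 + T * s) ^ (-(5 / 2) : ℝ) with hq
      have hq0 : 0 ≤ q := by positivity
      set y := x + (T * s) • e z with hy
      set o := oscFactor k (T * s) with ho
      -- The third term arises because the radiation condition gives ik f₀, in which f₀ has still to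
      -- be replaced by its far field.
      have key : kirIntegrand planeFrame c f₀ f₁ (x, t) z - N z
          = (s : ℂ) * ((f₀ y - o * α₀ x (e z))
            + ((T * s : ℝ) : ℂ) * (fderiv ℝ f₀ y (e z) - Complex.I * (k : ℂ) * f₀ y)
            + ((T * s : ℝ) : ℂ) * (Complex.I * (k : ℂ) * (f₀ y - o * α₀ x (e z)))
            + (t : ℂ) * (f₁ y - o * α₁ x (e z))) := by
        simp only [kirIntegrand, hN, hM, ha₀, ha₁, ray_planeFrame, dir_planeFrame, map_smul,
          Complex.real_smul]
        rw [← hT, ← hsdef, ← ho, show dirHor planeFrame z = e z from rfl, ← hy,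
          show e (0, z.2) = e z from rfl]
        push_cast
        ring
      rw [key, norm_mul, Complex.norm_real, Real.norm_eq_abs, abs_of_nonneg hs, mul_left_comm E]
      refine mul_le_mul_of_nonneg_left ?_ hs
      have n1 : ‖((T * s : ℝ) : ℂ)‖ ≤ T := by
        rw [Complex.norm_real, Real.norm_eq_abs, abs_of_nonneg hTs]
        nlinarith
      have n2 : ‖Complex.I * (k : ℂ)‖ = k := by
        rw [norm_mul, Complex.norm_I, one_mul, Complex.norm_real, Real.norm_eq_abs, abs_of_pos hk]
      have n3 : ‖(t : ℂ)‖ = t := by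
        rw [Complex.norm_real, Real.norm_eq_abs, abs_of_pos ht0]
      refine norm_add₄_le.trans ?_
      rw [norm_mul, norm_mul, norm_mul (Complex.I * (k : ℂ)), norm_mul (t : ℂ), n2, n3]
      calc _ ≤ C₀ * q + T * (B * q) + T * (k * (C₀ * q)) + t * (C₁ * q) := by gcongr
        _ = E * q := by rw [hE]; ring
    refine h1.trans ?_
    rw [integral_const_mul]
    exact mul_le_mul_of_nonneg_left (integral_angles_sin_mul_rpow_le hT0.le) hEnn
  have hE2 : E * (6 * Real.pi ^ 2 / (1 + T ^ 2))
      ≤ (C₀ + B + k * C₀ + C₁ / c) * (6 * Real.pi ^ 2) / T := by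
    have h1 : E ≤ T * (C₀ + B + k * C₀ + C₁ / c) := by
      have : E = C₀ + T * (B + k * C₀ + C₁ / c) := by rw [hE, htT]; ring
      rw [this]
      nlinarith
    calc _ ≤ T * (C₀ + B + k * C₀ + C₁ / c) * (6 * Real.pi ^ 2 / T ^ 2) := by
          gcongr
          linarith
      _ = _ := by field_simp
  have hki := integrableOn_kirIntegrand (b := planeFrame) (c := c) h₀ h₁ (x, t)
  have hsplit : ∫ z in angles, kirIntegrand planeFrame c f₀ f₁ (x, t) z
      = (∫ z in angles, (kirIntegrand planeFrame c f₀ f₁ (x, t) z - N z))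
        + ∫ z in angles, N z := by
    rw [integral_sub hki hNi, sub_add_cancel]
  have hpi : (4 * Real.pi)⁻¹ ≤ 1 := by
    have := Real.pi_gt_three
    exact inv_le_one_of_one_le₀ (by linarith)
  rw [kir, norm_smul, Real.norm_eq_abs, abs_of_nonneg (by positivity)]
  refine (mul_le_of_le_one_left (norm_nonneg _) hpi).trans ?_
  rw [hsplit]
  calc _ ≤ (C₀ + B + k * C₀ + C₁ / c) * (6 * Real.pi ^ 2) / T
        + (D * C₀ + k * (D * C₀) + D * C₁ / c) / T :=
        (norm_add_le _ _).trans (add_le_add (hdiff.trans hE2) hNle)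
    _ = _ := by rw [hT]; field_simp

end WaveDecay
end

noncomputable section

namespace WaveDecay

open Set MeasureTheory Filter Topology
open scoped Manifold EuclideanSpace ContDiff

/-! ### Functions of the angle in the plane -/

/-- Functions of class `C^n` off the origin that are homogeneous of degree zero. -/
structure IsAngular (n : WithTop ℕ∞) (W : Sp 2 → ℂ) : Prop where
  contDiffOn : ContDiffOn ℝ n W {0}ᶜ
  map_smul : ∀ s : ℝ, 0 < s → ∀ y, y ≠ 0 → W (s • y) = W y

/-- The extension of a function on the circle to a function that is homogeneous of degree zero. -/
def angularExt (Y : USphere 2 → ℂ) (y : Sp 2) : ℂ :=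
  if h : y = 0 then 0 else Y ⟨‖y‖⁻¹ • y, by
    rw [mem_sphere_zero_iff_norm, norm_smul, norm_inv, norm_norm,
      inv_mul_cancel₀ (norm_ne_zero_iff.2 h)]⟩

theorem angularExt_smul (Y : USphere 2 → ℂ) {s : ℝ} (hs : 0 < s) {y : Sp 2} (hy : y ≠ 0) :
    angularExt Y (s • y) = angularExt Y y := by
  have h : s • y ≠ 0 := smul_ne_zero hs.ne' hy
  rw [angularExt, angularExt, dif_neg h, dif_neg hy]
  congr 2
  rw [norm_smul, Real.norm_eq_abs, abs_of_pos hs, mul_inv, smul_smul]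
  congr 1
  field_simp

/-- Off the origin the extension is Y composed with the smooth retraction y ↦ y/|y| onto the circle,
which transfers differentiability on the manifold to the punctured plane. -/
theorem isAngular_angularExt {n : WithTop ℕ∞} {Y : USphere 2 → ℂ} (hY : ContMDiff (𝓡 1) 𝓘(ℝ, ℂ) n Y) :
    IsAngular n (angularExt Y) where
  map_smul s hs y hy := angularExt_smul Y hs hy
  contDiffOn := by
    let U : TopologicalSpace.Opens (Sp 2) := ⟨{0}ᶜ, isOpen_compl_singleton⟩
    have hmem : ∀ u : U, ‖(u : Sp 2)‖⁻¹ • (u : Sp 2) ∈ Metric.sphere (0 : Sp 2) 1 := fun u => by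
      have h : (u : Sp 2) ≠ 0 := u.2
      rw [mem_sphere_zero_iff_norm, norm_smul, norm_inv, norm_norm,
        inv_mul_cancel₀ (norm_ne_zero_iff.2 h)]
    have hN : ContMDiff 𝓘(ℝ, Sp 2) 𝓘(ℝ, Sp 2) n (fun u : U => ‖(u : Sp 2)‖⁻¹ • (u : Sp 2)) := by
      intro u
      have h : (u : Sp 2) ≠ 0 := u.2
      refine (contMDiffAt_subtype_iff (U := U) (f := fun y : Sp 2 => ‖y‖⁻¹ • y)).2 ?_
      exact (((contDiffAt_norm ℝ h).inv (norm_ne_zero_iff.2 h)).smul contDiffAt_id).contMDiffAt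
    have hN' := ContMDiff.codRestrict_sphere (n := 1) hN hmem
    have hc := hY.comp hN'
    intro y hy
    have h1 := hc ⟨y, hy⟩
    have h2 : (Y ∘ codRestrict (fun u : U => ‖(u : Sp 2)‖⁻¹ • (u : Sp 2)) _ hmem)
        = fun u : U => angularExt Y u := by
      funext u
      have h : (u : Sp 2) ≠ 0 := u.2
      rw [angularExt, dif_neg h]
      rfl
    rw [h2] at h1
    exact ((contMDiffAt_subtype_iff (U := U) (f := angularExt Y)).1 h1).contDiffAt.contDiffWithinAt

namespace IsAngular

variable {n : WithTop ℕ∞} {W : Sp 2 → ℂ}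

theorem contDiffAt (hW : IsAngular n W) {y : Sp 2} (hy : y ≠ 0) : ContDiffAt ℝ n W y :=
  hW.contDiffOn.contDiffAt (isOpen_compl_singleton.mem_nhds hy)

theorem hasFDerivAt (hW : IsAngular n W) (hn : 1 ≤ n) {y : Sp 2} (hy : y ≠ 0) :
    HasFDerivAt W (fderiv ℝ W y) y :=
  ((hW.contDiffAt hy).differentiableAt (by positivity)).hasFDerivAt

theorem contDiffAt_fderiv (hW : IsAngular (n + 1) W) {y : Sp 2} (hy : y ≠ 0) :
    ContDiffAt ℝ n (fderiv ℝ W) y :=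
  (hW.contDiffAt hy).fderiv_right le_rfl

theorem fderiv_smul (hW : IsAngular n W) {s : ℝ} (hs : 0 < s) {y : Sp 2} (hy : y ≠ 0) :
    fderiv ℝ W (s • y) = s⁻¹ • fderiv ℝ W y := by
  have h : (fun z => W (s • z)) =ᶠ[𝓝 y] W := by
    filter_upwards [isOpen_compl_singleton.mem_nhds hy] with z hz
    exact hW.map_smul s hs z hz
  have h1 := h.fderiv_eq (𝕜 := ℝ)
  rw [_root_.fderiv_comp_smul (f := W) s] at h1
  rw [← h1, smul_smul, inv_mul_cancel₀ hs.ne', one_smul]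

theorem fderiv_fderiv_smul (hW : IsAngular n W) {s : ℝ} (hs : 0 < s) {y : Sp 2} (hy : y ≠ 0) :
    fderiv ℝ (fderiv ℝ W) (s • y) = (s ^ 2)⁻¹ • fderiv ℝ (fderiv ℝ W) y := by
  have h : (fun z => fderiv ℝ W (s • z)) =ᶠ[𝓝 y] s⁻¹ • fderiv ℝ W := by
    filter_upwards [isOpen_compl_singleton.mem_nhds hy] with z hz
    exact hW.fderiv_smul hs hz
  have h1 := h.fderiv_eq (𝕜 := ℝ)
  rw [_root_.fderiv_comp_smul (f := fderiv ℝ W) s,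
    congrFun (fderiv_const_smul_field (𝕜 := ℝ) (f := fderiv ℝ W) s⁻¹) y, Pi.smul_apply] at h1
  have h2 := congrArg (fun L => s⁻¹ • L) h1
  simp only [smul_smul, inv_mul_cancel₀ hs.ne', one_smul] at h2
  rw [h2]
  congr 1
  field_simp

/-- Euler's relation in degree zero: the function is constant along rays. -/
theorem fderiv_self (hW : IsAngular n W) (hn : 1 ≤ n) {y : Sp 2} (hy : y ≠ 0) :
    fderiv ℝ W y y = 0 := by
  have h1 : HasDerivAt (fun s : ℝ => W (s • y)) (fderiv ℝ W y y) 1 := by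
    have hl : HasDerivAt (fun s : ℝ => s • y) ((1 : ℝ) • y) 1 := (hasDerivAt_id (1 : ℝ)).smul_const y
    have hd := hW.hasFDerivAt hn hy
    rw [← one_smul ℝ y] at hd
    have := hd.comp_hasDerivAt (1 : ℝ) hl
    rw [one_smul] at this
    exact this
  have h2 : HasDerivAt (fun s : ℝ => W (s • y)) 0 1 := by
    refine (hasDerivAt_const (1 : ℝ) (W y)).congr_of_eventuallyEq ?_
    filter_upwards [lt_mem_nhds (zero_lt_one (α := ℝ))] with s hs
    exact hW.map_smul s hs y hy
  exact h1.unique h2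

theorem exists_norm_le (hW : IsAngular n W) : ∃ M : ℝ, 0 ≤ M ∧ ∀ y, y ≠ 0 → ‖W y‖ ≤ M := by
  obtain ⟨M, hM⟩ := (isCompact_sphere (0 : Sp 2) 1).exists_bound_of_continuousOn
    (f := W) fun y hy => by
      have h1 : ‖y‖ = 1 := by simpa using hy
      have h0 : y ≠ 0 := fun h => by simp [h] at h1
      exact (hW.contDiffAt h0).continuousAt.continuousWithinAt
  refine ⟨|M|, abs_nonneg M, fun y hy => ?_⟩
  have hn : 0 < ‖y‖ := norm_pos_iff.2 hy
  rw [← hW.map_smul ‖y‖⁻¹ (inv_pos.2 hn) y hy]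
  refine (hM _ ?_).trans (le_abs_self M)
  rw [mem_sphere_zero_iff_norm, norm_smul, norm_inv, norm_norm, inv_mul_cancel₀ hn.ne']

/-- The derivative is homogeneous of degree -1, so its maximum on the circle controls it everywhere.
-/
theorem exists_norm_fderiv_le (hW : IsAngular n W) (hn : 1 ≤ n) :
    ∃ M : ℝ, 0 ≤ M ∧ ∀ y, y ≠ 0 → ‖fderiv ℝ W y‖ ≤ M / ‖y‖ := by
  obtain ⟨M, hM⟩ := (isCompact_sphere (0 : Sp 2) 1).exists_bound_of_continuousOn
    (f := fderiv ℝ W) fun y hy => by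
      have h1 : ‖y‖ = 1 := by simpa using hy
      have h0 : y ≠ 0 := fun h => by simp [h] at h1
      exact (((hW.contDiffAt h0).of_le hn).fderiv_right (m := 0) (by simp)
        ).continuousAt.continuousWithinAt
  refine ⟨|M|, abs_nonneg M, fun y hy => ?_⟩
  have hn : 0 < ‖y‖ := norm_pos_iff.2 hy
  have h1 := hW.fderiv_smul (inv_pos.2 hn) hy
  have h2 := (hM (‖y‖⁻¹ • y) (by
    rw [mem_sphere_zero_iff_norm, norm_smul, norm_inv, norm_norm, inv_mul_cancel₀ hn.ne'])).trans
    (le_abs_self M)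
  rw [h1, inv_inv, norm_smul, norm_norm] at h2
  rwa [le_div_iff₀ hn, mul_comm]

theorem const_smul (hW : IsAngular n W) (a : ℂ) : IsAngular n (a • W) where
  contDiffOn := contDiffOn_const.smul hW.contDiffOn
  map_smul s hs y hy := by rw [Pi.smul_apply, Pi.smul_apply, hW.map_smul s hs y hy]

theorem add {W' : Sp 2 → ℂ} (hW : IsAngular n W) (hW' : IsAngular n W') : IsAngular n (W + W') where
  contDiffOn := hW.contDiffOn.add hW'.contDiffOn
  map_smul s hs y hy := by
    rw [Pi.add_apply, Pi.add_apply, hW.map_smul s hs y hy, hW'.map_smul s hs y hy]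

theorem of_le (hW : IsAngular n W) {m : WithTop ℕ∞} (h : m ≤ n) : IsAngular m W :=
  ⟨hW.contDiffOn.of_le h, hW.map_smul⟩

/-- The angular part of the Laplacian. -/
theorem norm_sq_smul_frameLap (b : Fin 3 → Sp 2) (hW : IsAngular (n + 2) W) :
    IsAngular n (fun y => (‖y‖ ^ 2) • frameLap b W y) where
  contDiffOn := fun y hy => by
    have hW' : IsAngular (n + 1 + 1) W := by rwa [add_assoc, one_add_one_eq_two]
    have h1 : ContDiffAt ℝ n (fderiv ℝ (fderiv ℝ W)) y :=
      (hW'.contDiffAt_fderiv hy).fderiv_right le_rfl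
    have h2 : ContDiffAt ℝ n (frameLap b W) y := by
      unfold frameLap
      exact ContDiffAt.sum fun i _ => (h1.clm_apply contDiffAt_const).clm_apply contDiffAt_const
    exact ((contDiff_norm_sq ℝ).contDiffAt.smul h2).contDiffWithinAt
  map_smul s hs y hy := by
    have : frameLap b W (s • y) = (s ^ 2)⁻¹ • frameLap b W y := by
      simp only [frameLap, hW.fderiv_fderiv_smul hs hy, smul_apply, Finset.smul_sum]
    rw [this, smul_smul, norm_smul, Real.norm_eq_abs, abs_of_pos hs]
    congr 1
    field_simp

end IsAngular

end WaveDecay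
end

noncomputable section

namespace WaveDecay

open Set MeasureTheory Filter Topology
open scoped Manifold EuclideanSpace ContDiff

/-! ### Outgoing waves in the plane -/

/-- The radial function `e^{ik|y|} |y|^{-β}`. -/
def radFactor (k β : ℝ) (y : Sp 2) : ℂ :=
  Complex.exp (Complex.I * (k * ‖y‖ : ℝ)) * ((‖y‖ ^ (-β) : ℝ) : ℂ)

/-- The gradient of `radFactor k β` at `y` is `radSlope k β y` times `y`. -/
def radSlope (k β : ℝ) (y : Sp 2) : ℂ :=
  Complex.I * (k : ℂ) * radFactor k (β + 1) y - (β : ℂ) * radFactor k (β + 2) y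

theorem norm_radFactor (k β : ℝ) (y : Sp 2) : ‖radFactor k β y‖ = ‖y‖ ^ (-β) := by
  rw [radFactor, norm_mul, mul_comm Complex.I, Complex.norm_exp_ofReal_mul_I, one_mul,
    Complex.norm_real, Real.norm_eq_abs, abs_of_nonneg (by positivity)]

/-- Dividing by |y|^m raises the exponent by m, so all derivatives of radial factors stay in this
family and are compared by powers of |y|. -/
theorem radFactor_add_mul {k β : ℝ} {y : Sp 2} (hy : y ≠ 0) (m : ℕ) :
    radFactor k (β + m) y * (‖y‖ : ℂ) ^ m = radFactor k β y := by
  have hn : 0 < ‖y‖ := norm_pos_iff.2 hy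
  rw [radFactor, radFactor, mul_assoc, neg_add, Real.rpow_add hn, Real.rpow_neg hn.le (m : ℝ),
    Real.rpow_natCast]
  push_cast
  have : (‖y‖ : ℂ) ≠ 0 := by exact_mod_cast hn.ne'
  field_simp

/-- The real inner product with `y`, as a complex-valued linear form. -/
def innerForm (y : Sp 2) : Sp 2 →L[ℝ] ℂ := Complex.ofRealCLM.comp (innerSL ℝ y)

theorem innerForm_apply (y v : Sp 2) : innerForm y v = ((inner ℝ y v : ℝ) : ℂ) := rfl

theorem norm_innerForm_le (y : Sp 2) : ‖innerForm y‖ ≤ ‖y‖ :=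
  ContinuousLinearMap.opNorm_le_bound _ (norm_nonneg y) fun v => by
    rw [innerForm_apply, Complex.norm_real]
    exact norm_inner_le_norm y v

theorem hasFDerivAt_radFactor (k β : ℝ) {y : Sp 2} (hy : y ≠ 0) :
    HasFDerivAt (radFactor k β) (radSlope k β y • innerForm y) y := by
  have hn : 0 < ‖y‖ := norm_pos_iff.2 hy
  have h1 : HasFDerivAt (fun z : Sp 2 => ‖z‖) (‖y‖⁻¹ • innerSL ℝ y) y := by
    have h := (hasStrictFDerivAt_norm_sq y).hasFDerivAt.sqrt (by positivity)
    simp only [Real.sqrt_sq (norm_nonneg _)] at h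
    refine h.congr_fderiv ?_
    ext v
    simp
    field_simp
  have h2 : HasDerivAt (fun r : ℝ => Complex.exp (Complex.I * (k * r : ℝ)) * ((r ^ (-β) : ℝ) : ℂ))
      (Complex.I * k * (Complex.exp (Complex.I * (k * ‖y‖ : ℝ))) * ((‖y‖ ^ (-β) : ℝ) : ℂ)
        + Complex.exp (Complex.I * (k * ‖y‖ : ℝ)) * ((-β * ‖y‖ ^ (-β - 1) : ℝ) : ℂ)) ‖y‖ := by
    have h3 : HasDerivAt (fun r : ℝ => ((k * r : ℝ) : ℂ)) ((k * 1 : ℝ) : ℂ) ‖y‖ :=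
      ((hasDerivAt_id ‖y‖).const_mul k).ofReal_comp
    have h4 := (h3.const_mul Complex.I).cexp
    have h5 := (Real.hasDerivAt_rpow_const (p := -β) (Or.inl hn.ne')).ofReal_comp
    refine (h4.mul h5).congr_deriv ?_
    push_cast
    ring
  refine (h2.hasFDerivAt.comp y h1).congr_fderiv ?_
  ext v
  have e1 : ‖y‖ ^ (-β - 1) = ‖y‖ ^ (-β) * ‖y‖⁻¹ := by
    rw [sub_eq_add_neg, Real.rpow_add hn, Real.rpow_neg_one]
  have e2 := radFactor_add_mul (k := k) (β := β) hy 1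
  have e3 := radFactor_add_mul (k := k) (β := β) hy 2
  have hn' : (‖y‖ : ℂ) ≠ 0 := by exact_mod_cast hn.ne'
  rw [pow_one, ← eq_div_iff hn', Nat.cast_one] at e2
  rw [← eq_div_iff (pow_ne_zero 2 hn'), Nat.cast_ofNat] at e3
  simp only [ContinuousLinearMap.comp_apply, smul_apply, radSlope, innerForm_apply, e2, e3, e1,
    ContinuousLinearMap.toSpanSingleton_apply, innerSL_apply_apply, Complex.real_smul, smul_eq_mul]
  rw [radFactor]
  push_cast
  field_simp
  ring

theorem contDiffAt_radFactor (k β : ℝ) {n : WithTop ℕ∞} {y : Sp 2} (hy : y ≠ 0) :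
    ContDiffAt ℝ n (radFactor k β) y := by
  have hn : ‖y‖ ≠ 0 := norm_ne_zero_iff.2 hy
  have h1 : ContDiffAt ℝ n (fun z : Sp 2 => ‖z‖) y := contDiffAt_norm ℝ hy
  have h2 : ContDiffAt ℝ n (fun z : Sp 2 => ((k * ‖z‖ : ℝ) : ℂ)) y :=
    Complex.ofRealCLM.contDiff.contDiffAt.comp y (contDiffAt_const.mul h1)
  have h3 : ContDiffAt ℝ n (fun z : Sp 2 => ((‖z‖ ^ (-β) : ℝ) : ℂ)) y :=
    Complex.ofRealCLM.contDiff.contDiffAt.comp y (h1.rpow_const_of_ne hn)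
  exact (contDiffAt_const.mul h2).cexp.mul h3

theorem hasFDerivAt_radSlope (k β : ℝ) {y : Sp 2} (hy : y ≠ 0) :
    HasFDerivAt (radSlope k β) ((Complex.I * (k : ℂ) * radSlope k (β + 1) y
      - (β : ℂ) * radSlope k (β + 2) y) • innerForm y) y := by
  refine (((hasFDerivAt_radFactor k (β + 1) hy).const_mul (Complex.I * (k : ℂ))).sub
    ((hasFDerivAt_radFactor k (β + 2) hy).const_mul (β : ℂ))).congr_fderiv ?_
  ext v
  simp only [sub_apply, smul_apply, smul_eq_mul]
  ring

section

variable {W : Sp 2 → ℂ} (k β : ℝ)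

theorem IsAngular.hasFDerivAt_radFactor_mul {n : WithTop ℕ∞} (hW : IsAngular n W) (hn : 1 ≤ n)
    {y : Sp 2} (hy : y ≠ 0) : HasFDerivAt (fun z => radFactor k β z * W z)
      (radFactor k β y • fderiv ℝ W y + W y • (radSlope k β y • innerForm y)) y :=
  (hasFDerivAt_radFactor k β hy).mul (hW.hasFDerivAt hn hy)

theorem IsAngular.contDiffAt_radFactor_mul {n : WithTop ℕ∞} (hW : IsAngular n W) {y : Sp 2}
    (hy : y ≠ 0) : ContDiffAt ℝ n (fun z => radFactor k β z * W z) y :=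
  (contDiffAt_radFactor k β hy).mul (hW.contDiffAt hy)

theorem IsAngular.fderiv_fderiv_radFactor_mul (hW : IsAngular 2 W) {y : Sp 2} (hy : y ≠ 0)
    (v : Sp 2) : fderiv ℝ (fderiv ℝ (fun z => radFactor k β z * W z)) y v v
      = radFactor k β y * fderiv ℝ (fderiv ℝ W) y v v
        + 2 * radSlope k β y * ((inner ℝ y v : ℝ) * fderiv ℝ W y v)
        + W y * ((Complex.I * (k : ℂ) * radSlope k (β + 1) y
      - (β : ℂ) * radSlope k (β + 2) y) * (inner ℝ y v : ℝ) ^ 2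
          + radSlope k β y * (inner ℝ v v : ℝ)) := by
  set F := fun z => radFactor k β z * W z with hF
  have h1 : DifferentiableAt ℝ (fderiv ℝ F) y :=
    ((hW.contDiffAt_radFactor_mul k β hy).fderiv_right (m := 1) (by norm_num)).differentiableAt
      one_ne_zero
  have h2 : DifferentiableAt ℝ (fderiv ℝ W) y :=
    (((hW.contDiffAt hy).fderiv_right (m := 1) (by norm_num))).differentiableAt one_ne_zero
  have h3 : (fun z => fderiv ℝ F z v) =ᶠ[𝓝 y] fun z => radFactor k β z * fderiv ℝ W z v
      + W z * (radSlope k β z * innerForm v z) := by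
    filter_upwards [isOpen_compl_singleton.mem_nhds hy] with z hz
    rw [(hW.hasFDerivAt_radFactor_mul k β (by norm_num) hz).fderiv]
    simp only [add_apply, smul_apply, smul_eq_mul, innerForm_apply, real_inner_comm]
  have h4 : HasFDerivAt (fun z => fderiv ℝ W z v) ((fderiv ℝ (fderiv ℝ W) y).flip v) y := by
    refine (h2.hasFDerivAt.clm_apply (hasFDerivAt_const v y)).congr_fderiv ?_
    ext w
    simp
  have h5 := ((hasFDerivAt_radFactor k β hy).mul h4).add ((hW.hasFDerivAt (by norm_num) hy).mul
    ((hasFDerivAt_radSlope k β hy).mul (innerForm v).hasFDerivAt))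
  have h6 := congrArg (fun L => L v) (h5.congr_of_eventuallyEq h3).fderiv
  rw [fderiv_clm_apply h1 (differentiableAt_const v)] at h6
  simp only [fderiv_fun_const, Pi.zero_apply, ContinuousLinearMap.comp_zero, zero_add, add_apply,
    ContinuousLinearMap.flip_apply, smul_apply, smul_eq_mul, innerForm_apply, Pi.mul_apply] at h6
  rw [h6, real_inner_comm y v]
  ring

/-- The polar Laplacian acting on a product: the cross term vanishes because W has no radial
derivative. The remainder after -k² times the function gains one power of 1/|y|. -/
theorem IsAngular.frameLap_radFactor_mul (hW : IsAngular 2 W) {y : Sp 2} (hy : y ≠ 0) :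
    frameLap planeFrame (fun z => radFactor k β z * W z) y
      = -(k : ℂ) ^ 2 * (radFactor k β y * W y)
        + radFactor k (β + 1) y * (Complex.I * k * (1 - 2 * β) * W y)
        + radFactor k (β + 2) y * ((β : ℂ) ^ 2 * W y + (‖y‖ ^ 2) • frameLap planeFrame W y) := by
  have e0 : (inner ℝ y (EuclideanSpace.single 0 1) : ℝ) = y 0 := by
    rw [EuclideanSpace.inner_single_right]
    simp
  have e1 : (inner ℝ y (EuclideanSpace.single 1 1) : ℝ) = y 1 := by
    rw [EuclideanSpace.inner_single_right]
    simp
  have hnorm : ‖y‖ ^ 2 = y 0 ^ 2 + y 1 ^ 2 := by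
    rw [EuclideanSpace.norm_sq_eq]
    simp
  have hsum : y = y 0 • EuclideanSpace.single 0 (1 : ℝ) + y 1 • EuclideanSpace.single 1 1 := by
    ext i
    fin_cases i <;> simp
  -- Euler's relation in coordinates, which removes the cross term.
  have hE : (y 0 : ℂ) * fderiv ℝ W y (EuclideanSpace.single 0 1)
      + (y 1 : ℂ) * fderiv ℝ W y (EuclideanSpace.single 1 1) = 0 := by
    have h := hW.fderiv_self (by norm_num) hy
    nth_rewrite 2 [hsum] at h
    rw [map_add, (fderiv ℝ W y).map_smul, (fderiv ℝ W y).map_smul] at h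
    simpa only [Complex.real_smul] using h
  have hnC : ((‖y‖ : ℂ)) ^ 2 = (y 0 : ℂ) ^ 2 + (y 1 : ℂ) ^ 2 := by exact_mod_cast hnorm
  have f1 := radFactor_add_mul (k := k) (β := β) hy 2
  have f2 := radFactor_add_mul (k := k) (β := β + 1) hy 2
  have f3 := radFactor_add_mul (k := k) (β := β + 2) hy 2
  rw [Nat.cast_ofNat] at f1 f2 f3
  have g1 : β + 1 + 1 = β + 2 := by ring
  have g2 : β + 2 + 1 = β + 1 + 2 := by ring
  simp only [frameLap, Fin.sum_univ_three, hW.fderiv_fderiv_radFactor_mul k β hy]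
  simp only [planeFrame, Matrix.cons_val_zero, Matrix.cons_val_one, Matrix.cons_val, map_zero, e0,
    e1, inner_zero_right, radSlope, g1, g2, EuclideanSpace.inner_single_left, Complex.real_smul]
  simp only [PiLp.single_apply]
  simp only [if_true, Fin.isValue, map_one, Complex.ofReal_add,
    Complex.ofReal_one, Complex.ofReal_ofNat, Complex.ofReal_zero, mul_one, mul_zero, add_zero]
  set A := fderiv ℝ (fderiv ℝ W) y (EuclideanSpace.single 0 1) (EuclideanSpace.single 0 1)
  set B := fderiv ℝ (fderiv ℝ W) y (EuclideanSpace.single 1 1) (EuclideanSpace.single 1 1)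
  push_cast
  linear_combination (2 * (Complex.I * k * radFactor k (β + 1) y - β * radFactor k (β + 2) y)) * hE
    - W y * (Complex.I * k * (Complex.I * k * radFactor k (β + 2) y
      - (β + 1) * radFactor k (β + 1 + 2) y) - β * (Complex.I * k * radFactor k (β + 1 + 2) y
      - (β + 2) * radFactor k (β + 2 + 2) y)) * hnC
    + ((Complex.I * k) ^ 2 * W y - (A + B)) * f1
    - (Complex.I * k * (2 * β + 1) * W y) * f2 + W y * β * (β + 2) * f3
    + k ^ 2 * W y * radFactor k β y * Complex.I_sq

end

end WaveDecay
end

noncomputable section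

namespace WaveDecay

open Set MeasureTheory Filter Topology
open scoped Manifold EuclideanSpace ContDiff

/-! ### The far field of outgoing waves -/

theorem norm_radFactor_add_mul (k β : ℝ) {y : Sp 2} (hy : y ≠ 0) (m : ℕ) :
    ‖radFactor k (β + m) y‖ * ‖y‖ ^ m = ‖y‖ ^ (-β) := by
  rw [← norm_radFactor k β y, ← radFactor_add_mul (k := k) (β := β) hy m, norm_mul, norm_pow,
    Complex.norm_real, norm_norm]

theorem norm_radFactor_add_le (k β : ℝ) {ρ : ℝ} (hρ : 0 < ρ) {y : Sp 2} (hy : ρ < ‖y‖) (m : ℕ) :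
    ‖radFactor k (β + m) y‖ ≤ ρ⁻¹ ^ m * ‖y‖ ^ (-β) := by
  have hn : 0 < ‖y‖ := hρ.trans hy
  rw [← norm_radFactor_add_mul k β (norm_pos_iff.1 hn) m, inv_pow, ← div_eq_inv_mul,
    le_div_iff₀ (by positivity)]
  gcongr

theorem norm_radSlope_mul_le (k β : ℝ) {ρ : ℝ} (hρ : 0 < ρ) {y : Sp 2} (hy : ρ < ‖y‖) :
    ‖radSlope k β y‖ * ‖y‖ ≤ (|k| + |β| * ρ⁻¹) * ‖y‖ ^ (-β) := by
  have hn : 0 < ‖y‖ := hρ.trans hy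
  have h1 := norm_radFactor_add_mul k β (norm_pos_iff.1 hn) 1
  have h2 := norm_radFactor_add_mul k β (norm_pos_iff.1 hn) 2
  have h3 := norm_radFactor_add_le k β hρ hy 1
  rw [Nat.cast_one, pow_one] at *
  rw [Nat.cast_ofNat] at h2
  have h4 : ‖radFactor k (β + 2) y‖ * ‖y‖ = ‖radFactor k (β + 1) y‖ := by
    have : ‖radFactor k (β + 2) y‖ * ‖y‖ * ‖y‖ = ‖radFactor k (β + 1) y‖ * ‖y‖ := by
      rw [h1, ← h2]; ring
    exact mul_right_cancel₀ hn.ne' this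
  calc ‖radSlope k β y‖ * ‖y‖ ≤ (|k| * ‖radFactor k (β + 1) y‖ + |β| * ‖radFactor k (β + 2) y‖) * ‖y‖ := by
        refine mul_le_mul_of_nonneg_right ((norm_sub_le _ _).trans_eq ?_) hn.le
        rw [norm_mul, norm_mul, norm_mul, Complex.norm_I, one_mul, Complex.norm_real,
          Complex.norm_real, Real.norm_eq_abs, Real.norm_eq_abs]
    _ = |k| * (‖radFactor k (β + 1) y‖ * ‖y‖) + |β| * (‖radFactor k (β + 2) y‖ * ‖y‖) := by ring
    _ ≤ |k| * ‖y‖ ^ (-β) + |β| * (ρ⁻¹ * ‖y‖ ^ (-β)) := by rw [h1, h4]; gcongr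
    _ = _ := by ring

/-- Derivatives produce either the same power of |y| or lower ones, and outside the ball of radius ρ
each extra 1/|y| is at most ρ^{-1}. -/
theorem IsAngular.exists_norm_radFactor_mul_le {W : Sp 2 → ℂ} (hW : IsAngular 2 W) (k β : ℝ) {ρ : ℝ}
    (hρ : 0 < ρ) : ∃ M : ℝ, 0 ≤ M ∧ ∀ y, ρ < ‖y‖ →
      ‖radFactor k β y * W y‖ ≤ M * ‖y‖ ^ (-β) ∧
      ‖fderiv ℝ (fun z => radFactor k β z * W z) y‖ ≤ M * ‖y‖ ^ (-β) ∧
      ‖frameLap planeFrame (fun z => radFactor k β z * W z) y‖ ≤ M * ‖y‖ ^ (-β) := by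
  obtain ⟨M₀, hM₀, h₀⟩ := hW.exists_norm_le
  obtain ⟨M₁, hM₁, h₁⟩ := hW.exists_norm_fderiv_le (by norm_num)
  obtain ⟨M₂, hM₂, h₂⟩ :=
    (IsAngular.norm_sq_smul_frameLap (n := 0) planeFrame (by simpa using hW)).exists_norm_le
  refine ⟨M₀ + (ρ⁻¹ * M₁ + M₀ * (|k| + |β| * ρ⁻¹)) + (k ^ 2 * M₀ + ρ⁻¹ * (|k| * |1 - 2 * β| * M₀)
    + ρ⁻¹ ^ 2 * (β ^ 2 * M₀ + M₂)), by positivity, fun y hy => ?_⟩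
  have hn : 0 < ‖y‖ := hρ.trans hy
  have hy0 : y ≠ 0 := norm_pos_iff.1 hn
  set p := ‖y‖ ^ (-β) with hp
  have hp0 : 0 ≤ p := by positivity
  have b₀ : ‖radFactor k β y * W y‖ ≤ M₀ * p := by
    rw [norm_mul, norm_radFactor, mul_comm]
    exact mul_le_mul_of_nonneg_right (h₀ y hy0) hp0
  have b₁ : ‖fderiv ℝ (fun z => radFactor k β z * W z) y‖
      ≤ (ρ⁻¹ * M₁ + M₀ * (|k| + |β| * ρ⁻¹)) * p := by
    rw [(hW.hasFDerivAt_radFactor_mul k β (by norm_num) hy0).fderiv]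
    have c1 : ‖radFactor k β y • fderiv ℝ W y‖ ≤ p * (ρ⁻¹ * M₁) := by
      rw [norm_smul, norm_radFactor]
      refine mul_le_mul_of_nonneg_left ((h₁ y hy0).trans ?_) hp0
      rw [div_eq_inv_mul]
      gcongr
    have c2 : ‖W y • (radSlope k β y • innerForm y)‖ ≤ M₀ * ((|k| + |β| * ρ⁻¹) * p) := by
      rw [norm_smul, norm_smul]
      refine mul_le_mul (h₀ y hy0) (le_trans ?_ (norm_radSlope_mul_le k β hρ hy)) (by positivity) hM₀
      gcongr
      exact norm_innerForm_le y
    refine (norm_add_le _ _).trans ((add_le_add c1 c2).trans_eq ?_)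
    ring
  have b₂ : ‖frameLap planeFrame (fun z => radFactor k β z * W z) y‖
      ≤ (k ^ 2 * M₀ + ρ⁻¹ * (|k| * |1 - 2 * β| * M₀) + ρ⁻¹ ^ 2 * (β ^ 2 * M₀ + M₂)) * p := by
    rw [hW.frameLap_radFactor_mul k β hy0]
    have d1 := norm_radFactor_add_le k β hρ hy 1
    have d2 := norm_radFactor_add_le k β hρ hy 2
    rw [Nat.cast_one, pow_one] at d1
    rw [Nat.cast_ofNat] at d2
    have c1 : ‖-(k : ℂ) ^ 2 * (radFactor k β y * W y)‖ ≤ k ^ 2 * (M₀ * p) := by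
      rw [norm_mul, norm_neg, norm_pow, Complex.norm_real, Real.norm_eq_abs, sq_abs]
      gcongr
    have c2 : ‖radFactor k (β + 1) y * (Complex.I * k * (1 - 2 * β) * W y)‖
        ≤ ρ⁻¹ * p * (|k| * |1 - 2 * β| * M₀) := by
      have : ‖(1 - 2 * β : ℂ)‖ = |1 - 2 * β| := by
        rw [← Real.norm_eq_abs, ← Complex.norm_real]
        push_cast
        rfl
      rw [norm_mul, norm_mul, norm_mul, norm_mul, Complex.norm_I, one_mul, Complex.norm_real, this,
        Real.norm_eq_abs]
      gcongr
      exact h₀ y hy0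
    have c3 : ‖radFactor k (β + 2) y * ((β : ℂ) ^ 2 * W y + (‖y‖ ^ 2) • frameLap planeFrame W y)‖
        ≤ ρ⁻¹ ^ 2 * p * (β ^ 2 * M₀ + M₂) := by
      rw [norm_mul]
      refine mul_le_mul d2 ((norm_add_le _ _).trans (add_le_add ?_ (h₂ y hy0))) (norm_nonneg _)
        (by positivity)
      rw [norm_mul, norm_pow, Complex.norm_real, Real.norm_eq_abs, sq_abs]
      gcongr
      exact h₀ y hy0
    refine norm_add₃_le.trans ((add_le_add_three c1 c2 c3).trans_eq ?_)
    ring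
  have e₀ : 0 ≤ M₀ * p := by positivity
  have e₁ : 0 ≤ (ρ⁻¹ * M₁ + M₀ * (|k| + |β| * ρ⁻¹)) * p := by positivity
  have e₂ : 0 ≤ (k ^ 2 * M₀ + ρ⁻¹ * (|k| * |1 - 2 * β| * M₀) + ρ⁻¹ ^ 2 * (β ^ 2 * M₀ + M₂)) * p := by
    positivity
  rw [add_mul, add_mul _ _ p]
  refine ⟨?_, ?_, ?_⟩ <;> linarith

theorem exists_norm_le_one_add_rpow {G : Type*} [NormedAddCommGroup G] {f : Sp 2 → G}
    (hf : Continuous f) {M ρ : ℝ} (h : ∀ y, ρ < ‖y‖ → ‖f y‖ ≤ M * ‖y‖ ^ (-(5 / 2) : ℝ)) :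
    ∃ M' : ℝ, ∀ y, ‖f y‖ ≤ M' * (1 + ‖y‖) ^ (-(5 / 2) : ℝ) := by
  set σ := max ρ 1 with hσ
  have hσ0 : 0 < 1 + σ := by
    have := le_max_right ρ 1
    linarith
  obtain ⟨B, hB⟩ := (isCompact_closedBall (0 : Sp 2) σ).exists_bound_of_continuousOn hf.continuousOn
  refine ⟨|B| * (1 + σ) ^ (5 / 2 : ℝ) + |M| * 2 ^ (5 / 2 : ℝ), fun y => ?_⟩
  rw [add_mul]
  have p0 : 0 ≤ (1 + ‖y‖) ^ (-(5 / 2) : ℝ) := by positivity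
  rcases le_or_gt ‖y‖ σ with hy | hy
  · have h1 : ‖f y‖ ≤ |B| := (hB y (by simpa using hy)).trans (le_abs_self B)
    have h2 : (1 + σ) ^ (-(5 / 2) : ℝ) ≤ (1 + ‖y‖) ^ (-(5 / 2) : ℝ) :=
      Real.rpow_le_rpow_of_nonpos (by positivity) (by linarith) (by norm_num)
    have h3 : (1 + σ) ^ (5 / 2 : ℝ) * (1 + σ) ^ (-(5 / 2) : ℝ) = 1 := by
      rw [← Real.rpow_add hσ0]
      norm_num
    have h4 : |B| ≤ |B| * (1 + σ) ^ (5 / 2 : ℝ) * (1 + ‖y‖) ^ (-(5 / 2) : ℝ) := by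
      calc |B| = |B| * ((1 + σ) ^ (5 / 2 : ℝ) * (1 + σ) ^ (-(5 / 2) : ℝ)) := by rw [h3, mul_one]
        _ ≤ |B| * ((1 + σ) ^ (5 / 2 : ℝ) * (1 + ‖y‖) ^ (-(5 / 2) : ℝ)) := by gcongr
        _ = _ := by ring
    have : 0 ≤ |M| * 2 ^ (5 / 2 : ℝ) * (1 + ‖y‖) ^ (-(5 / 2) : ℝ) := by positivity
    linarith
  · have hy1 : 1 < ‖y‖ := (le_max_right ρ 1).trans_lt hy
    have h1 : ‖f y‖ ≤ |M| * ‖y‖ ^ (-(5 / 2) : ℝ) :=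
      (h y ((le_max_left ρ 1).trans_lt hy)).trans (by gcongr; exact le_abs_self M)
    have h2 : ‖y‖ ^ (-(5 / 2) : ℝ) ≤ 2 ^ (5 / 2 : ℝ) * (1 + ‖y‖) ^ (-(5 / 2) : ℝ) := by
      have : (2 * ‖y‖) ^ (-(5 / 2) : ℝ) ≤ (1 + ‖y‖) ^ (-(5 / 2) : ℝ) :=
        Real.rpow_le_rpow_of_nonpos (by positivity) (by linarith) (by norm_num)
      calc ‖y‖ ^ (-(5 / 2) : ℝ) = 2 ^ (5 / 2 : ℝ) * (2 * ‖y‖) ^ (-(5 / 2) : ℝ) := by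
            rw [Real.mul_rpow two_pos.le (norm_nonneg y), ← mul_assoc, ← Real.rpow_add two_pos]
            norm_num
        _ ≤ _ := by gcongr
    have h3 : |M| * ‖y‖ ^ (-(5 / 2) : ℝ) ≤ |M| * 2 ^ (5 / 2 : ℝ) * (1 + ‖y‖) ^ (-(5 / 2) : ℝ) := by
      rw [mul_assoc]
      gcongr
    have : 0 ≤ |B| * (1 + σ) ^ (5 / 2 : ℝ) * (1 + ‖y‖) ^ (-(5 / 2) : ℝ) := by positivity
    linarith

end WaveDecay
end

noncomputable section

namespace WaveDecay

open Set MeasureTheory Filter Topology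
open scoped Manifold EuclideanSpace ContDiff

/-! ### Far field and radiation condition seen from a displaced centre -/

theorem norm_exp_I_mul_sub_le (s t : ℝ) :
    ‖Complex.exp (Complex.I * s) - Complex.exp (Complex.I * t)‖ ≤ |s - t| := by
  have h : Complex.exp (Complex.I * s) - Complex.exp (Complex.I * t)
      = Complex.exp (Complex.I * t) * (Complex.exp (Complex.I * ((s - t : ℝ) : ℂ)) - 1) := by
    rw [mul_sub, ← Complex.exp_add, mul_one]
    push_cast
    ring_nf
  rw [h, norm_mul, mul_comm Complex.I (t : ℂ), Complex.norm_exp_ofReal_mul_I, one_mul]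
  exact Real.norm_exp_I_mul_ofReal_sub_one_le

theorem abs_rpow_sub_rpow_le {c s t : ℝ} (hc : 0 < c) (hs : c ≤ s) (ht : c ≤ t) :
    |s ^ (-(3 / 2) : ℝ) - t ^ (-(3 / 2) : ℝ)| ≤ 3 / 2 * c ^ (-(5 / 2) : ℝ) * |s - t| := by
  have h := Convex.norm_image_sub_le_of_norm_hasDerivWithin_le (s := Ici c)
    (f := fun x : ℝ => x ^ (-(3 / 2) : ℝ)) (f' := fun x => -(3 / 2) * x ^ (-(3 / 2) - 1 : ℝ))
    (C := 3 / 2 * c ^ (-(5 / 2) : ℝ)) (x := t) (y := s)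
    (fun x hx => (Real.hasDerivAt_rpow_const (Or.inl (hc.trans_le hx).ne')).hasDerivWithinAt)
    (fun x hx => by
      have hx0 : 0 < x := hc.trans_le hx
      rw [norm_mul, norm_neg, Real.norm_eq_abs, Real.norm_eq_abs, abs_of_pos (by norm_num),
        abs_of_nonneg (by positivity), show (-(3 / 2) - 1 : ℝ) = -(5 / 2) by norm_num]
      exact mul_le_mul_of_nonneg_left (Real.rpow_le_rpow_of_nonpos hc hx (by norm_num))
        (by norm_num)) (convex_Ici c) ht hs
  simpa only [Real.norm_eq_abs] using h

/-- The phase of a plane wave approximates that of a circular wave. -/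
theorem abs_norm_add_smul_sub_le {x e : Sp 2} {r c : ℝ} (he : ‖e‖ = 1) (hc : 0 < c) (hx : ‖x‖ ≤ r)
    (h : c ≤ ‖x + r • e‖) : |‖x + r • e‖ - (r + inner ℝ x e)| ≤ ‖x‖ ^ 2 / c := by
  set n := ‖x + r • e‖ with hn
  set i : ℝ := inner ℝ x e with hi
  have hin : |i| ≤ ‖x‖ := by simpa [he] using abs_real_inner_le_norm x e
  have hr : 0 ≤ r := (norm_nonneg x).trans hx
  have h1 : n ^ 2 = ‖x‖ ^ 2 + 2 * (r * i) + r ^ 2 := by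
    rw [hn, norm_add_sq_real, real_inner_smul_right, norm_smul, he, mul_one, Real.norm_eq_abs, sq_abs]
  -- A difference of squares: |x + re|² - (r + ⟨x, e⟩)² is the squared length of the component of x
  -- orthogonal to e.
  have h2 : (n - (r + i)) * (n + (r + i)) = ‖x‖ ^ 2 - i ^ 2 := by
    linear_combination h1
  have h3 : 0 ≤ r + i := by linarith [neg_abs_le i]
  have h4 : i ^ 2 ≤ ‖x‖ ^ 2 := sq_le_sq' (by linarith [neg_abs_le i]) ((le_abs_self i).trans hin)
  have h5 : 0 < n + (r + i) := by linarith
  have h6 : 0 ≤ n - (r + i) := by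
    by_contra hneg
    push Not at hneg
    nlinarith
  rw [abs_of_nonneg h6, le_div_iff₀ hc]
  nlinarith [sq_nonneg i]

/-- Mean value inequality on the segment from y to x + y, which stays at distance at least c from
the origin: far away, a bounded displacement changes the angle by O(1/c). -/
theorem IsAngular.norm_sub_le {W : Sp 2 → ℂ} {n : WithTop ℕ∞} (hW : IsAngular n W) (hn : 1 ≤ n)
    {M : ℝ} (hM : 0 ≤ M) (h : ∀ y, y ≠ 0 → ‖fderiv ℝ W y‖ ≤ M / ‖y‖) {c : ℝ} (hc : 0 < c)
    {x y : Sp 2} (hxy : ‖x‖ + c ≤ ‖y‖) : ‖W (x + y) - W y‖ ≤ M / c * ‖x‖ := by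
  have hseg : ∀ z ∈ segment ℝ y (x + y), c ≤ ‖z‖ := fun z hz => by
    have h1 : ‖z - y‖ ≤ ‖x‖ := by
      have := norm_sub_le_of_mem_segment hz
      simpa using this
    have h2 : ‖y‖ ≤ ‖z‖ + ‖z - y‖ := by
      have := _root_.norm_sub_le z (z - y)
      rwa [sub_sub_cancel] at this
    linarith
  have := Convex.norm_image_sub_le_of_norm_hasFDerivWithin_le (𝕜 := ℝ) (f := W)
    (f' := fderiv ℝ W) (s := segment ℝ y (x + y)) (C := M / c) (x := y) (y := x + y)
    (fun z hz => (hW.hasFDerivAt hn (norm_pos_iff.1 (hc.trans_le (hseg z hz)))).hasFDerivWithinAt)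
    (fun z hz => (h z (norm_pos_iff.1 (hc.trans_le (hseg z hz)))).trans (by
      gcongr
      exact hseg z hz)) (convex_segment _ _) (left_mem_segment ℝ _ _) (right_mem_segment ℝ _ _)
  simpa using this

/-- A wave with an angular amplitude outside a ball has a far field. -/
theorem hasFarField_of_eq {k ρ : ℝ} {g W : Sp 2 → ℂ} {n : WithTop ℕ∞} (hg : Continuous g)
    (hW : IsAngular n W) (hn : 1 ≤ n) (hρ : 0 < ρ)
    (h : ∀ y, ρ < ‖y‖ → g y = radFactor k (3 / 2) y * W y) : HasFarField k g := by
  obtain ⟨M₀, hM₀, h₀⟩ := hW.exists_norm_le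
  obtain ⟨M₁, hM₁, h₁⟩ := hW.exists_norm_fderiv_le hn
  -- Since |x + re| = r + ⟨x, e⟩ + O(1/r), moving the centre to x multiplies the amplitude by a
  -- plane wave.
  refine ⟨fun x e => Complex.exp (Complex.I * (k * inner ℝ x e : ℝ)) * W e, fun x => ?_, fun R => ?_⟩
  · refine ContinuousOn.mul (by fun_prop) fun e he => ?_
    have he0 : e ≠ 0 := fun h => by simp [h] at he
    exact (hW.contDiffAt he0).continuousAt.continuousWithinAt
  set S := |R| with hS
  have hS0 : 0 ≤ S := abs_nonneg R
  -- Beyond this radius (1 + r)/2 ≤ r - S ≤ |x + re| and ρ < |x + re|; up to it, compactness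
  -- suffices.
  set r₀ := 2 * S + 1 + ρ with hr₀
  have hr₀0 : 0 < 1 + r₀ := by positivity
  obtain ⟨B, hB⟩ := (isCompact_closedBall (0 : Sp 2) (S + r₀)).exists_bound_of_continuousOn
    hg.continuousOn
  set D := |k| * S ^ 2 * M₀ + 3 / 2 * (1 + S) * M₀ + M₁ * S with hD
  have hD0 : 0 ≤ D := by positivity
  refine ⟨M₀ + (|B| + M₀) * (1 + r₀) ^ (5 / 2 : ℝ) + D * 2 ^ (5 / 2 : ℝ), by positivity,
    fun x r e hx hr he => ?_⟩
  have hxS : ‖x‖ ≤ S := hx.trans (le_abs_self R)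
  have he0 : e ≠ 0 := fun h => by simp [h] at he
  have hα : ‖Complex.exp (Complex.I * (k * inner ℝ x e : ℝ)) * W e‖ ≤ M₀ := by
    rw [norm_mul, mul_comm Complex.I, Complex.norm_exp_ofReal_mul_I, one_mul]
    exact h₀ e he0
  have u₁ : 0 ≤ (|B| + M₀) * (1 + r₀) ^ (5 / 2 : ℝ) := by positivity
  have u₂ : 0 ≤ D * 2 ^ (5 / 2 : ℝ) := by positivity
  refine ⟨by linarith, ?_⟩
  set q := (1 + r) ^ (-(5 / 2) : ℝ) with hq
  have hq0 : 0 ≤ q := by positivity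
  rcases le_or_gt r r₀ with hrr | hrr
  · have b1 : ‖g (x + r • e)‖ ≤ |B| := by
      refine (hB _ ?_).trans (le_abs_self B)
      rw [mem_closedBall_zero_iff]
      refine (norm_add_le _ _).trans (add_le_add hxS ?_)
      rwa [norm_smul, he, mul_one, Real.norm_eq_abs, abs_of_nonneg hr]
    have b2 : ‖Complex.exp (Complex.I * (k * r : ℝ)) * (((1 + r) ^ (-(3 / 2) : ℝ) : ℝ) : ℂ)
        * (Complex.exp (Complex.I * (k * inner ℝ x e : ℝ)) * W e)‖ ≤ 1 * M₀ := by
      rw [norm_mul]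
      refine mul_le_mul ?_ hα (norm_nonneg _) zero_le_one
      rw [norm_mul, mul_comm Complex.I, Complex.norm_exp_ofReal_mul_I, one_mul, Complex.norm_real,
        Real.norm_eq_abs, abs_of_nonneg (by positivity)]
      exact Real.rpow_le_one_of_one_le_of_nonpos (by linarith) (by norm_num)
    have b3 : (1 : ℝ) ≤ (1 + r₀) ^ (5 / 2 : ℝ) * q := by
      calc (1 : ℝ) = (1 + r₀) ^ (5 / 2 : ℝ) * (1 + r₀) ^ (-(5 / 2) : ℝ) := by
            rw [← Real.rpow_add hr₀0]
            norm_num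
        _ ≤ _ := by
            refine mul_le_mul_of_nonneg_left ?_ (by positivity)
            exact Real.rpow_le_rpow_of_nonpos (by positivity) (by linarith) (by norm_num)
    have b4 : (|B| + M₀) * 1 ≤ (|B| + M₀) * ((1 + r₀) ^ (5 / 2 : ℝ) * q) :=
      mul_le_mul_of_nonneg_left b3 (by positivity)
    have b5 : 0 ≤ M₀ * q := by positivity
    have b6 : 0 ≤ D * 2 ^ (5 / 2 : ℝ) * q := by positivity
    refine (norm_sub_le _ _).trans ((add_le_add b1 b2).trans ?_)
    rw [add_mul, add_mul]
    linarith
  set c := (1 + r) / 2 with hc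
  have hc0 : 0 < c := by positivity
  set y := x + r • e with hy
  have hre : ‖r • e‖ = r := by rw [norm_smul, he, mul_one, Real.norm_eq_abs, abs_of_nonneg hr]
  have hny : r - S ≤ ‖y‖ := by
    have := norm_sub_le y x
    rw [hy, add_sub_cancel_left, hre] at this
    linarith
  have hyc : c ≤ ‖y‖ := by linarith
  have hyρ : ρ < ‖y‖ := by linarith
  have hy0 : y ≠ 0 := norm_pos_iff.1 (hρ.trans hyρ)
  have hcq : c ^ (-(5 / 2) : ℝ) = 2 ^ (5 / 2 : ℝ) * q := by
    rw [hc, Real.div_rpow (by positivity) two_pos.le, Real.rpow_neg two_pos.le, div_inv_eq_mul,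
      mul_comm]
  have hc1 : c ^ (-(3 / 2) : ℝ) * c⁻¹ = c ^ (-(5 / 2) : ℝ) := by
    rw [← Real.rpow_neg_one c, ← Real.rpow_add hc0]
    norm_num
  set m := r + inner ℝ x e with hm
  -- The three errors are those of phase, modulus and angular amplitude.
  have key : g y - Complex.exp (Complex.I * (k * r : ℝ)) * (((1 + r) ^ (-(3 / 2) : ℝ) : ℝ) : ℂ)
        * (Complex.exp (Complex.I * (k * inner ℝ x e : ℝ)) * W e)
      = (Complex.exp (Complex.I * (k * ‖y‖ : ℝ)) - Complex.exp (Complex.I * (k * m : ℝ)))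
          * ((‖y‖ ^ (-(3 / 2) : ℝ) : ℝ) : ℂ) * W y
        + Complex.exp (Complex.I * (k * m : ℝ))
          * ((‖y‖ ^ (-(3 / 2) : ℝ) - (1 + r) ^ (-(3 / 2) : ℝ) : ℝ) : ℂ) * W y
        + Complex.exp (Complex.I * (k * m : ℝ)) * (((1 + r) ^ (-(3 / 2) : ℝ) : ℝ) : ℂ)
          * (W (x + r • e) - W (r • e)) := by
    have hexp : Complex.exp (Complex.I * (k * m : ℝ)) = Complex.exp (Complex.I * (k * r : ℝ))
        * Complex.exp (Complex.I * (k * inner ℝ x e : ℝ)) := by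
      rw [← Complex.exp_add, hm]
      push_cast
      ring_nf
    rw [h y hyρ, hexp, hW.map_smul r (by linarith) e he0, ← hy, radFactor]
    push_cast
    ring
  have hrp : 0 ≤ ‖y‖ ^ (-(3 / 2) : ℝ) := by positivity
  have t1 : ‖(Complex.exp (Complex.I * (k * ‖y‖ : ℝ)) - Complex.exp (Complex.I * (k * m : ℝ)))
      * ((‖y‖ ^ (-(3 / 2) : ℝ) : ℝ) : ℂ) * W y‖ ≤ |k| * S ^ 2 * M₀ * c ^ (-(5 / 2) : ℝ) := by
    have a1 : ‖Complex.exp (Complex.I * (k * ‖y‖ : ℝ)) - Complex.exp (Complex.I * (k * m : ℝ))‖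
        ≤ |k| * (S ^ 2 / c) := by
      refine (norm_exp_I_mul_sub_le _ _).trans ?_
      rw [← mul_sub, abs_mul]
      refine mul_le_mul_of_nonneg_left ?_ (abs_nonneg k)
      refine (abs_norm_add_smul_sub_le he hc0 (by linarith) hyc).trans ?_
      gcongr
    have a2 : ‖y‖ ^ (-(3 / 2) : ℝ) ≤ c ^ (-(3 / 2) : ℝ) :=
      Real.rpow_le_rpow_of_nonpos hc0 hyc (by norm_num)
    rw [norm_mul, norm_mul, Complex.norm_real, Real.norm_eq_abs, abs_of_nonneg hrp]
    calc _ ≤ |k| * (S ^ 2 / c) * c ^ (-(3 / 2) : ℝ) * M₀ := by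
          gcongr
          exact h₀ y hy0
      _ = |k| * S ^ 2 * M₀ * (c ^ (-(3 / 2) : ℝ) * c⁻¹) := by ring
      _ = _ := by rw [hc1]
  have t2 : ‖Complex.exp (Complex.I * (k * m : ℝ))
      * ((‖y‖ ^ (-(3 / 2) : ℝ) - (1 + r) ^ (-(3 / 2) : ℝ) : ℝ) : ℂ) * W y‖
      ≤ 3 / 2 * (1 + S) * M₀ * c ^ (-(5 / 2) : ℝ) := by
    have a1 : |‖y‖ - (1 + r)| ≤ 1 + S := by
      have : ‖y‖ ≤ S + r := (norm_add_le _ _).trans (by rw [hre]; linarith)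
      rw [abs_le]
      constructor <;> linarith
    rw [norm_mul, norm_mul, mul_comm Complex.I, Complex.norm_exp_ofReal_mul_I, one_mul,
      Complex.norm_real, Real.norm_eq_abs]
    calc _ ≤ 3 / 2 * c ^ (-(5 / 2) : ℝ) * (1 + S) * M₀ := by
          refine mul_le_mul ((abs_rpow_sub_rpow_le hc0 hyc (by linarith)).trans ?_) (h₀ y hy0)
            (norm_nonneg _) (by positivity)
          gcongr
      _ = _ := by ring
  have t3 : ‖Complex.exp (Complex.I * (k * m : ℝ)) * (((1 + r) ^ (-(3 / 2) : ℝ) : ℝ) : ℂ)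
      * (W (x + r • e) - W (r • e))‖ ≤ M₁ * S * c ^ (-(5 / 2) : ℝ) := by
    have a1 : ‖W (x + r • e) - W (r • e)‖ ≤ M₁ / c * ‖x‖ :=
      hW.norm_sub_le hn hM₁ h₁ hc0 (by rw [hre]; linarith)
    have a2 : (1 + r) ^ (-(3 / 2) : ℝ) ≤ c ^ (-(3 / 2) : ℝ) :=
      Real.rpow_le_rpow_of_nonpos hc0 (by linarith) (by norm_num)
    rw [norm_mul, norm_mul, mul_comm Complex.I, Complex.norm_exp_ofReal_mul_I, one_mul,
      Complex.norm_real, Real.norm_eq_abs, abs_of_nonneg (by positivity)]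
    calc _ ≤ c ^ (-(3 / 2) : ℝ) * (M₁ / c * S) := by
          gcongr
          exact a1.trans (by gcongr)
      _ = M₁ * S * (c ^ (-(3 / 2) : ℝ) * c⁻¹) := by ring
      _ = _ := by rw [hc1]
  rw [key]
  have hsum : |k| * S ^ 2 * M₀ * c ^ (-(5 / 2) : ℝ) + 3 / 2 * (1 + S) * M₀ * c ^ (-(5 / 2) : ℝ)
      + M₁ * S * c ^ (-(5 / 2) : ℝ) = D * 2 ^ (5 / 2 : ℝ) * q := by
    rw [hcq, hD]
    ring
  refine norm_add₃_le.trans ((add_le_add_three t1 t2 t3).trans ?_)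
  have b5 : 0 ≤ M₀ * q := by positivity
  have b6 : 0 ≤ (|B| + M₀) * (1 + r₀) ^ (5 / 2 : ℝ) * q := by positivity
  rw [hsum, add_mul, add_mul]
  linarith

/-- A wave with an angular amplitude outside a ball radiates. -/
theorem radiates_of_eq {k ρ : ℝ} {g W : Sp 2 → ℂ} {n : WithTop ℕ∞} (hg : ContDiff ℝ 1 g)
    (hW : IsAngular n W) (hn : 1 ≤ n) (hρ : 0 < ρ)
    (h : ∀ y, ρ < ‖y‖ → g y = radFactor k (3 / 2) y * W y) : Radiates k g := fun R => by
  obtain ⟨M₀, hM₀, h₀⟩ := hW.exists_norm_le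
  obtain ⟨M₁, hM₁, h₁⟩ := hW.exists_norm_fderiv_le hn
  set S := |R| with hS
  have hS0 : 0 ≤ S := abs_nonneg R
  set D := M₁ + (|k| * (2 * S) + 3 / 2) * M₀ with hD
  set G : Sp 2 × Sp 2 → ℂ := fun w => fderiv ℝ g w.1 w.2 - Complex.I * (k : ℂ) * g w.1 with hG
  have hGc : Continuous G := by
    have h1 := hg.continuous_fderiv one_ne_zero
    have h2 := hg.continuous
    rw [hG]
    fun_prop
  set r₀ := 2 * S + 1 + ρ with hr₀
  have hr₀0 : 0 < 1 + r₀ := by positivity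
  obtain ⟨B, hB⟩ := ((isCompact_closedBall (0 : Sp 2) (S + r₀)).prod
    (isCompact_sphere (0 : Sp 2) 1)).exists_bound_of_continuousOn hGc.continuousOn
  have hD0 : 0 ≤ D := by positivity
  refine ⟨|B| * (1 + r₀) ^ (5 / 2 : ℝ) + D * 2 ^ (5 / 2 : ℝ), by positivity,
    fun x r e hx hr he => ?_⟩
  have hxS : ‖x‖ ≤ S := hx.trans (le_abs_self R)
  have hre : ‖r • e‖ = r := by rw [norm_smul, he, mul_one, Real.norm_eq_abs, abs_of_nonneg hr]
  set q := (1 + r) ^ (-(5 / 2) : ℝ) with hq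
  have hq0 : 0 ≤ q := by positivity
  set y := x + r • e with hy
  rw [add_mul]
  rcases le_or_gt r r₀ with hrr | hrr
  · have b1 : ‖G (y, e)‖ ≤ |B| := by
      refine (hB _ ⟨?_, by simpa using he⟩).trans (le_abs_self B)
      rw [mem_closedBall_zero_iff]
      refine (norm_add_le _ _).trans (add_le_add hxS ?_)
      rwa [hre]
    have b3 : (1 : ℝ) ≤ (1 + r₀) ^ (5 / 2 : ℝ) * q := by
      calc (1 : ℝ) = (1 + r₀) ^ (5 / 2 : ℝ) * (1 + r₀) ^ (-(5 / 2) : ℝ) := by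
            rw [← Real.rpow_add hr₀0]
            norm_num
        _ ≤ _ := by
            refine mul_le_mul_of_nonneg_left ?_ (by positivity)
            exact Real.rpow_le_rpow_of_nonpos (by positivity) (by linarith) (by norm_num)
    have b4 : |B| * 1 ≤ |B| * ((1 + r₀) ^ (5 / 2 : ℝ) * q) :=
      mul_le_mul_of_nonneg_left b3 (by positivity)
    have b6 : 0 ≤ D * 2 ^ (5 / 2 : ℝ) * q := by positivity
    have b7 : ‖fderiv ℝ g y e - Complex.I * (k : ℂ) * g y‖ ≤ |B| := b1
    linarith
  have hny : r - S ≤ ‖y‖ := by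
    have := norm_sub_le y x
    rw [hy, add_sub_cancel_left, hre] at this
    linarith
  have hyρ : ρ < ‖y‖ := by linarith
  have hy1 : 0 < ‖y‖ := hρ.trans hyρ
  have hy0 : y ≠ 0 := norm_pos_iff.1 hy1
  have hopen : IsOpen {z : Sp 2 | ρ < ‖z‖} := isOpen_lt continuous_const continuous_norm
  have hev : g =ᶠ[𝓝 y] fun z => radFactor k (3 / 2) z * W z := by
    filter_upwards [hopen.mem_nhds hyρ] with z hz
    exact h z hz
  set i : ℝ := inner ℝ y e with hi
  have hi1 : |i - ‖y‖| ≤ 2 * S := by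
    have e1 : i = inner ℝ x e + r := by
      rw [hi, hy, inner_add_left, real_inner_smul_left, real_inner_self_eq_norm_sq, he]
      ring
    have e2 : |inner ℝ x e| ≤ ‖x‖ := by simpa [he] using abs_real_inner_le_norm x e
    have e3 : ‖y‖ ≤ S + r := (norm_add_le _ _).trans (by rw [hre]; linarith)
    rw [abs_le] at e2 ⊢
    constructor <;> linarith
  have hi2 : |i| ≤ ‖y‖ := by simpa [he] using abs_real_inner_le_norm y e
  have f1 := radFactor_add_mul (k := k) (β := 3 / 2) hy0 1
  rw [Nat.cast_one, pow_one] at f1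
  -- The derivative is taken along e rather than along y/|y|. The discrepancy ⟨y, e⟩ - |y| is at
  -- most 2S in modulus and is multiplied by a factor of order |y|^{-5/2}.
  have key : fderiv ℝ g y e - Complex.I * (k : ℂ) * g y
      = radFactor k (3 / 2) y * fderiv ℝ W y e
        + Complex.I * k * radFactor k (3 / 2 + 1) y * ((i - ‖y‖ : ℝ) : ℂ) * W y
        - ((3 / 2 : ℝ) : ℂ) * radFactor k (3 / 2 + 2) y * (i : ℂ) * W y := by
    rw [hev.fderiv_eq, h y hyρ, (hW.hasFDerivAt_radFactor_mul k (3 / 2) hn hy0).fderiv]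
    simp only [add_apply, smul_apply, smul_eq_mul, innerForm_apply, radSlope]
    rw [← hi]
    push_cast
    linear_combination (Complex.I * k * W y) * f1
  set p := ‖y‖ ^ (-(5 / 2) : ℝ) with hp
  have hp0 : 0 ≤ p := by positivity
  have p1 : ‖radFactor k (3 / 2 + 1) y‖ = p := by
    rw [norm_radFactor]
    norm_num [hp]
  have p0 : ‖radFactor k (3 / 2) y‖ = p * ‖y‖ := by
    rw [← f1, norm_mul, p1, Complex.norm_real, norm_norm]
  have p2 : ‖radFactor k (3 / 2 + 2) y‖ * ‖y‖ = p := by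
    rw [norm_radFactor]
    nth_rewrite 2 [← Real.rpow_one ‖y‖]
    rw [← Real.rpow_add hy1]
    norm_num [hp]
  have t1 : ‖radFactor k (3 / 2) y * fderiv ℝ W y e‖ ≤ M₁ * p := by
    rw [norm_mul, p0]
    have : ‖fderiv ℝ W y e‖ ≤ M₁ / ‖y‖ := by
      refine ((fderiv ℝ W y).le_opNorm e).trans ?_
      rw [he, mul_one]
      exact h₁ y hy0
    calc _ ≤ p * ‖y‖ * (M₁ / ‖y‖) := by gcongr
      _ = _ := by field_simp
  have t2 : ‖Complex.I * k * radFactor k (3 / 2 + 1) y * ((i - ‖y‖ : ℝ) : ℂ) * W y‖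
      ≤ |k| * p * (2 * S) * M₀ := by
    rw [norm_mul, norm_mul, norm_mul, norm_mul, Complex.norm_I, one_mul, Complex.norm_real,
      Complex.norm_real, p1, Real.norm_eq_abs, Real.norm_eq_abs]
    gcongr
    exact h₀ y hy0
  have t3 : ‖((3 / 2 : ℝ) : ℂ) * radFactor k (3 / 2 + 2) y * (i : ℂ) * W y‖ ≤ 3 / 2 * p * M₀ := by
    rw [norm_mul, norm_mul, norm_mul, Complex.norm_real, Complex.norm_real, Real.norm_eq_abs,
      Real.norm_eq_abs, abs_of_pos (by norm_num : (0 : ℝ) < 3 / 2), mul_assoc (3 / 2 : ℝ)]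
    have : ‖radFactor k (3 / 2 + 2) y‖ * |i| ≤ p := by
      rw [← p2]
      gcongr
    gcongr
    exact h₀ y hy0
  have hpq : p ≤ 2 ^ (5 / 2 : ℝ) * q := by
    have e1 : ((1 + r) / 2) ^ (-(5 / 2) : ℝ) = 2 ^ (5 / 2 : ℝ) * q := by
      rw [Real.div_rpow (by positivity) two_pos.le, Real.rpow_neg two_pos.le, div_inv_eq_mul,
        mul_comm]
    rw [← e1]
    exact Real.rpow_le_rpow_of_nonpos (by positivity) (by linarith) (by norm_num)
  have hpD : D * p ≤ D * (2 ^ (5 / 2 : ℝ) * q) := mul_le_mul_of_nonneg_left hpq hD0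
  have b6 : 0 ≤ |B| * (1 + r₀) ^ (5 / 2 : ℝ) * q := by positivity
  have b7 : ‖fderiv ℝ g y e - Complex.I * (k : ℂ) * g y‖ ≤ D * p := by
    rw [key]
    refine (norm_sub_le _ _).trans ((add_le_add ((norm_add_le _ _).trans (add_le_add t1 t2)) t3
      ).trans_eq ?_)
    rw [hD]
    ring
  linarith

end WaveDecay
end

noncomputable section

namespace WaveDecay

open Set MeasureTheory Filter Topology
open scoped Manifold EuclideanSpace

/-! ### The decay theorem in the plane -/

theorem frameLap_congr {d : ℕ} (b : Fin 3 → Sp d) {f g : Sp d → ℂ} {y : Sp d} (h : f =ᶠ[𝓝 y] g) :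
    frameLap b f y = frameLap b g y := by
  unfold frameLap
  rw [(h.fderiv (𝕜 := ℝ)).fderiv_eq]

theorem frameLap_add_of_contDiffAt {d : ℕ} (b : Fin 3 → Sp d) {f g : Sp d → ℂ} {y : Sp d}
    (hf : ContDiffAt ℝ 2 f y) (hg : ContDiffAt ℝ 2 g y) :
    frameLap b (f + g) y = frameLap b f y + frameLap b g y := by
  have h : fderiv ℝ (f + g) =ᶠ[𝓝 y] fderiv ℝ f + fderiv ℝ g := by
    filter_upwards [hf.eventually (by norm_num), hg.eventually (by norm_num)] with z h1 h2
    exact fderiv_add (h1.differentiableAt two_ne_zero) (h2.differentiableAt two_ne_zero)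
  have h1 := (hf.fderiv_right (m := 1) (by norm_num)).differentiableAt one_ne_zero
  have h2 := (hg.fderiv_right (m := 1) (by norm_num)).differentiableAt one_ne_zero
  simp only [frameLap, h.fderiv_eq, fderiv_add h1 h2, add_apply, Finset.sum_add_distrib]

/-- The asymptotic conditions on initial data in the plane under which solutions decay. -/
structure IsOutgoing (k : ℝ) (v : Sp 2 → ℂ) : Prop where
  contDiff : ContDiff ℝ 5 v
  hasFarField : HasFarField k v
  radiates : Radiates k v
  hasFarField_lap : HasFarField k (frameLap planeFrame v)
  radiates_lap : Radiates k (frameLap planeFrame v)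
  hasFarField_lap_lap : HasFarField k (frameLap planeFrame (frameLap planeFrame v))

theorem IsOutgoing.contDiff_lap {k : ℝ} {v : Sp 2 → ℂ} (hv : IsOutgoing k v) :
    ContDiff ℝ 3 (frameLap planeFrame v) := contDiff_frameLap planeFrame hv.contDiff (by norm_num)

theorem IsOutgoing.add {k : ℝ} {v w : Sp 2 → ℂ} (hv : IsOutgoing k v) (hw : IsOutgoing k w) :
    IsOutgoing k (v + w) := by
  have e1 : frameLap planeFrame (v + w) = frameLap planeFrame v + frameLap planeFrame w :=
    frameLap_add _ (hv.contDiff.of_le (by norm_num)) (hw.contDiff.of_le (by norm_num))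
  have e2 : frameLap planeFrame (frameLap planeFrame v + frameLap planeFrame w)
      = frameLap planeFrame (frameLap planeFrame v) + frameLap planeFrame (frameLap planeFrame w) :=
    frameLap_add _ (hv.contDiff_lap.of_le (by norm_num)) (hw.contDiff_lap.of_le (by norm_num))
  exact
    { contDiff := hv.contDiff.add hw.contDiff
      hasFarField := hv.hasFarField.add hw.hasFarField
      radiates := hv.radiates.add hw.radiates (hv.contDiff.differentiable (by norm_num))
        (hw.contDiff.differentiable (by norm_num))
      hasFarField_lap := e1 ▸ hv.hasFarField_lap.add hw.hasFarField_lap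
      radiates_lap := e1 ▸ hv.radiates_lap.add hw.radiates_lap
        (hv.contDiff_lap.differentiable (by norm_num)) (hw.contDiff_lap.differentiable (by norm_num))
      hasFarField_lap_lap := by
        rw [e1, e2]
        exact hv.hasFarField_lap_lap.add hw.hasFarField_lap_lap }

theorem radiates_of_norm_le_rpow {k M ρ : ℝ} {f : Sp 2 → ℂ} (hf : ContDiff ℝ 1 f)
    (h : ∀ y, ρ < ‖y‖ → ‖f y‖ ≤ M * ‖y‖ ^ (-(5 / 2) : ℝ))
    (h' : ∀ y, ρ < ‖y‖ → ‖fderiv ℝ f y‖ ≤ M * ‖y‖ ^ (-(5 / 2) : ℝ)) : Radiates k f := by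
  obtain ⟨A, hA⟩ := exists_norm_le_one_add_rpow hf.continuous h
  obtain ⟨B, hB⟩ := exists_norm_le_one_add_rpow (hf.continuous_fderiv one_ne_zero) h'
  refine Radiates.of_norm_le (M := max A B) (fun y => (hA y).trans ?_) fun y => (hB y).trans ?_
  · gcongr
    exact le_max_left A B
  · gcongr
    exact le_max_right A B

theorem hasFarField_of_norm_le_rpow {k M ρ : ℝ} {f : Sp 2 → ℂ} (hf : Continuous f)
    (h : ∀ y, ρ < ‖y‖ → ‖f y‖ ≤ M * ‖y‖ ^ (-(5 / 2) : ℝ)) : HasFarField k f := by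
  obtain ⟨A, hA⟩ := exists_norm_le_one_add_rpow hf h
  exact HasFarField.of_norm_le hA

/-- Every function involved is itself of the order of the error terms, so the far fields are zero.
-/
theorem isOutgoing_of_biharmonicSize {k C : ℝ} {V : Sp 2 → ℂ} (hV : ContDiff ℝ 5 V)
    (h : ∀ x : Sp 2, ‖x‖ ^ (5 / 2 : ℝ) * biharmonicSize V x ≤ C) : IsOutgoing k V := by
  have hL : ContDiff ℝ 3 (frameLap planeFrame V) := contDiff_frameLap _ hV (by norm_num)
  have hLL : ContDiff ℝ 1 (frameLap planeFrame (frameLap planeFrame V)) :=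
    contDiff_frameLap _ hL (by norm_num)
  have key : ∀ y : Sp 2, 1 < ‖y‖ →
      (2 + 1) * (biharmonicSize V y + biharmonicSize V y) ≤ 6 * C * ‖y‖ ^ (-(5 / 2) : ℝ) :=
    fun y hy => by
      have hy0 : 0 < ‖y‖ := by linarith
      have h1 := h y
      rw [Real.rpow_neg hy0.le, ← div_eq_mul_inv, le_div_iff₀ (by positivity)]
      linarith
  have B := fun y : Sp 2 => fun hy : 1 < ‖y‖ => And.intro (le_biharmonicSize V V y).1 (key y hy)
  have hlap : ∀ f : Sp 2 → ℂ, lap f = frameLap planeFrame f := isFrame_two.lap_eq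
  simp only [hlap, Nat.cast_ofNat] at B
  exact
    { contDiff := hV
      hasFarField := hasFarField_of_norm_le_rpow hV.continuous fun y hy =>
        (B y hy).1.1.trans (B y hy).2
      radiates := radiates_of_norm_le_rpow (hV.of_le (by norm_num))
        (fun y hy => (B y hy).1.1.trans (B y hy).2) fun y hy => (B y hy).1.2.1.trans (B y hy).2
      hasFarField_lap := hasFarField_of_norm_le_rpow hL.continuous fun y hy =>
        (B y hy).1.2.2.1.trans (B y hy).2
      radiates_lap := radiates_of_norm_le_rpow (hL.of_le (by norm_num))
        (fun y hy => (B y hy).1.2.2.1.trans (B y hy).2)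
        fun y hy => (B y hy).1.2.2.2.1.trans (B y hy).2
      hasFarField_lap_lap := hasFarField_of_norm_le_rpow hLL.continuous fun y hy =>
        (B y hy).1.2.2.2.2.trans (B y hy).2 }

/-- The function f = Δg + k²g is O(|y|^{-5/2}) together with its gradient and its Laplacian. Hence
Δg = f - k²g and Δ²g = Δf - k²Δg inherit their far fields from g. -/
theorem isOutgoing_of_eq {k ρ : ℝ} {g W : Sp 2 → ℂ} (hg : ContDiff ℝ 5 g) (hW : IsAngular 5 W)
    (hρ : 0 < ρ) (h : ∀ y, ρ < ‖y‖ → g y = radFactor k (3 / 2) y * W y) : IsOutgoing k g := by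
  have hW2 : IsAngular 2 W := hW.of_le (by norm_num)
  set L := frameLap planeFrame g with hLdef
  have hL : ContDiff ℝ 3 L := contDiff_frameLap (n := 3) planeFrame hg (by norm_num)
  set W₁ : Sp 2 → ℂ := (Complex.I * k * (1 - 2 * ((3 / 2 : ℝ) : ℂ))) • W with hW₁
  set W₂ : Sp 2 → ℂ := (((3 / 2 : ℝ) : ℂ) ^ 2) • W + fun y => (‖y‖ ^ 2) • frameLap planeFrame W y
    with hW₂
  -- The first amplitude keeps the regularity of W; the second, `W₂`, contains the angular
  -- Laplacian, which costs two derivatives. Two more are needed for the Laplacian of f, and W of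
  -- class C⁵ suffices.
  have hA₁ : IsAngular 2 W₁ := hW2.const_smul _
  have hA₂ : IsAngular 2 W₂ := (hW2.const_smul _).add
    (IsAngular.norm_sq_smul_frameLap (n := 2) planeFrame (hW.of_le (m := 2 + 2) (by norm_num)))
  set f := L + ((k : ℂ) ^ 2) • g with hf
  have hfC : ContDiff ℝ 3 f :=
    hL.add (ContDiff.const_smul ((k : ℂ) ^ 2) (hg.of_le (m := 3) (by norm_num)))
  have hopen : IsOpen {z : Sp 2 | ρ < ‖z‖} := isOpen_lt continuous_const continuous_norm
  set F₁ : Sp 2 → ℂ := fun z => radFactor k (5 / 2) z * W₁ z with hF₁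
  set F₂ : Sp 2 → ℂ := fun z => radFactor k (7 / 2) z * W₂ z with hF₂
  have hfeq : ∀ y, ρ < ‖y‖ → f =ᶠ[𝓝 y] F₁ + F₂ := fun y hy => by
    filter_upwards [hopen.mem_nhds hy] with z hz
    have hz0 : z ≠ 0 := norm_pos_iff.1 (hρ.trans hz)
    have hev : g =ᶠ[𝓝 z] fun z => radFactor k (3 / 2) z * W z := by
      filter_upwards [hopen.mem_nhds hz] with z hz
      exact h z hz
    have e1 : L z = _ := (frameLap_congr planeFrame hev).trans
      (hW2.frameLap_radFactor_mul k (3 / 2) hz0)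
    have a1 : (3 / 2 + 1 : ℝ) = 5 / 2 := by norm_num
    have a2 : (3 / 2 + 2 : ℝ) = 7 / 2 := by norm_num
    rw [a1, a2] at e1
    simp only [hf, hF₁, hF₂, hW₁, hW₂, Pi.add_apply, Pi.smul_apply, smul_eq_mul, e1, h z hz]
    ring
  obtain ⟨M₁, hM₁, B₁⟩ := hA₁.exists_norm_radFactor_mul_le k (5 / 2) hρ
  obtain ⟨M₂, hM₂, B₂⟩ := hA₂.exists_norm_radFactor_mul_le k (7 / 2) hρ
  have hpow : ∀ y : Sp 2, ρ < ‖y‖ → M₁ * ‖y‖ ^ (-(5 / 2) : ℝ) + M₂ * ‖y‖ ^ (-(7 / 2) : ℝ)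
      ≤ (M₁ + M₂ * ρ⁻¹) * ‖y‖ ^ (-(5 / 2) : ℝ) := fun y hy => by
    have hy0 : 0 < ‖y‖ := hρ.trans hy
    have e : ‖y‖ ^ (-(7 / 2) : ℝ) = ‖y‖⁻¹ * ‖y‖ ^ (-(5 / 2) : ℝ) := by
      rw [← Real.rpow_neg_one, ← Real.rpow_add hy0]
      norm_num
    rw [e, add_mul, mul_assoc M₂]
    gcongr
  have hc₁ : ∀ y, ρ < ‖y‖ → ContDiffAt ℝ 2 F₁ y := fun y hy =>
    hA₁.contDiffAt_radFactor_mul k (5 / 2) (norm_pos_iff.1 (hρ.trans hy))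
  have hc₂ : ∀ y, ρ < ‖y‖ → ContDiffAt ℝ 2 F₂ y := fun y hy =>
    hA₂.contDiffAt_radFactor_mul k (7 / 2) (norm_pos_iff.1 (hρ.trans hy))
  have b₀ : ∀ y, ρ < ‖y‖ → ‖f y‖ ≤ (M₁ + M₂ * ρ⁻¹) * ‖y‖ ^ (-(5 / 2) : ℝ) := fun y hy => by
    rw [(hfeq y hy).self_of_nhds]
    exact (norm_add_le _ _).trans ((add_le_add (B₁ y hy).1 (B₂ y hy).1).trans (hpow y hy))
  have b₁ : ∀ y, ρ < ‖y‖ → ‖fderiv ℝ f y‖ ≤ (M₁ + M₂ * ρ⁻¹) * ‖y‖ ^ (-(5 / 2) : ℝ) := fun y hy => by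
    rw [(hfeq y hy).fderiv_eq, fderiv_add ((hc₁ y hy).differentiableAt two_ne_zero)
      ((hc₂ y hy).differentiableAt two_ne_zero)]
    exact (norm_add_le _ _).trans ((add_le_add (B₁ y hy).2.1 (B₂ y hy).2.1).trans (hpow y hy))
  have b₂ : ∀ y, ρ < ‖y‖ → ‖frameLap planeFrame f y‖ ≤ (M₁ + M₂ * ρ⁻¹) * ‖y‖ ^ (-(5 / 2) : ℝ) :=
    fun y hy => by
      rw [frameLap_congr _ (hfeq y hy), frameLap_add_of_contDiffAt _ (hc₁ y hy) (hc₂ y hy)]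
      exact (norm_add_le _ _).trans ((add_le_add (B₁ y hy).2.2 (B₂ y hy).2.2).trans (hpow y hy))
  have hfF : HasFarField k f := hasFarField_of_norm_le_rpow hfC.continuous b₀
  have hfR : Radiates k f := radiates_of_norm_le_rpow (hfC.of_le (by norm_num)) b₀ b₁
  have hfLF : HasFarField k (frameLap planeFrame f) := hasFarField_of_norm_le_rpow
    (contDiff_frameLap (n := 1) planeFrame hfC (by norm_num)).continuous b₂
  have hgF : HasFarField k g := hasFarField_of_eq hg.continuous hW2 (by norm_num) hρ h
  have hgR : Radiates k g := radiates_of_eq (hg.of_le (by norm_num)) hW2 (by norm_num) hρ h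
  have hLeq : L = f + (-(k : ℂ) ^ 2) • g := by
    rw [hf, neg_smul, add_neg_cancel_right]
  have hgd : Differentiable ℝ g := hg.differentiable (by norm_num)
  have hLF : HasFarField k L := hLeq ▸ hfF.add (hgF.smul _)
  have hLL : frameLap planeFrame L = frameLap planeFrame f + (-(k : ℂ) ^ 2) • L := by
    have hg2 : ContDiff ℝ 2 g := hg.of_le (by norm_num)
    have e := frameLap_add planeFrame (f := f) (g := (-(k : ℂ) ^ 2) • g) (hfC.of_le (by norm_num))
      (ContDiff.const_smul (-(k : ℂ) ^ 2) hg2)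
    rw [← hLeq, frameLap_const_smul planeFrame hg2] at e
    exact e
  exact
    { contDiff := hg
      hasFarField := hgF
      radiates := hgR
      hasFarField_lap := hLF
      radiates_lap := by
        rw [← hLdef, hLeq]
        exact hfR.add (hgR.smul hgd _) (hfC.differentiable (by norm_num)) (hgd.const_smul _)
      hasFarField_lap_lap := by
        rw [← hLdef, hLL]
        exact hfLF.add (hLF.smul _) }

/-- The difference v - V equals A(|y|) times the degree-zero extension of Y. It is of class C⁵ even
at the origin, because A vanishes on [0, ρ₀], and beyond ρ₁ it is exactly an outgoing wave. -/
theorem isOutgoing_of_polar {k ρ₀ ρ₁ C : ℝ} (hρ₀ : 0 < ρ₀) (hρ₁ : ρ₀ < ρ₁) {v V : Sp 2 → ℂ}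
    {A : ℝ → ℂ} {Y : USphere 2 → ℂ}
    (hv : ∀ r : ℝ, 0 ≤ r → ∀ θ : USphere 2, v (r • (θ : Sp 2)) = A r * Y θ + V (r • (θ : Sp 2)))
    (hA : ContDiffOn ℝ 5 A (Ici 0)) (hY : ContMDiff (𝓡 1) 𝓘(ℝ, ℂ) 5 Y) (hV : ContDiff ℝ 5 V)
    (hA0 : ∀ x : Sp 2, ‖x‖ ≤ ρ₀ → A ‖x‖ = 0)
    (hC : ∀ x : Sp 2, ‖x‖ ^ (5 / 2 : ℝ) * biharmonicSize V x ≤ C)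
    (hA1 : ∀ ρ : ℝ, ρ₁ < ρ →
      A ρ = Complex.exp (Complex.I * ((k * ρ : ℝ) : ℂ)) / ((ρ ^ (3 / 2 : ℝ) : ℝ) : ℂ)) :
    IsOutgoing k v := by
  set W := angularExt Y with hWdef
  have hW : IsAngular 5 W := isAngular_angularExt hY
  have hg : ∀ y, (v - V) y = A ‖y‖ * W y := fun y => by
    rcases eq_or_ne y 0 with rfl | hy
    · have h := hv 0 le_rfl ⟨EuclideanSpace.single 0 1, by simp⟩
      have h0 := hA0 0 (by simpa using hρ₀.le)
      rw [norm_zero] at h0 ⊢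
      rw [zero_smul, h0, zero_mul, zero_add] at h
      rw [Pi.sub_apply, h, sub_self, h0, zero_mul]
    · have hn : 0 < ‖y‖ := norm_pos_iff.2 hy
      have hθ : ‖y‖⁻¹ • y ∈ Metric.sphere (0 : Sp 2) 1 := by
        rw [mem_sphere_zero_iff_norm, norm_smul, norm_inv, norm_norm, inv_mul_cancel₀ hn.ne']
      have h := hv ‖y‖ hn.le ⟨‖y‖⁻¹ • y, hθ⟩
      have e : ‖y‖ • ‖y‖⁻¹ • y = y := by rw [smul_smul, mul_inv_cancel₀ hn.ne', one_smul]
      simp only [e] at h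
      rw [Pi.sub_apply, h, add_sub_cancel_right, hWdef, angularExt, dif_neg hy]
  have hgC : ContDiff ℝ 5 (v - V) := contDiff_iff_contDiffAt.2 fun y => by
    rcases lt_or_ge ‖y‖ ρ₀ with hy | hy
    · have hev : (v - V) =ᶠ[𝓝 y] fun _ => 0 := by
        filter_upwards [(isOpen_lt continuous_norm continuous_const).mem_nhds hy] with z hz
        rw [hg, hA0 z (le_of_lt hz), zero_mul]
      exact contDiffAt_const.congr_of_eventuallyEq hev
    · have hn : 0 < ‖y‖ := hρ₀.trans_le hy
      have hy0 : y ≠ 0 := norm_pos_iff.1 hn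
      rw [funext hg]
      exact (((hA.contDiffAt (Ici_mem_nhds hn)).comp y (contDiffAt_norm ℝ hy0))).mul
        (hW.contDiffAt hy0)
  have hout : IsOutgoing k (v - V) := by
    refine isOutgoing_of_eq hgC hW (hρ₀.trans hρ₁) fun y hy => ?_
    rw [hg, hA1 _ hy, radFactor, Real.rpow_neg (norm_nonneg y), Complex.ofReal_inv, div_eq_mul_inv]
  have := hout.add (isOutgoing_of_biharmonicSize hV hC)
  rwa [sub_add_cancel] at this

theorem solutionDecaysOn_two {ω c₀ ρ₀ ρ₁ : ℝ} (hω : 0 < ω) (hc₀ : 0 < c₀) (hρ₀ : 0 < ρ₀)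
    (hρ₁ : ρ₀ < ρ₁) {Ω : Set (Sp 2)} {ρ : ℝ} (hΩ : CompactlyInBall Ω ρ) {v₀ v₁ : Sp 2 → ℂ}
    (h : AdmissibleData2D ω c₀ ρ₀ ρ₁ v₀ v₁) : SolutionDecaysOn c₀ Ω v₀ v₁ := by
  obtain ⟨A₀, Y₀, Y₁, V₀, V₁, hv₀, hv₁, hA, hY₀, hY₁, hV₀, hV₁, h0, ⟨C₀, -, hC⟩, hA1⟩ := h
  have hnn : ∀ (f : Sp 2 → ℂ) x, 0 ≤ biharmonicSize f x := fun f x => by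
    unfold biharmonicSize
    positivity
  have hk : 0 < ω / c₀ := div_pos hω hc₀
  have O₀ : IsOutgoing (ω / c₀) v₀ := isOutgoing_of_polar hρ₀ hρ₁ hv₀ hA hY₀ hV₀.1
    (fun x hx => (h0 x hx).1) (fun x => le_trans (mul_le_mul_of_nonneg_left
      (le_add_of_nonneg_right (hnn V₁ x)) (by positivity)) (hC x)) hA1
  have O₁ : IsOutgoing (ω / c₀) v₁ := isOutgoing_of_polar hρ₀ hρ₁ hv₁ hA hY₁ hV₁.1
    (fun x hx => (h0 x hx).1) (fun x => le_trans (mul_le_mul_of_nonneg_left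
      (le_add_of_nonneg_left (hnn V₀ x)) (by positivity)) (hC x)) hA1
  have hLL : ContDiff ℝ 1 (frameLap planeFrame (frameLap planeFrame v₀)) :=
    contDiff_frameLap _ O₀.contDiff_lap (by norm_num)
  refine isFrame_two.solutionDecaysOn hc₀ (O₀.contDiff.of_le (by norm_num))
    (O₁.contDiff.of_le (by norm_num)) hΩ ?_ ?_ ?_ ?_
  · exact decaysLocally_kir_planeFrame hk hc₀ (O₀.contDiff.of_le (by norm_num))
      O₁.contDiff.continuous O₀.hasFarField O₀.radiates O₁.hasFarField
  · exact decaysLocally_kir_planeFrame hk hc₀ (O₁.contDiff.of_le (by norm_num))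
      (O₀.contDiff_lap.continuous.const_smul _) O₁.hasFarField O₁.radiates
      (O₀.hasFarField_lap.smul _)
  · exact decaysLocally_kir_planeFrame hk hc₀ (O₀.contDiff_lap.of_le (by norm_num))
      O₁.contDiff_lap.continuous O₀.hasFarField_lap O₀.radiates_lap O₁.hasFarField_lap
  · exact decaysLocally_kir_planeFrame hk hc₀ (O₁.contDiff_lap.of_le (by norm_num))
      (hLL.continuous.const_smul _) O₁.hasFarField_lap O₁.radiates_lap
      (O₀.hasFarField_lap_lap.smul _)

end WaveDecay
end

theorem lemma2p3 (ω c₀ ρ₀ ρ₁ : ℝ) (hω : 0 < ω) (hc₀ : 0 < c₀) (hρ₀ : 0 < ρ₀) (hρ₁ : ρ₀ < ρ₁) :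
    (∀ Ω : Set (WaveDecay.Sp 2), WaveDecay.CompactlyInBall Ω ρ₀ →
      ∀ v₀ v₁ : WaveDecay.Sp 2 → ℂ, WaveDecay.AdmissibleData2D ω c₀ ρ₀ ρ₁ v₀ v₁ →
        WaveDecay.SolutionDecaysOn c₀ Ω v₀ v₁) ∧
    (∀ Ω : Set (WaveDecay.Sp 3), WaveDecay.CompactlyInBall Ω ρ₀ →
      ∀ v₀ v₁ : WaveDecay.Sp 3 → ℂ, WaveDecay.AdmissibleData3D v₀ v₁ →
        WaveDecay.SolutionDecaysOn c₀ Ω v₀ v₁) := by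
  exact ⟨fun _ hΩ _ _ h => WaveDecay.solutionDecaysOn_two hω hc₀ hρ₀ hρ₁ hΩ h,
    fun _ hΩ _ _ h => WaveDecay.solutionDecaysOn_three hc₀ hΩ h⟩
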